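/- Let $G=(V,E)$ be a finite simple undirected graph and write $N[u]$ for the closed neighbourhood of $u$. For $S\subseteq V$ let $P_1(S)=\bigcup_{v\in S}N[v]$ and, for $r\ge 2$, let $P_r(S)=P_{r-1}(S)\cup\{v:\ \exists u,\ uv\in E,\ N[u]\setminus\{v\}\subseteq P_{r-1}(S)\}$. A tree decomposition of $G$ consists of a tree $T$ and a bag $X_i\subseteq V$ for every node $i$ of $T$ such that every vertex lies in some bag, every edge has both ends in some bag, and $X_i\cap X_k\subseteq X_j$ whenever $j$ lies on the path from $i$ to $k$ in $T$; its width is $\max_i|X_i|-1$, and the tree-width of $G$ is the minimum width of a tree decomposition. Theorem. There are an algorithm and a global constant $c>1$ with the following property. The input consists of a nonempty graph $G=(V,E)$, a set $V'\subseteq V$, an integer $\ell\ge 1$, and a tree decomposition of $G$ of width $k$ with $O(|V|)$ nodes (for example one of minimum width, in which case $k$ is the tree-width of $G$). The algorithm computes a set $S\subseteq V$ of minimum size subject to $V'\subseteq P_\ell(S)$ in time $$O\bigl(c^{\,m_e+k\log(\ell+1)}\cdot|V|\bigr),$$ where $m_e$ is the maximum, over all bags $X_i$, of the number of edges of $G$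 with both ends in $X_i$. The constant hidden in $O(\cdot)$ depends only on the constant in the bound on the number of nodes of the tree. Here time is measured on a random access machine whose unit-cost operations on natural numbers are addition, truncated subtraction, comparison and indirect memory access. The graph and the tree are given by lists of their edges, $V'$ by its characteristic function and the bags by lists of their elements, all in arbitrary order; the output is the characteristic function of $S$. -/

import Mathlib

/-! ## Power domination with bounded propagation -/

/-- The closed neighbourhood `N[u]` of a vertex. -/
def closedNbhd {V : Type*} (G : SimpleGraph V) (u : V) : Set V :=
  insert u (G.neighborSet u)

/-- `powerDom G S r` is the set `P_r(S)` of vertices that are power dominated by `S` within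
`r ≥ 1` parallel rounds: the first round is domination, and in each further round every vertex `u`
whose closed neighbourhood, except for one neighbour `v`, is already power dominated, power
dominates `v`.  (The value for `r = 0` is never used.) -/
def powerDom {V : Type*} (G : SimpleGraph V) (S : Set V) : ℕ → Set V
  | 0 => ∅
  | 1 => ⋃ v ∈ S, closedNbhd G v
  | r + 2 => powerDom G S (r + 1) ∪
      {v | ∃ u, G.Adj u v ∧ closedNbhd G u \ {v} ⊆ powerDom G S (r + 1)}

/-- `S` is a vertex set of minimum size among those with `V' ⊆ P_ℓ(S)`: an optimal solution of the
generalized `ℓ`-round power dominating set problem for the pair `⟨G, V'⟩`. -/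
def IsMinPowerDom {V : Type*} (G : SimpleGraph V) (V' : Finset V) (ℓ : ℕ) (S : Finset V) : Prop :=
  (V' : Set V) ⊆ powerDom G (S : Set V) ℓ ∧
    ∀ S' : Finset V, (V' : Set V) ⊆ powerDom G (S' : Set V) ℓ → S.card ≤ S'.card

/-! ## Tree decompositions -/

/-- A tree decomposition of `G` whose tree has the node set `I`. -/
structure TreeDecomposition {V : Type*} (G : SimpleGraph V) (I : Type*) where
  /-- the tree -/
  tree : SimpleGraph I
  isTree : tree.IsTree
  /-- the bags -/
  bag : I → Finset V
  exists_mem_bag : ∀ v, ∃ i, v ∈ bag i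
  exists_adj_bag : ∀ u v, G.Adj u v → ∃ i, u ∈ bag i ∧ v ∈ bag i
  bag_of_path : ∀ (i j k : I) (p : tree.Walk i k), p.IsPath → j ∈ p.support →
    ∀ v, v ∈ bag i → v ∈ bag k → v ∈ bag j

/-- The width: the maximum size of a bag, minus one.  (It is used for nonempty graphs only, where
some bag is nonempty.) -/
def TreeDecomposition.width {V I : Type*} [Fintype I] {G : SimpleGraph V}
    (D : TreeDecomposition G I) : ℕ :=
  (Finset.univ.sup fun i => (D.bag i).card) - 1

/-- The maximum, over all bags, of the number of edges of `G` with both ends in the bag. -/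
noncomputable def TreeDecomposition.maxBagEdges {V I : Type*} [Fintype I] {G : SimpleGraph V}
    (D : TreeDecomposition G I) : ℕ :=
  Finset.univ.sup fun i => {e ∈ G.edgeSet | ∀ v ∈ e, v ∈ D.bag i}.ncard

/-! ## Random access machines with unit costs

The memory consists of registers and of arrays, each cell holding a natural number.  The available
operations are addition, truncated subtraction, comparison, and indirect reading and writing; there
is no multiplication.  Every operation has cost one.  A program is a fixed finite object, so it
uses finitely many registers and arrays. -/

namespace RAM

/-- The contents of the memory: `reg x` is register `x`, and `arr a i` is cell `i` of array `a`. -/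
structure State where
  reg : ℕ → ℕ
  arr : ℕ → ℕ → ℕ

/-- The memory after `v` is written to register `x`. -/
def State.setReg (σ : State) (x v : ℕ) : State :=
  { σ with reg := Function.update σ.reg x v }

/-- The memory after `v` is written to cell `i` of array `a`. -/
def State.setArr (σ : State) (a i v : ℕ) : State :=
  { σ with arr := Function.update σ.arr a (Function.update (σ.arr a) i v) }

/-- Expressions. -/
inductive Expr where
  | lit (v : ℕ)
  | reg (x : ℕ)
  | get (a : ℕ) (i : Expr)
  | add (e f : Expr)
  | sub (e f : Expr)
  | lt (e f : Expr)
  | eq (e f : Expr)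

/-- The value of an expression; a comparison has value `1` if it holds and `0` if it does not. -/
def Expr.eval (σ : State) : Expr → ℕ
  | .lit v => v
  | .reg x => σ.reg x
  | .get a i => σ.arr a (i.eval σ)
  | .add e f => e.eval σ + f.eval σ
  | .sub e f => e.eval σ - f.eval σ
  | .lt e f => if e.eval σ < f.eval σ then 1 else 0
  | .eq e f => if e.eval σ = f.eval σ then 1 else 0

/-- The cost of evaluating an expression: the number of its constituents. -/
def Expr.cost : Expr → ℕ
  | .lit _ => 1
  | .reg _ => 1
  | .get _ i => i.cost + 1
  | .add e f => e.cost + f.cost + 1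
  | .sub e f => e.cost + f.cost + 1
  | .lt e f => e.cost + f.cost + 1
  | .eq e f => e.cost + f.cost + 1

/-- Programs. -/
inductive Prog where
  | skip
  | assign (x : ℕ) (e : Expr)
  | store (a : ℕ) (i e : Expr)
  | seq (p q : Prog)
  | ite (b : Expr) (p q : Prog)
  | loop (b : Expr) (p : Prog)

/-- `Exec p σ t σ'`: started with memory `σ`, the program `p` halts after exactly `t` steps with
memory `σ'`.  The program `loop b p` repeats `p` while `b` has a nonzero value. -/
inductive Exec : Prog → State → ℕ → State → Prop
  | skip (σ : State) : Exec .skip σ 1 σ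
  | assign (x : ℕ) (e : Expr) (σ : State) :
      Exec (.assign x e) σ (e.cost + 1) (σ.setReg x (e.eval σ))
  | store (a : ℕ) (i e : Expr) (σ : State) :
      Exec (.store a i e) σ (i.cost + e.cost + 1) (σ.setArr a (i.eval σ) (e.eval σ))
  | seq {p q : Prog} {σ σ' σ'' : State} {t t' : ℕ} :
      Exec p σ t σ' → Exec q σ' t' σ'' → Exec (.seq p q) σ (t + t') σ''
  | ite_true {b : Expr} {p q : Prog} {σ σ' : State} {t : ℕ} :
      b.eval σ ≠ 0 → Exec p σ t σ' → Exec (.ite b p q) σ (b.cost + 1 + t) σ'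
  | ite_false {b : Expr} {p q : Prog} {σ σ' : State} {t : ℕ} :
      b.eval σ = 0 → Exec q σ t σ' → Exec (.ite b p q) σ (b.cost + 1 + t) σ'
  | loop_true {b : Expr} {p : Prog} {σ σ' σ'' : State} {t t' : ℕ} :
      b.eval σ ≠ 0 → Exec p σ t σ' → Exec (.loop b p) σ' t' σ'' →
        Exec (.loop b p) σ (b.cost + 1 + t + t') σ''
  | loop_false {b : Expr} {p : Prog} {σ : State} :
      b.eval σ = 0 → Exec (.loop b p) σ (b.cost + 1) σ

end RAM

/-! ## Inputs and outputs -/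

/-- `E` lists every edge of `G` exactly once, in any order, with its ends in any order. -/
def IsEdgeList {V : Type*} (G : SimpleGraph V) (E : List (V × V)) : Prop :=
  (E.map fun p => s(p.1, p.2)).Nodup ∧
    ∀ e : Sym2 V, e ∈ G.edgeSet ↔ e ∈ E.map fun p => s(p.1, p.2)

/-- `B` lists, for every node of the tree, the elements of its bag without repetition, in any
order. -/
def IsBagList {V I : Type*} {G : SimpleGraph V} (D : TreeDecomposition G I)
    (B : I → List V) : Prop :=
  ∀ i, (B i).Nodup ∧ ∀ v, v ∈ B i ↔ v ∈ D.bag i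

/-- The initial memory for a graph on `{0, …, n-1}` with edge list `E`, a set `V'` of vertices, the
number `ℓ` of rounds, and a tree decomposition with tree nodes `{0, …, N-1}`, tree edge list `F`
and bag lists `B`.  Registers `0` to `4` hold `n`, `|E|`, `N`, `|F|`, `ℓ`.  Arrays `0` and `1` hold
the ends of the edges of the graph, array `2` the characteristic function of `V'`, arrays `3` and
`4` the ends of the tree edges; array `6` is the concatenation of the bag lists, where the list of
node `i` starts at the position that is held by cell `i` of array `5` and ends before the one held
by cell `i + 1`.  All other cells are zero. -/
def inputState {n N : ℕ} (E : List (Fin n × Fin n)) (V' : Finset (Fin n)) (ℓ : ℕ)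
    (F : List (Fin N × Fin N)) (B : Fin N → List (Fin n)) : RAM.State where
  reg x := [n, E.length, N, F.length, ℓ].getD x 0
  arr a i :=
    match a with
    | 0 => (E.map fun p => p.1.val).getD i 0
    | 1 => (E.map fun p => p.2.val).getD i 0
    | 2 => (List.ofFn fun v => if v ∈ V' then 1 else 0).getD i 0
    | 3 => (F.map fun p => p.1.val).getD i 0
    | 4 => (F.map fun p => p.2.val).getD i 0
    | 5 => ((List.range (N + 1)).map fun j => ((List.ofFn B).take j).flatten.length).getD i 0
    | 6 => ((List.ofFn B).flatten.map Fin.val).getD i 0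
    | _ => 0

/-- In the memory `σ`, array `7` holds the characteristic function of `S`. -/
def IsOutput {n : ℕ} (σ : RAM.State) (S : Finset (Fin n)) : Prop :=
  ∀ v : Fin n, σ.arr 7 v = if v ∈ S then 1 else 0

/-!
Optimal power dominating sets with bounded propagation, by dynamic programming over a tree
decomposition on a random access machine.

*Local checkability.* That `S` power dominates `V'` within `ℓ` rounds is witnessed by two labels
per vertex: a round `t u` by which `u` is dominated (`0` for the elements of `S`), and a round
`f u` from which on `u` can force, because at most one of its neighbours is then left. All
conditions on the labels (`IsCert`) relate a vertex to its neighbours, and only numbers of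
neighbours matter: at most one neighbour `w` has `f u ≤ t w`, and at least one neighbour helps to
dominate `u`. Certificates are sound (`IsCert.mem_powerDom`), and every solution has one with
labels at most `ℓ + 2` (`exists_isCert`).

*Dynamic program.* The tree is rooted, with an additional root that has an empty bag, and its
nodes are merged into their parents one by one, bottom-up. A state of a node holds, for every
vertex of the bag, the two labels and two counters that saturate at two. A vertex is forgotten
when a node is merged whose parent does not contain it; an edge is accounted for when the first of
its ends is forgotten, which happens in a bag that contains both. The counters of a vertex in the
nodes that are not yet merged always add up, up to saturation, to the number of relevant
neighbours forgotten so far (`IsCounter.conserved`); so when the vertex itself is forgotten, one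
counter has seen all neighbours (`IsCounter.final`), and the conditions on the vertex can be
checked. Therefore the choices of compatible states (`IsRun`) correspond to the certificates
(`IsRun.cert`, `Cert.exists_run`). The tables give a lower bound for the cost of all runs
(`IsRun.le_tab`), and pointers to the states that attain the entries lead to a run of that cost
(`IsPointer.exists_run`), hence to an optimal solution (`IsPointer.optimal`).

*Implementation.* States are numbers with `4 * K + 1` digits in base `ℓ + 3`, where `K` is the
maximum size of a bag; there are `M = (ℓ + 3) ^ (4 * K + 1)` of them. The machine can neither
multiply nor divide, so all addresses and digits are tabulated in advance. A bottom-up order of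
the tree is found by successive elimination of leaves: with the degree of each node and the sum of
its neighbours at hand, the parent of a leaf is the sum that is left (`QInv.step`). Programs are
verified in a small program logic with a rule for loops (`Runs.for`) and a frame rule that is read
off from the text of the program (`Exec.agree`).

*Running time.* It is at most a constant times `Z * M ^ 5`, where `Z` is the number of vertices,
edges, tree nodes and tree edges (`Dom.mainTime`). Every edge lies in a bag, so
`Z = O(n * M ^ 2)`, and `M ^ 7` is single exponential in `k * log (ℓ + 1)` as soon as `k ≥ 1`
(`states_le`). If no bag has two elements, the graph has no edges, and `ℓ` can be replaced by `1`,
so that `M` is bounded. The bound thus holds even without the term for the number of edges inside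
a bag, which only makes the stated bound larger.
-/

namespace RAM

/-! ### A program logic for the random access machine -/

instance : Add Expr := ⟨.add⟩
instance : Sub Expr := ⟨.sub⟩

/-- The truth value of `e ≤ f`. -/
def Expr.le (e f : Expr) : Expr := .lt e (f + .lit 1)
/-- The truth value of `e = 0`; as a connective, negation. -/
def Expr.not (e : Expr) : Expr := .eq e (.lit 0)
/-- Conjunction, where nonzero values count as true. -/
def Expr.and (e f : Expr) : Expr := .not (e.not + f.not)
/-- Disjunction, where nonzero values count as true. -/
def Expr.or (e f : Expr) : Expr := .lt (.lit 0) (e + f)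

section eval
variable (σ : State) (e f : Expr)

@[simp] theorem Expr.eval_lit (v : ℕ) : (Expr.lit v).eval σ = v := rfl
@[simp] theorem Expr.eval_reg (x : ℕ) : (Expr.reg x).eval σ = σ.reg x := rfl
@[simp] theorem Expr.eval_get (a : ℕ) : (Expr.get a e).eval σ = σ.arr a (e.eval σ) := rfl
@[simp] theorem Expr.eval_add : (e + f).eval σ = e.eval σ + f.eval σ := rfl
@[simp] theorem Expr.eval_sub : (e - f).eval σ = e.eval σ - f.eval σ := rfl
@[simp] theorem Expr.eval_lt :
    (Expr.lt e f).eval σ = if e.eval σ < f.eval σ then 1 else 0 := rfl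
@[simp] theorem Expr.eval_eq :
    (Expr.eq e f).eval σ = if e.eval σ = f.eval σ then 1 else 0 := rfl
@[simp] theorem Expr.eval_le :
    (Expr.le e f).eval σ = if e.eval σ ≤ f.eval σ then 1 else 0 := by
  simp [Expr.le]
@[simp] theorem Expr.eval_not : e.not.eval σ = if e.eval σ = 0 then 1 else 0 := rfl
@[simp] theorem Expr.eval_and :
    (e.and f).eval σ = if e.eval σ ≠ 0 ∧ f.eval σ ≠ 0 then 1 else 0 := by
  by_cases he : e.eval σ = 0 <;> by_cases hf : f.eval σ = 0 <;> simp [Expr.and, he, hf]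
@[simp] theorem Expr.eval_or :
    (e.or f).eval σ = if e.eval σ ≠ 0 ∨ f.eval σ ≠ 0 then 1 else 0 := by
  by_cases he : e.eval σ = 0 <;> by_cases hf : f.eval σ = 0 <;>
    simp [Expr.or, he, hf, Nat.pos_iff_ne_zero]

@[simp] theorem State.setReg_reg (x v y : ℕ) :
    (σ.setReg x v).reg y = if y = x then v else σ.reg y := by
  simp [State.setReg, Function.update_apply]
@[simp] theorem State.setReg_arr (x v : ℕ) : (σ.setReg x v).arr = σ.arr := rfl
@[simp] theorem State.setArr_reg (a i v : ℕ) : (σ.setArr a i v).reg = σ.reg := rfl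
@[simp] theorem State.setArr_arr (a i v b : ℕ) :
    (σ.setArr a i v).arr b = if b = a then Function.update (σ.arr a) i v else σ.arr b := by
  simp [State.setArr, Function.update_apply]

end eval

/-- Whether a program contains an assignment to register `x`. -/
def Prog.wr (x : ℕ) : Prog → Bool
  | .skip => false
  | .assign y _ => y == x
  | .store _ _ _ => false
  | .seq p q => p.wr x || q.wr x
  | .ite _ p q => p.wr x || q.wr x
  | .loop _ p => p.wr x

/-- Whether a program contains a store to array `a`. -/
def Prog.wa (a : ℕ) : Prog → Bool
  | .skip => false
  | .assign _ _ => false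
  | .store b _ _ => b == a
  | .seq p q => p.wa a || q.wa a
  | .ite _ p q => p.wa a || q.wa a
  | .loop _ p => p.wa a

/-- The two memories differ at most in the registers and arrays that `p` writes to. -/
structure Agree (p : Prog) (σ σ' : State) : Prop where
  reg : ∀ x, p.wr x = false → σ'.reg x = σ.reg x
  arr : ∀ a, p.wa a = false → σ'.arr a = σ.arr a

theorem Agree.refl (p : Prog) (σ : State) : Agree p σ σ := ⟨fun _ _ => rfl, fun _ _ => rfl⟩

theorem Agree.trans {p : Prog} {σ σ' σ'' : State} (h : Agree p σ σ') (h' : Agree p σ' σ'') :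
    Agree p σ σ'' :=
  ⟨fun x hx => (h'.reg x hx).trans (h.reg x hx), fun a ha => (h'.arr a ha).trans (h.arr a ha)⟩

theorem Agree.mono {p q : Prog} {σ σ' : State} (h : Agree p σ σ')
    (hr : ∀ x, q.wr x = false → p.wr x = false) (ha : ∀ a, q.wa a = false → p.wa a = false) :
    Agree q σ σ' :=
  ⟨fun x hx => h.reg x (hr x hx), fun a hq => h.arr a (ha a hq)⟩

/-- The frame rule: a run changes only what the text of the program mentions as written. -/
theorem Exec.agree {p : Prog} {σ σ' : State} {t : ℕ} (h : Exec p σ t σ') : Agree p σ σ' := by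
  induction h with
  | skip => exact Agree.refl _ _
  | assign x e σ =>
    refine ⟨fun y hy => ?_, fun a _ => rfl⟩
    have : y ≠ x := by rintro rfl; simp [Prog.wr] at hy
    simp [this]
  | store a i e σ =>
    refine ⟨fun y _ => rfl, fun b hb => ?_⟩
    have : b ≠ a := by rintro rfl; simp [Prog.wa] at hb
    simp [this]
  | seq _ _ h₁ h₂ =>
    refine Agree.trans (h₁.mono ?_ ?_) (h₂.mono ?_ ?_) <;> simp +contextual [Prog.wr, Prog.wa]
  | ite_true _ _ h => refine h.mono ?_ ?_ <;> simp +contextual [Prog.wr, Prog.wa]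
  | ite_false _ _ h => refine h.mono ?_ ?_ <;> simp +contextual [Prog.wr, Prog.wa]
  | loop_true _ _ _ h₁ h₂ =>
    refine Agree.trans (h₁.mono ?_ ?_) h₂ <;> simp +contextual [Prog.wr, Prog.wa]
  | loop_false => exact Agree.refl _ _

/-- `Runs p σ T Q`: started with memory `σ`, the program `p` halts within `T` steps with a memory
that satisfies `Q`. -/
def Runs (p : Prog) (σ : State) (T : ℕ) (Q : State → Prop) : Prop :=
  ∃ t σ', Exec p σ t σ' ∧ t ≤ T ∧ Q σ'

theorem Runs.mono {p : Prog} {σ : State} {T T' : ℕ} {Q Q' : State → Prop} (h : Runs p σ T Q)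
    (hT : T ≤ T') (hQ : ∀ σ', Agree p σ σ' → Q σ' → Q' σ') : Runs p σ T' Q' := by
  obtain ⟨t, σ', he, ht, hq⟩ := h
  exact ⟨t, σ', he, ht.trans hT, hQ _ he.agree hq⟩

theorem Runs.seq {p q : Prog} {σ : State} {T T' : ℕ} {Q R : State → Prop} (h : Runs p σ T R)
    (h' : ∀ σ', Agree p σ σ' → R σ' → Runs q σ' T' Q) : Runs (.seq p q) σ (T + T') Q := by
  obtain ⟨t, σ', he, ht, hq⟩ := h
  obtain ⟨t', σ'', he', ht', hq'⟩ := h' σ' he.agree hq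
  exact ⟨_, _, .seq he he', Nat.add_le_add ht ht', hq'⟩

/-! ### Programs without loops -/

/-- The effect of a program without loops (of the program with its loops removed, in general). -/
def Prog.den : Prog → State → State
  | .skip, σ => σ
  | .assign x e, σ => σ.setReg x (e.eval σ)
  | .store a i e, σ => σ.setArr a (i.eval σ) (e.eval σ)
  | .seq p q, σ => q.den (p.den σ)
  | .ite b p q, σ => if b.eval σ ≠ 0 then p.den σ else q.den σ
  | .loop _ _, σ => σ

/-- Whether a program has no loops. -/
def Prog.flat : Prog → Bool
  | .seq p q => p.flat && q.flat
  | .ite _ p q => p.flat && q.flat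
  | .loop _ _ => false
  | _ => true

/-- An upper bound for the running time of a program without loops. -/
def Prog.size : Prog → ℕ
  | .skip => 1
  | .assign _ e => e.cost + 1
  | .store _ i e => i.cost + e.cost + 1
  | .seq p q => p.size + q.size
  | .ite b p q => b.cost + 1 + (p.size + q.size)
  | .loop _ _ => 0

theorem Prog.runs_flat {p : Prog} (hp : p.flat = true) (σ : State) :
    Runs p σ p.size (fun σ' => σ' = p.den σ) := by
  induction p generalizing σ with
  | skip => exact ⟨_, _, .skip _, le_rfl, rfl⟩
  | assign x e => exact ⟨_, _, .assign _ _ _, le_rfl, rfl⟩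
  | store a i e => exact ⟨_, _, .store _ _ _ _, le_rfl, rfl⟩
  | seq p q hp' hq' =>
    simp only [Prog.flat, Bool.and_eq_true] at hp
    refine (hp' hp.1 σ).seq fun σ' _ h => ?_
    subst h
    exact hq' hp.2 _
  | ite b p q hp' hq' =>
    simp only [Prog.flat, Bool.and_eq_true] at hp
    by_cases hb : b.eval σ = 0
    · obtain ⟨t, σ', he, ht, rfl⟩ := hq' hp.2 σ
      exact ⟨_, _, .ite_false hb he, by simp only [Prog.size]; omega, by simp [Prog.den, hb]⟩
    · obtain ⟨t, σ', he, ht, rfl⟩ := hp' hp.1 σ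
      exact ⟨_, _, .ite_true hb he, by simp only [Prog.size]; omega, by simp [Prog.den, hb]⟩
  | loop => simp [Prog.flat] at hp

theorem Runs.flat {p : Prog} {σ : State} {T : ℕ} {Q : State → Prop} (hp : p.flat = true)
    (hT : p.size ≤ T) (hQ : Q (p.den σ)) : Runs p σ T Q :=
  (Prog.runs_flat hp σ).mono hT fun _ _ h => h ▸ hQ

/-- `for x in lo..hi do p`; the upper bound is evaluated before every iteration. -/
def Prog.for (x : ℕ) (lo hi : Expr) (p : Prog) : Prog :=
  .seq (.assign x lo) (.loop (.lt (.reg x) hi) (.seq p (.assign x (.reg x + .lit 1))))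

/-- The rule for `for`-loops.  The invariant `I` is indexed by the value of the counter `x`.  By the
frame rule, the invariant need not mention what the loop does not write to: this is available as
`Agree`, relative to the memory before the loop. -/
theorem Runs.for {x : ℕ} {lo hi : Expr} {p : Prog} {σ₀ : State} {m k T : ℕ}
    (I : ℕ → State → Prop) (hx : p.wr x = false) (hm : lo.eval σ₀ = m) (hmk : m ≤ k)
    (h0 : I m (σ₀.setReg x m))
    (hhi : ∀ σ i, Agree (.for x lo hi p) σ₀ σ → I i σ → hi.eval σ = k)
    (hp : ∀ i σ, m ≤ i → i < k → Agree (.for x lo hi p) σ₀ σ → σ.reg x = i → I i σ →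
      Runs p σ T (fun σ' => I (i + 1) (σ'.setReg x (i + 1)))) :
    Runs (.for x lo hi p) σ₀ ((k - m + 1) * (T + (lo.cost + hi.cost + 10))) (I k) := by
  subst hm
  have key : ∀ d i σ, lo.eval σ₀ ≤ i → i + d = k → Agree (.for x lo hi p) σ₀ σ → σ.reg x = i →
      I i σ → Runs (.loop (.lt (.reg x) hi) (.seq p (.assign x (.reg x + .lit 1)))) σ
        (d * (T + (hi.cost + 8)) + (hi.cost + 3)) (I k) := by
    intro d
    induction d with
    | zero =>
      intro i σ hi' hd hA hxi hI
      obtain rfl : i = k := by omega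
      refine ⟨_, _, .loop_false ?_, ?_, hI⟩
      · simp [hhi σ i hA hI, hxi]
      · simp only [Expr.cost]; omega
    | succ d ih =>
      intro i σ hi' hd hA hxi hI
      obtain ⟨t, σ', he, ht, hI'⟩ := hp i σ hi' (by omega) hA hxi hI
      have hx' : σ'.reg x = i := (he.agree.reg x hx).trans hxi
      have hb : Exec (.seq p (.assign x (.reg x + .lit 1))) σ (t + 4)
          (σ'.setReg x (i + 1)) := by
        have := Exec.seq he (Exec.assign x (.reg x + .lit 1) σ')
        simpa [hx', Expr.cost, show (Expr.reg x + Expr.lit 1).cost = 3 from rfl] using this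
      have hA' : Agree (.for x lo hi p) σ₀ (σ'.setReg x (i + 1)) := by
        refine hA.trans (hb.agree.mono ?_ ?_) <;>
          simp +contextual [Prog.for, Prog.wr, Prog.wa]
      obtain ⟨t', σ'', he', ht', hQ⟩ := ih (i + 1) _ (by omega) (by omega) hA' (by simp) hI'
      refine ⟨_, σ'', .loop_true ?_ hb he', ?_, hQ⟩
      · simp [hhi σ i hA hI, hxi]; omega
      · simp only [Expr.cost]; rw [Nat.succ_mul]; omega
  have hA0 : Agree (.for x lo hi p) σ₀ (σ₀.setReg x (lo.eval σ₀)) := by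
    refine ⟨fun y hy => ?_, fun _ _ => rfl⟩
    have : y ≠ x := by rintro rfl; simp [Prog.for, Prog.wr] at hy
    simp [this]
  obtain ⟨t, σ', he, ht, hQ⟩ := key (k - lo.eval σ₀) _ _ le_rfl (by omega) hA0 (by simp) h0
  refine ⟨_, σ', .seq (Exec.assign x lo σ₀) he, ?_, hQ⟩
  have : (k - lo.eval σ₀) * (T + (hi.cost + 8)) ≤
      (k - lo.eval σ₀) * (T + (lo.cost + hi.cost + 10)) :=
    Nat.mul_le_mul_left _ (by omega)
  rw [Nat.succ_mul]
  omega

end RAM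

/-! ### Timed certificates for power domination -/

/-- `t` assigns to every vertex a round by which it is power dominated (`0` for the vertices of
`S`, more than `ℓ` for no claim), and `f` assigns to every vertex a round from which on it can
force.  All conditions refer to a vertex and its neighbours only. -/
structure IsCert {V : Type*} (G : SimpleGraph V) (V' : Finset V) (ℓ : ℕ) (t f : V → ℕ) : Prop where
  lt : ∀ u, t u < f u
  unique : ∀ u w w', G.Adj u w → G.Adj u w' → f u ≤ t w → f u ≤ t w' → w = w'
  cause : ∀ u, t u = 0 ∨ ℓ < t u ∨ ∃ w, G.Adj u w ∧ (t w = 0 ∨ f w ≤ t u)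
  target : ∀ u ∈ V', t u ≤ ℓ

theorem powerDom_mono {V : Type*} (G : SimpleGraph V) (S : Set V) {r s : ℕ} (hr : 1 ≤ r)
    (h : r ≤ s) : powerDom G S r ⊆ powerDom G S s := by
  induction s, h using Nat.le_induction with
  | base => exact subset_rfl
  | succ s hs ih =>
    obtain ⟨k, rfl⟩ : ∃ k, s = k + 1 := ⟨s - 1, by omega⟩
    exact ih.trans fun v hv => Or.inl hv

theorem self_mem_powerDom {V : Type*} (G : SimpleGraph V) {S : Set V} {v : V} (hv : v ∈ S) {r : ℕ}
    (hr : 1 ≤ r) : v ∈ powerDom G S r :=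
  powerDom_mono G S le_rfl hr (Set.mem_biUnion hv (Set.mem_insert _ _))

theorem adj_mem_powerDom {V : Type*} (G : SimpleGraph V) {S : Set V} {u v : V} (hv : v ∈ S)
    (h : G.Adj u v) {r : ℕ} (hr : 1 ≤ r) : u ∈ powerDom G S r :=
  powerDom_mono G S le_rfl hr (Set.mem_biUnion hv (Set.mem_insert_of_mem _ h.symm))

/-- Certificates are sound: a vertex is power dominated by the round that `t` claims for it. -/
theorem IsCert.mem_powerDom {V : Type*} {G : SimpleGraph V} {V' : Finset V} {ℓ : ℕ} {t f : V → ℕ}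
    (h : IsCert G V' ℓ t f) {S : Set V} (hS : ∀ v, v ∈ S ↔ t v = 0) (r : ℕ) :
    ∀ u, t u ≤ r → r ≤ ℓ → 1 ≤ r → u ∈ powerDom G S r := by
  induction r with
  | zero => intro u _ _ h; omega
  | succ r ih =>
    intro u hu hr _
    by_cases hur : t u ≤ r ∧ 1 ≤ r
    · exact powerDom_mono G S hur.2 (Nat.le_succ r) (ih u hur.1 (by omega) hur.2)
    by_cases hu0 : t u = 0
    · exact self_mem_powerDom G ((hS u).2 hu0) (by omega)
    obtain ⟨w, hw, hw'⟩ := ((h.cause u).resolve_left hu0).resolve_left (by omega)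
    by_cases hw0 : t w = 0
    · exact adj_mem_powerDom G ((hS w).2 hw0) hw (by omega)
    have hfw := hw'.resolve_left hw0
    have hlt := h.lt w
    -- here `t w ≥ 1`, so the round `t u = r + 1` is at least the second one
    obtain ⟨k, rfl⟩ : ∃ k, r = k + 1 := ⟨r - 1, by omega⟩
    refine Or.inr ⟨w, hw.symm, ?_⟩
    rintro x ⟨hx, hxu⟩
    refine ih x ?_ (by omega) (by omega)
    rcases hx with rfl | hx
    · omega
    · by_contra hxt
      exact hxu (h.unique w x u hx hw.symm (by omega) (by omega))

open Classical in
/-- Certificates are complete: every solution has one, whose values are small. Take for `t` the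
actual round in which a vertex is dominated, and for `f` the least value that the conditions allow.
-/
theorem exists_isCert {V : Type*} {G : SimpleGraph V} {V' : Finset V} {ℓ : ℕ} {S : Finset V}
    (hS : (V' : Set V) ⊆ powerDom G (S : Set V) ℓ) :
    ∃ t f, IsCert G V' ℓ t f ∧ (∀ v, t v = 0 ↔ v ∈ S) ∧ (∀ v, t v ≤ ℓ + 1) ∧
      ∀ v, f v ≤ ℓ + 2 := by
  -- the actual round in which a vertex is dominated
  have ht : ∀ v, ∃ t, t ≤ ℓ + 1 ∧ (t = 0 ↔ v ∈ S) ∧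
      ∀ r, 1 ≤ r → r ≤ ℓ → (t ≤ r ↔ v ∈ powerDom G (S : Set V) r) := by
    intro v
    by_cases hv : v ∈ S
    · refine ⟨0, by omega, by simp [hv], fun r hr _ => ?_⟩
      simp [self_mem_powerDom G (S := (S : Set V)) (by exact_mod_cast hv) hr]
    have hex : ∃ t, 1 ≤ t ∧ (ℓ < t ∨ v ∈ powerDom G (S : Set V) t) :=
      ⟨ℓ + 1, by omega, Or.inl (by omega)⟩
    refine ⟨Nat.find hex, Nat.find_min' hex ⟨by omega, Or.inl (by omega)⟩, ?_, fun r hr hrl => ?_⟩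
    · have := (Nat.find_spec hex).1
      simp only [hv, iff_false]; omega
    · constructor
      · intro h
        have := Nat.find_spec hex
        exact powerDom_mono G _ this.1 h (this.2.resolve_left (by omega))
      · intro h
        exact Nat.find_min' hex ⟨hr, Or.inr h⟩
  choose t htl ht0 htr using ht
  -- the first round from which on at most one neighbour is left
  have hf : ∀ u, ∃ f, t u < f ∧ ∀ w w', G.Adj u w → G.Adj u w' → f ≤ t w → f ≤ t w' → w = w' :=
    fun u => ⟨ℓ + 2, by have := htl u; omega, fun w _ _ _ h _ => by have := htl w; omega⟩
  refine ⟨t, fun u => Nat.find (hf u), ⟨fun u => (Nat.find_spec (hf u)).1,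
    fun u => (Nat.find_spec (hf u)).2, fun u => ?_, fun u hu => ?_⟩, ht0, htl, fun u => ?_⟩
  · by_cases hu0 : t u = 0
    · exact Or.inl hu0
    by_cases hul : ℓ < t u
    · exact Or.inr (Or.inl hul)
    refine Or.inr (Or.inr ?_)
    have hmem := (htr u (t u) (by omega) (by omega)).1 le_rfl
    obtain ⟨r, hr⟩ : ∃ r, t u = r + 1 := ⟨t u - 1, by omega⟩
    rw [hr] at hmem
    cases r with
    | zero =>
      simp only [powerDom, Set.mem_iUnion] at hmem
      obtain ⟨v, hv, huv⟩ := hmem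
      rcases huv with rfl | huv
      · exact absurd ((ht0 _).2 (by exact_mod_cast hv)) hu0
      · exact ⟨v, SimpleGraph.Adj.symm huv, Or.inl ((ht0 _).2 (by exact_mod_cast hv))⟩
    | succ r =>
      rcases hmem with hmem | ⟨w, hw, hN⟩
      · have := (htr u (r + 1) (by omega) (by omega)).2 hmem
        omega
      · refine ⟨w, hw.symm, Or.inr (Nat.find_min' _ ⟨?_, ?_⟩)⟩
        · have := (htr w (r + 1) (by omega) (by omega)).2
            (hN ⟨Set.mem_insert _ _, fun h => hw.ne h⟩)
          omega
        · have : ∀ x, G.Adj w x → t u ≤ t x → x = u := by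
            intro x hx hxt
            by_contra hxu
            have := (htr x (r + 1) (by omega) (by omega)).2
              (hN ⟨Set.mem_insert_of_mem _ hx, hxu⟩)
            omega
          intro x x' hx hx' h h'
          rw [this x hx h, this x' hx' h']
  · by_cases hl : 1 ≤ ℓ
    · exact (htr u ℓ hl le_rfl).2 (hS hu)
    · have := hS hu
      obtain rfl : ℓ = 0 := by omega
      exact absurd this (Set.notMem_empty _)
  · exact Nat.find_min' _ ⟨by have := htl u; omega, fun w _ _ _ h _ => by have := htl w; omega⟩

theorem powerDom_eq_of_no_edges {V : Type*} {G : SimpleGraph V} (hG : ∀ u v, ¬ G.Adj u v)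
    (S : Set V) {r : ℕ} (hr : 1 ≤ r) : powerDom G S r = powerDom G S 1 := by
  induction r, hr using Nat.le_induction with
  | base => rfl
  | succ r hr ih =>
    obtain ⟨k, rfl⟩ : ∃ k, r = k + 1 := ⟨r - 1, by omega⟩
    rw [← ih]
    ext v
    simp [powerDom, hG]

/-! ### Rooted tree decompositions over the natural numbers -/

/-- The data on which the dynamic program works.  Vertices are the numbers below `n`, tree nodes
the numbers below `N`, and `N` itself is an additional root with an empty bag.  The bag of node `j`
is listed by `bag` at the positions from `off j` to `off (j + 1)`; `pos j u` is the rank, counted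
from `1`, of `u` in that list, and `0` if `u` is not in the bag.  `ord` lists the nodes such that
children come before their parents, which are given by `par`; `idx` is the inverse of `ord`.
`K` bounds the sizes of the bags and `L` is the number of rounds; `adj` and `inV` are nonzero for
adjacent vertices and for vertices that have to be dominated. -/
structure Inst where
  n : ℕ
  N : ℕ
  L : ℕ
  K : ℕ
  off : ℕ → ℕ
  bag : ℕ → ℕ
  ord : ℕ → ℕ
  par : ℕ → ℕ
  idx : ℕ → ℕ
  pos : ℕ → ℕ → ℕ
  adj : ℕ → ℕ → ℕ
  inV : ℕ → ℕ

namespace Inst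

/-- The bag of node `j`. -/
def X (I : Inst) (j : ℕ) : Finset ℕ := (Finset.Ico (I.off j) (I.off (j + 1))).image I.bag

/-- The base in which states are written; it exceeds all rounds that occur in labels. -/
def B (I : Inst) : ℕ := I.L + 3

/-- The number of states of a node: they have four digits for each of at most `K` vertices of the
bag. Ranks start from `1`, so that there is an additional digit that is never used. -/
def M (I : Inst) : ℕ := I.B ^ (4 * I.K + 1)

/-- The data describe a tree decomposition, the nodes of which are listed bottom-up. The running
intersection property `rip` is stated for a node and its parent: a vertex that occurs again in a
later node occurs in the parent. -/
structure Good (I : Inst) : Prop where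
  off_le : ∀ j ≤ I.N, I.off j ≤ I.off (j + 1)
  off_sub : ∀ j ≤ I.N, I.off (j + 1) ≤ I.off j + I.K
  bag_lt : ∀ j ≤ I.N, ∀ u ∈ I.X j, u < I.n
  bag_inj : ∀ j ≤ I.N, Set.InjOn I.bag (Finset.Ico (I.off j) (I.off (j + 1)))
  pos_le : ∀ j ≤ I.N, ∀ u < I.n, I.pos j u ≤ I.K
  pos_zero : ∀ j ≤ I.N, ∀ u < I.n, I.pos j u = 0 ↔ u ∉ I.X j
  pos_inj : ∀ j ≤ I.N, ∀ u ∈ I.X j, ∀ w ∈ I.X j, I.pos j u = I.pos j w → u = w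
  root : I.X I.N = ∅
  ord_lt : ∀ i < I.N, I.ord i < I.N
  idx_ord : ∀ i < I.N, I.idx (I.ord i) = i
  ord_idx : ∀ q < I.N, I.ord (I.idx q) = q
  idx_lt : ∀ q < I.N, I.idx q < I.N
  idx_root : I.idx I.N = I.N
  par_le : ∀ q < I.N, I.par q ≤ I.N
  idx_par : ∀ q < I.N, I.idx q < I.idx (I.par q)
  rip : ∀ q < I.N, ∀ q' < I.N, I.idx q < I.idx q' → ∀ u ∈ I.X q, u ∈ I.X q' → u ∈ I.X (I.par q)
  mem : ∀ u < I.n, ∃ q < I.N, u ∈ I.X q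
  cover : ∀ u < I.n, ∀ w < I.n, I.adj u w ≠ 0 → ∃ q < I.N, u ∈ I.X q ∧ w ∈ I.X q

/-- The index of the last node whose bag contains `u`; this is where `u` is forgotten. -/
def li (I : Inst) (u : ℕ) : ℕ := ((Finset.range I.N).filter fun q => u ∈ I.X q).sup I.idx

/-- The nodes that have not been merged into their parents after `i` steps. -/
def live (I : Inst) (i : ℕ) : Finset ℕ := (Finset.range (I.N + 1)).filter fun q => i ≤ I.idx q

namespace Good
variable {I : Inst} (h : I.Good)
include h

theorem idx_le {q : ℕ} (hq : q ≤ I.N) : I.idx q ≤ I.N := by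
  rcases hq.lt_or_eq with hq | rfl
  · exact (h.idx_lt q hq).le
  · exact h.idx_root.le

theorem lt_of_mem {q u : ℕ} (hq : q ≤ I.N) (hu : u ∈ I.X q) : q < I.N := by
  rcases hq.lt_or_eq with hq | rfl
  · exact hq
  · simp [h.root] at hu

theorem pos_ne {j u : ℕ} (hj : j ≤ I.N) (hu : u ∈ I.X j) : I.pos j u ≠ 0 := fun h0 =>
  (h.pos_zero j hj u (h.bag_lt j hj u hu)).1 h0 hu

theorem le_li {q u : ℕ} (hq : q ≤ I.N) (hu : u ∈ I.X q) : I.idx q ≤ I.li u :=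
  Finset.le_sup (f := I.idx) (by simp [h.lt_of_mem hq hu, hu])

theorem exists_li {u : ℕ} (hu : u < I.n) : ∃ q < I.N, u ∈ I.X q ∧ I.idx q = I.li u := by
  obtain ⟨q, hq, hqu⟩ := h.mem u hu
  obtain ⟨r, hr, hr'⟩ := Finset.exists_mem_eq_sup
    ((Finset.range I.N).filter fun q => u ∈ I.X q) ⟨q, by simp [hq, hqu]⟩ I.idx
  simp only [Finset.mem_filter, Finset.mem_range] at hr
  exact ⟨r, hr.1, hr.2, hr'.symm⟩

theorem li_lt {u : ℕ} (hu : u < I.n) : I.li u < I.N := by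
  obtain ⟨q, hq, _, hq'⟩ := h.exists_li hu
  exact hq' ▸ h.idx_lt q hq

theorem mem_li {u : ℕ} (hu : u < I.n) : u ∈ I.X (I.ord (I.li u)) := by
  obtain ⟨q, hq, hqu, hq'⟩ := h.exists_li hu
  rwa [← hq', h.ord_idx q hq]

theorem mem_par_iff {q u : ℕ} (hq : q < I.N) (hu : u ∈ I.X q) :
    u ∈ I.X (I.par q) ↔ I.idx q < I.li u := by
  have hun := h.bag_lt q hq.le u hu
  constructor
  · intro hp
    exact (h.idx_par q hq).trans_le (h.le_li (h.par_le q hq) hp)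
  · intro hlt
    refine h.rip q hq _ (h.ord_lt _ (h.li_lt hun)) ?_ u hu (h.mem_li hun)
    rwa [h.idx_ord _ (h.li_lt hun)]

/-- Two vertices that share a bag share the bag in which the first of them is forgotten. -/
theorem mem_both {u w : ℕ} : ∀ q < I.N, u ∈ I.X q → w ∈ I.X q →
    u ∈ I.X (I.ord (min (I.li u) (I.li w))) ∧ w ∈ I.X (I.ord (min (I.li u) (I.li w))) := by
  suffices ∀ d q, q < I.N → I.idx q + d = I.N → u ∈ I.X q → w ∈ I.X q →
      u ∈ I.X (I.ord (min (I.li u) (I.li w))) ∧ w ∈ I.X (I.ord (min (I.li u) (I.li w))) from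
    fun q hq => this (I.N - I.idx q) q hq (by have := h.idx_lt q hq; omega)
  intro d
  induction d using Nat.strong_induction_on with
  | _ d ih =>
    intro q hq hd hu hw
    have h1 := h.le_li hq.le hu
    have h2 := h.le_li hq.le hw
    by_cases he : I.idx q = min (I.li u) (I.li w)
    · rw [← he, h.ord_idx q hq]
      exact ⟨hu, hw⟩
    · have hu' := (h.mem_par_iff hq hu).2 (by omega)
      have hw' := (h.mem_par_iff hq hw).2 (by omega)
      have hp := h.lt_of_mem (h.par_le q hq) hu'
      have := h.idx_par q hq
      have := h.idx_lt _ hp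
      exact ih (I.N - I.idx (I.par q)) (by omega) _ hp (by omega) hu' hw'

theorem mem_of_adj {u w : ℕ} (hu : u < I.n) (hw : w < I.n) (ha : I.adj u w ≠ 0) :
    u ∈ I.X (I.ord (min (I.li u) (I.li w))) ∧ w ∈ I.X (I.ord (min (I.li u) (I.li w))) := by
  obtain ⟨q, hq, hqu, hqw⟩ := h.cover u hu w hw ha
  exact h.mem_both q hq hqu hqw

theorem par_ord_le {i : ℕ} (hi : i < I.N) : I.par (I.ord i) ≤ I.N := h.par_le _ (h.ord_lt i hi)

theorem lt_idx_par {i : ℕ} (hi : i < I.N) : i < I.idx (I.par (I.ord i)) := by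
  have := h.idx_par _ (h.ord_lt i hi)
  rwa [h.idx_ord i hi] at this

theorem live_eq {i : ℕ} (hi : i < I.N) : I.live i = insert (I.ord i) (I.live (i + 1)) := by
  ext q
  simp only [live, Finset.mem_filter, Finset.mem_range, Finset.mem_insert]
  constructor
  · rintro ⟨hq, hiq⟩
    by_cases hqi : I.idx q = i
    · left
      rcases (Nat.lt_succ_iff.1 hq).lt_or_eq with hq' | rfl
      · rw [← hqi, h.ord_idx q hq']
      · rw [h.idx_root] at hqi; omega
    · right; omega
  · rintro (rfl | ⟨hq, hiq⟩)
    · have := h.ord_lt i hi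
      exact ⟨by omega, (h.idx_ord i hi).ge⟩
    · exact ⟨hq, by omega⟩

/-- How a sum over the live nodes changes when node `ord i` is merged into its parent. -/
theorem sum_live {i : ℕ} (hi : i < I.N) (g g' : ℕ → ℕ)
    (hg : ∀ q ≤ I.N, i < I.idx q → q ≠ I.par (I.ord i) → g' q = g q) :
    ∑ q ∈ I.live i, g q + g' (I.par (I.ord i)) =
      ∑ q ∈ I.live (i + 1), g' q + g (I.ord i) + g (I.par (I.ord i)) := by
  have hp : I.par (I.ord i) ∈ I.live (i + 1) := by
    have := h.par_ord_le hi
    have := h.lt_idx_par hi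
    simp only [live, Finset.mem_filter, Finset.mem_range]
    omega
  have hj : I.ord i ∉ I.live (i + 1) := by
    simp [live, h.idx_ord i hi]
  rw [h.live_eq hi, Finset.sum_insert hj, ← Finset.add_sum_erase _ g hp,
    ← Finset.add_sum_erase _ g' hp]
  have : ∑ q ∈ (I.live (i + 1)).erase (I.par (I.ord i)), g' q =
      ∑ q ∈ (I.live (i + 1)).erase (I.par (I.ord i)), g q := by
    refine Finset.sum_congr rfl fun q hq => ?_
    simp only [live, Finset.mem_erase, Finset.mem_filter, Finset.mem_range] at hq
    exact hg q (by omega) (by omega) hq.1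
  omega

theorem live_last : I.live I.N = {I.N} := by
  ext q
  simp only [live, Finset.mem_filter, Finset.mem_range, Finset.mem_singleton]
  constructor
  · rintro ⟨hq, hq'⟩
    by_contra hne
    have := h.idx_lt q (by omega)
    omega
  · rintro rfl
    exact ⟨by omega, h.idx_root.ge⟩

end Good

/-! ### Counting neighbours along the tree -/

/-- The number of neighbours `w` of `u` with `φ u w` for which the edge `uw` is accounted for when
node `j` is merged into node `p`: those with `u` or `w` forgotten in this step. -/
def gain (I : Inst) (φ : ℕ → ℕ → Prop) [∀ u w, Decidable (φ u w)] (j p u : ℕ) : ℕ :=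
  ∑ w ∈ I.X j, if I.adj u w ≠ 0 ∧ (I.pos p u = 0 ∨ I.pos p w = 0) ∧ φ u w then 1 else 0

/-- `C i q u` behaves like the counter of vertex `u` in node `q` after `i` steps: it starts at zero
and is added up, saturating at two, when nodes are merged. -/
structure IsCounter (I : Inst) (φ : ℕ → ℕ → Prop) [∀ u w, Decidable (φ u w)]
    (C : ℕ → ℕ → ℕ → ℕ) : Prop where
  zero : ∀ q ≤ I.N, ∀ u ∈ I.X q, C 0 q u = 0
  keep : ∀ i < I.N, ∀ q ≤ I.N, i < I.idx q → q ≠ I.par (I.ord i) → ∀ u ∈ I.X q,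
    C (i + 1) q u = C i q u
  out : ∀ i < I.N, ∀ u ∈ I.X (I.par (I.ord i)), u ∉ I.X (I.ord i) →
    C (i + 1) (I.par (I.ord i)) u = C i (I.par (I.ord i)) u
  add : ∀ i < I.N, ∀ u ∈ I.X (I.par (I.ord i)), u ∈ I.X (I.ord i) →
    C (i + 1) (I.par (I.ord i)) u =
      min (C i (I.par (I.ord i)) u + (C i (I.ord i) u + I.gain φ (I.ord i) (I.par (I.ord i)) u)) 2

/-- As long as `u` is not forgotten, its counters in the live nodes add up to the number of its
neighbours that have been forgotten.  The saturation of the counters does no harm because the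
comparison is up to saturation at two as well. -/
theorem IsCounter.conserved {I : Inst} (h : I.Good) {φ : ℕ → ℕ → Prop}
    [∀ u w, Decidable (φ u w)] {C : ℕ → ℕ → ℕ → ℕ} (hC : I.IsCounter φ C) {u : ℕ} (hu : u < I.n)
    (i : ℕ) (hi : i ≤ I.li u) :
    min (∑ q ∈ I.live i, if u ∈ I.X q then C i q u else 0) 2 =
      min ((Finset.range I.n).filter fun w => I.adj u w ≠ 0 ∧ φ u w ∧ I.li w < i).card 2 := by
  induction i with
  | zero =>
    have : ∑ q ∈ I.live 0, (if u ∈ I.X q then C 0 q u else 0) = 0 := by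
      refine Finset.sum_eq_zero fun q hq => ?_
      simp only [live, Finset.mem_filter, Finset.mem_range] at hq
      split_ifs with hqu
      · exact hC.zero q (by omega) u hqu
      · rfl
    simp [this]
  | succ i ih =>
    have hiN : i < I.N := by have := h.li_lt hu; omega
    have ih := ih (by omega)
    set j := I.ord i with hj
    set p := I.par j with hp
    have hjN : j < I.N := h.ord_lt i hiN
    have hpN : p ≤ I.N := h.par_le j hjN
    have hji : I.idx j = i := h.idx_ord i hiN
    have key := h.sum_live hiN (fun q => if u ∈ I.X q then C i q u else 0)
      (fun q => if u ∈ I.X q then C (i + 1) q u else 0) (by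
        intro q hq hqi hqp
        by_cases hqu : u ∈ I.X q
        · simp [hqu, hC.keep i hiN q hq hqi hqp u hqu]
        · simp [hqu])
    simp only [← hj, ← hp] at key
    -- the neighbours of `u` that are forgotten in this step
    have hsplit : ((Finset.range I.n).filter
          fun w => I.adj u w ≠ 0 ∧ φ u w ∧ I.li w < i + 1).card =
        ((Finset.range I.n).filter fun w => I.adj u w ≠ 0 ∧ φ u w ∧ I.li w < i).card +
        ((Finset.range I.n).filter fun w => I.adj u w ≠ 0 ∧ φ u w ∧ I.li w = i).card := by
      rw [← Finset.card_union_of_disjoint]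
      · congr 1
        ext w
        simp only [Finset.mem_filter, Finset.mem_union, Finset.mem_range]
        constructor
        · rintro ⟨h1, h2, h3, h4⟩
          rcases (Nat.lt_succ_iff.1 h4).lt_or_eq with h5 | h5
          · exact Or.inl ⟨h1, h2, h3, h5⟩
          · exact Or.inr ⟨h1, h2, h3, h5⟩
        · rintro (⟨h1, h2, h3, h4⟩ | ⟨h1, h2, h3, h4⟩)
          · exact ⟨h1, h2, h3, by omega⟩
          · exact ⟨h1, h2, h3, by omega⟩
      · rw [Finset.disjoint_left]
        intro w hw hw'
        simp only [Finset.mem_filter] at hw hw'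
        omega
    have hmem : ∀ w < I.n, I.adj u w ≠ 0 → I.li w = i → u ∈ I.X j ∧ w ∈ I.X j := by
      intro w hw ha hwi
      have := h.mem_of_adj hu hw ha
      rwa [show min (I.li u) (I.li w) = i by omega] at this
    by_cases huj : u ∈ I.X j
    · have hup : u ∈ I.X p := (h.mem_par_iff hjN huj).2 (by omega)
      have hg : I.gain φ j p u =
          ((Finset.range I.n).filter fun w => I.adj u w ≠ 0 ∧ φ u w ∧ I.li w = i).card := by
        rw [gain, ← Finset.card_filter]
        congr 1
        ext w
        simp only [Finset.mem_filter, Finset.mem_range, h.pos_ne hpN hup, false_or]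
        constructor
        · rintro ⟨hwj, ha, hpw, hφ⟩
          have hw := h.bag_lt j hjN.le w hwj
          refine ⟨hw, ha, hφ, ?_⟩
          have h1 := h.le_li hjN.le hwj
          have h2 := mt (h.mem_par_iff hjN hwj).2 ((h.pos_zero p hpN w hw).1 hpw)
          omega
        · rintro ⟨hw, ha, hφ, hwi⟩
          have hwj := (hmem w hw ha hwi).2
          refine ⟨hwj, ha, (h.pos_zero p hpN w hw).2 fun hwp => ?_, hφ⟩
          have := (h.mem_par_iff hjN hwj).1 hwp
          omega
      have hadd := hC.add i hiN u hup huj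
      simp only [← hj, ← hp] at hadd
      have hle := Finset.single_le_sum (s := I.live (i + 1)) (a := p)
        (f := fun q => if u ∈ I.X q then C (i + 1) q u else 0) (fun _ _ => Nat.zero_le _) (by
          have : i < I.idx p := h.lt_idx_par hiN
          exact Finset.mem_filter.2 ⟨Finset.mem_range.2 (by omega), this⟩)
      simp only [huj, hup, if_true] at key hle
      rw [hsplit, ← hg]
      omega
    · have hz : ((Finset.range I.n).filter
          fun w => I.adj u w ≠ 0 ∧ φ u w ∧ I.li w = i).card = 0 := by
        rw [Finset.card_eq_zero, Finset.filter_eq_empty_iff]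
        rintro w hw ⟨ha, _, hwi⟩
        exact huj (hmem w (Finset.mem_range.1 hw) ha hwi).1
      have hpp : (if u ∈ I.X p then C (i + 1) p u else 0) =
          if u ∈ I.X p then C i p u else 0 := by
        split_ifs with hup
        · exact hC.out i hiN u hup huj
        · rfl
      simp only [hpp, huj, if_false] at key
      rw [hsplit, hz]
      omega

/-- When a vertex is forgotten, its counter has seen all its neighbours. -/
theorem IsCounter.final {I : Inst} (h : I.Good) {φ : ℕ → ℕ → Prop}
    [∀ u w, Decidable (φ u w)] {C : ℕ → ℕ → ℕ → ℕ} (hC : I.IsCounter φ C) {i u : ℕ}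
    (hi : i < I.N) (hu : u ∈ I.X (I.ord i)) (hup : u ∉ I.X (I.par (I.ord i))) :
    min (C i (I.ord i) u + I.gain φ (I.ord i) (I.par (I.ord i)) u) 2 =
      min ((Finset.range I.n).filter fun w => I.adj u w ≠ 0 ∧ φ u w).card 2 := by
  have hjN : I.ord i < I.N := h.ord_lt i hi
  have hpN := h.par_le _ hjN
  have hji := h.idx_ord i hi
  have hun := h.bag_lt _ hjN.le u hu
  have hli : I.li u = i := by
    have h1 := h.le_li hjN.le hu
    have h2 := mt (h.mem_par_iff hjN hu).2 hup
    omega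
  have key := hC.conserved h hun i hli.ge
  have hsum : ∑ q ∈ I.live i, (if u ∈ I.X q then C i q u else 0) = C i (I.ord i) u := by
    rw [Finset.sum_eq_single (I.ord i), if_pos hu]
    · intro q hq hne
      simp only [live, Finset.mem_filter, Finset.mem_range] at hq
      refine if_neg fun hqu => hne ?_
      have hqN := h.lt_of_mem (by omega) hqu
      have := h.le_li hqN.le hqu
      rw [← h.ord_idx q hqN, show I.idx q = i by omega]
    · intro hne
      exact absurd (by simp [live, hji]; omega) hne
  have hg : I.gain φ (I.ord i) (I.par (I.ord i)) u =
      ((Finset.range I.n).filter fun w => I.adj u w ≠ 0 ∧ φ u w ∧ ¬ I.li w < i).card := by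
    rw [gain, ← Finset.card_filter]
    congr 1
    ext w
    simp only [Finset.mem_filter, Finset.mem_range, (h.pos_zero _ hpN u hun).2 hup, true_or,
      true_and]
    constructor
    · rintro ⟨hwj, ha, hφ⟩
      have := h.le_li hjN.le hwj
      exact ⟨h.bag_lt _ hjN.le w hwj, ha, hφ, by omega⟩
    · rintro ⟨hw, ha, hφ, hwi⟩
      refine ⟨?_, ha, hφ⟩
      have := (h.mem_of_adj hun hw ha).2
      rwa [show min (I.li u) (I.li w) = i by omega] at this
  have hsplit := Finset.card_filter_add_card_filter_not
    (s := (Finset.range I.n).filter fun w => I.adj u w ≠ 0 ∧ φ u w) (fun w => I.li w < i)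
  simp only [Finset.filter_filter, and_assoc] at hsplit
  rw [hsum] at key
  rw [hg, ← hsplit]
  omega

end Inst

/-! ### States of tree nodes and the merge relation -/

namespace Inst

/-- Neighbour `w` of `u` is dominated too late to allow `u` to force another vertex from round
`f u` on. -/
abbrev Late (t f : ℕ → ℕ) (u w : ℕ) : Prop := f u ≤ t w

/-- Neighbour `w` of `u` dominates `u`, or can force it, by round `t u`. -/
abbrev Helps (t f : ℕ → ℕ) (u w : ℕ) : Prop := t w = 0 ∨ f w ≤ t u

/-- A state `s` of node `j` stores four digits for each vertex `u` of the bag: the round `t u`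
(`y = 0`), the forcing round `f u` (`y = 1`), and, saturating at two, the numbers of neighbours
accounted for so far that are `Late` (`y = 2`) and that are of help (`y = 3`). The first two are the
labels of `u`, the last two its counters. -/
def lab (I : Inst) (y j s u : ℕ) : ℕ := s / I.B ^ (y * I.K + I.pos j u) % I.B

/-- The number of late neighbours of `u` when node `j`, in state `b`, is merged into `p`. -/
def lateCount (I : Inst) (j p b u : ℕ) : ℕ :=
  I.lab 2 j b u + I.gain (Late (I.lab 0 j b) (I.lab 1 j b)) j p u

/-- The number of helpful neighbours of `u` when node `j`, in state `b`, is merged into `p`. -/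
def helpCount (I : Inst) (j p b u : ℕ) : ℕ :=
  I.lab 3 j b u + I.gain (Helps (I.lab 0 j b) (I.lab 1 j b)) j p u

/-- The certificate conditions for a vertex that is forgotten. -/
def ForgetOK (I : Inst) (j p b u : ℕ) : Prop :=
  I.lab 0 j b u < I.lab 1 j b u ∧ I.lateCount j p b u ≤ 1 ∧
    (I.lab 0 j b u = 0 ∨ I.L < I.lab 0 j b u ∨ 1 ≤ I.helpCount j p b u) ∧
    (I.inV u = 0 ∨ I.lab 0 j b u ≤ I.L)

/-- Labels agree and counters are added for a vertex of both bags. -/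
def MergeOK (I : Inst) (j p a b q u : ℕ) : Prop :=
  I.lab 0 j b u = I.lab 0 p a u ∧ I.lab 1 j b u = I.lab 1 p a u ∧
    I.lab 2 p q u = min (I.lab 2 p a u + I.lateCount j p b u) 2 ∧
    I.lab 3 p q u = min (I.lab 3 p a u + I.helpCount j p b u) 2

/-- Labels, and the counters of vertices outside the merged bag, do not change. -/
def KeepOK (I : Inst) (j p a q u : ℕ) : Prop :=
  I.lab 0 p q u = I.lab 0 p a u ∧ I.lab 1 p q u = I.lab 1 p a u ∧
    (I.pos j u ≠ 0 ∨ I.lab 2 p q u = I.lab 2 p a u ∧ I.lab 3 p q u = I.lab 3 p a u)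

/-- Merging node `j` in state `b` into node `p` in state `a` can give state `q` of `p`. -/
def Rel (I : Inst) (j p a b q : ℕ) : Prop :=
  (∀ u ∈ I.X j, (I.pos p u = 0 ∧ I.ForgetOK j p b u) ∨ (I.pos p u ≠ 0 ∧ I.MergeOK j p a b q u)) ∧
    ∀ u ∈ I.X p, I.KeepOK j p a q u

/-- The number of forgotten vertices that belong to the solution. -/
def cost (I : Inst) (j p b : ℕ) : ℕ :=
  ∑ u ∈ I.X j, if I.pos p u = 0 ∧ I.lab 0 j b u = 0 then 1 else 0

/-- A choice of states of all nodes at all times: `cur i q` is the state of node `q` after `i`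
merges.  States below `B ^ (2 * K + 1)` are those in which all counters are zero. -/
structure IsRun (I : Inst) (cur : ℕ → ℕ → ℕ) : Prop where
  init : ∀ q ≤ I.N, cur 0 q < I.B ^ (2 * I.K + 1)
  rel : ∀ i < I.N, I.Rel (I.ord i) (I.par (I.ord i)) (cur i (I.par (I.ord i))) (cur i (I.ord i))
    (cur (i + 1) (I.par (I.ord i)))
  keep : ∀ i < I.N, ∀ q ≤ I.N, i < I.idx q → q ≠ I.par (I.ord i) → cur (i + 1) q = cur i q

/-- The conditions of a timed certificate, by counting neighbours. -/
structure Cert (I : Inst) (t f : ℕ → ℕ) : Prop where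
  lt : ∀ u < I.n, t u < f u
  late : ∀ u < I.n, ((Finset.range I.n).filter fun w => I.adj u w ≠ 0 ∧ Late t f u w).card ≤ 1
  helps : ∀ u < I.n, t u = 0 ∨ I.L < t u ∨
    1 ≤ ((Finset.range I.n).filter fun w => I.adj u w ≠ 0 ∧ Helps t f u w).card
  target : ∀ u < I.n, I.inV u = 0 ∨ t u ≤ I.L

theorem B_pos (I : Inst) : 0 < I.B := by simp [B]

theorem lab_init {I : Inst} {q u s y : ℕ} (hp : I.pos q u ≠ 0) (hy : 2 ≤ y)
    (hs : s < I.B ^ (2 * I.K + 1)) : I.lab y q s u = 0 := by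
  have : 2 * I.K ≤ y * I.K := Nat.mul_le_mul_right _ hy
  rw [lab, Nat.div_eq_of_lt, Nat.zero_mod]
  exact hs.trans_le (Nat.pow_le_pow_right I.B_pos (by omega))

theorem gain_congr {I : Inst} {φ ψ : ℕ → ℕ → Prop} [∀ u w, Decidable (φ u w)]
    [∀ u w, Decidable (ψ u w)] {j p u : ℕ} (h : ∀ w ∈ I.X j, φ u w ↔ ψ u w) :
    I.gain φ j p u = I.gain ψ j p u := by
  refine Finset.sum_congr rfl fun w hw => ?_
  simp only [h w hw]

/-- Every vertex of the solution is paid for exactly once, when it is forgotten. -/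
theorem Good.sum_cost {I : Inst} (h : I.Good) {cur : ℕ → ℕ → ℕ} {t : ℕ → ℕ}
    (ht : ∀ q ≤ I.N, ∀ u ∈ I.X q, ∀ i ≤ I.idx q, I.lab 0 q (cur i q) u = t u) :
    ∑ i ∈ Finset.range I.N, I.cost (I.ord i) (I.par (I.ord i)) (cur i (I.ord i)) =
      ((Finset.range I.n).filter fun u => t u = 0).card := by
  rw [Finset.card_eq_sum_card_fiberwise (f := I.li) (t := Finset.range I.N)]
  · refine Finset.sum_congr rfl fun i hi => ?_
    rw [Finset.mem_range] at hi
    have hj := h.ord_lt i hi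
    have hp := h.par_le _ hj
    have hji := h.idx_ord i hi
    rw [cost, ← Finset.card_filter]
    congr 1
    ext u
    simp only [Finset.mem_filter, Finset.mem_range]
    constructor
    · rintro ⟨hu, hpu, h0⟩
      have hun := h.bag_lt _ hj.le u hu
      have h1 := h.le_li hj.le hu
      have h2 := mt (h.mem_par_iff hj hu).2 ((h.pos_zero _ hp u hun).1 hpu)
      rw [ht _ hj.le u hu i hji.ge] at h0
      exact ⟨⟨hun, h0⟩, by omega⟩
    · rintro ⟨⟨hun, h0⟩, hli⟩
      have hu := h.mem_li hun
      rw [hli] at hu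
      refine ⟨hu, (h.pos_zero _ hp u hun).2 fun hpu => ?_, ?_⟩
      · have := (h.mem_par_iff hj hu).1 hpu
        omega
      · rw [ht _ hj.le u hu i hji.ge, h0]
  · intro u hu
    simp only [Finset.coe_filter, Finset.mem_range, Set.mem_ofPred_eq] at hu
    simpa using h.li_lt hu.1

/-! ### Runs give certificates -/

section run
variable {I : Inst} (h : I.Good) {cur : ℕ → ℕ → ℕ} (hr : I.IsRun cur)
include h hr

/-- The labels `t` and `f` of a live node do not change during a run. -/
theorem IsRun.lab_eq {y : ℕ} (hy : y < 2) {q u : ℕ} (hq : q ≤ I.N) (hu : u ∈ I.X q) (i : ℕ)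
    (hi : i ≤ I.idx q) : I.lab y q (cur i q) u = I.lab y q (cur 0 q) u := by
  induction i with
  | zero => rfl
  | succ i ih =>
    rw [← ih (by omega)]
    have hiN : i < I.N := by have := h.idx_le hq; omega
    by_cases hqp : q = I.par (I.ord i)
    · subst hqp
      have := (hr.rel i hiN).2 u hu
      interval_cases y
      · exact this.1
      · exact this.2.1
    · rw [hr.keep i hiN q hq (by omega) hqp]

/-- The labels of a vertex are the same in all bags. -/
theorem IsRun.lab_eq_last {y : ℕ} (hy : y < 2) {u : ℕ} : ∀ q ≤ I.N, u ∈ I.X q →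
    I.lab y q (cur 0 q) u = I.lab y (I.ord (I.li u)) (cur 0 (I.ord (I.li u))) u := by
  suffices ∀ d q, q ≤ I.N → I.idx q + d = I.N → u ∈ I.X q →
      I.lab y q (cur 0 q) u = I.lab y (I.ord (I.li u)) (cur 0 (I.ord (I.li u))) u from
    fun q hq hu => this (I.N - I.idx q) q hq (by have := h.idx_le hq; omega) hu
  intro d
  induction d using Nat.strong_induction_on with
  | _ d ih =>
    intro q hq hd hu
    have hqN := h.lt_of_mem hq hu
    by_cases he : I.idx q = I.li u
    · rw [← he, h.ord_idx q hqN]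
    have hiN := h.idx_lt q hqN
    have hpu := (h.mem_par_iff hqN hu).2 (lt_of_le_of_ne (h.le_li hq hu) he)
    have hp := h.par_le q hqN
    have hlt := h.idx_par q hqN
    have := h.idx_le hp
    rw [← ih (I.N - I.idx (I.par q)) (by omega) _ hp (by omega) hpu]
    have hrel := hr.rel _ hiN
    rw [h.ord_idx q hqN] at hrel
    have := (hrel.1 u hu).resolve_left fun h' => h.pos_ne hp hpu h'.1
    rw [← hr.lab_eq h hy hq hu _ le_rfl, ← hr.lab_eq h hy hp hpu _ hlt.le]
    interval_cases y
    · exact this.2.1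
    · exact this.2.2.1

/-- The labels of all vertices in all bags come from one labelling of the graph. -/
theorem IsRun.exists_label {y : ℕ} (hy : y < 2) : ∃ t : ℕ → ℕ, ∀ q ≤ I.N, ∀ u ∈ I.X q,
    ∀ i ≤ I.idx q, I.lab y q (cur i q) u = t u :=
  ⟨fun u => I.lab y (I.ord (I.li u)) (cur 0 (I.ord (I.li u))) u, fun q hq _ hu i hi =>
    (hr.lab_eq h hy hq hu i hi).trans (hr.lab_eq_last h hy q hq hu)⟩

/-- The labels of a run form a certificate: the counters count correctly by `IsCounter.final`, and
the conditions are checked when a vertex is forgotten. -/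
theorem IsRun.cert {t f : ℕ → ℕ}
    (ht : ∀ q ≤ I.N, ∀ u ∈ I.X q, ∀ i ≤ I.idx q, I.lab 0 q (cur i q) u = t u)
    (hf : ∀ q ≤ I.N, ∀ u ∈ I.X q, ∀ i ≤ I.idx q, I.lab 1 q (cur i q) u = f u) : I.Cert t f := by
  have hgL : ∀ i < I.N, ∀ u ∈ I.X (I.ord i), ∀ p,
      I.gain (Late (I.lab 0 (I.ord i) (cur i (I.ord i))) (I.lab 1 (I.ord i) (cur i (I.ord i))))
        (I.ord i) p u = I.gain (Late t f) (I.ord i) p u := by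
    intro i hi u hu p
    have hj := (h.ord_lt i hi).le
    have hji := (h.idx_ord i hi).ge
    refine gain_congr fun w hw => ?_
    rw [Late, ht _ hj w hw i hji, hf _ hj u hu i hji]
  have hgH : ∀ i < I.N, ∀ u ∈ I.X (I.ord i), ∀ p,
      I.gain (Helps (I.lab 0 (I.ord i) (cur i (I.ord i))) (I.lab 1 (I.ord i) (cur i (I.ord i))))
        (I.ord i) p u = I.gain (Helps t f) (I.ord i) p u := by
    intro i hi u hu p
    have hj := (h.ord_lt i hi).le
    have hji := (h.idx_ord i hi).ge
    refine gain_congr fun w hw => ?_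
    rw [Helps, ht _ hj w hw i hji, hf _ hj w hw i hji, ht _ hj u hu i hji]
  have hmerge : ∀ i (hi : i < I.N), ∀ u ∈ I.X (I.par (I.ord i)), u ∈ I.X (I.ord i) →
      I.MergeOK (I.ord i) (I.par (I.ord i)) (cur i (I.par (I.ord i))) (cur i (I.ord i))
        (cur (i + 1) (I.par (I.ord i))) u := fun i hi u hup huj =>
    (((hr.rel i hi).1 u huj).resolve_left fun h' => h.pos_ne (h.par_ord_le hi) hup h'.1).2
  have hkeep : ∀ i (hi : i < I.N), ∀ u ∈ I.X (I.par (I.ord i)), u ∉ I.X (I.ord i) →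
      I.lab 2 (I.par (I.ord i)) (cur (i + 1) (I.par (I.ord i))) u =
        I.lab 2 (I.par (I.ord i)) (cur i (I.par (I.ord i))) u ∧
      I.lab 3 (I.par (I.ord i)) (cur (i + 1) (I.par (I.ord i))) u =
        I.lab 3 (I.par (I.ord i)) (cur i (I.par (I.ord i))) u := by
    intro i hi u hup huj
    exact ((hr.rel i hi).2 u hup).2.2.resolve_left fun h' => h' <|
      (h.pos_zero _ (h.ord_lt i hi).le u (h.bag_lt _ (h.par_ord_le hi) u hup)).2 huj
  have hC2 : I.IsCounter (Late t f) fun i q u => I.lab 2 q (cur i q) u := {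
    zero := fun q hq u hu => lab_init (h.pos_ne hq hu) le_rfl (hr.init q hq)
    keep := fun i hi q hq hqi hqp _ _ => by rw [hr.keep i hi q hq hqi hqp]
    out := fun i hi u hup huj => (hkeep i hi u hup huj).1
    add := fun i hi u hup huj => by
      rw [(hmerge i hi u hup huj).2.2.1, lateCount, hgL i hi u huj] }
  have hC3 : I.IsCounter (Helps t f) fun i q u => I.lab 3 q (cur i q) u := {
    zero := fun q hq u hu => lab_init (h.pos_ne hq hu) (by omega) (hr.init q hq)
    keep := fun i hi q hq hqi hqp _ _ => by rw [hr.keep i hi q hq hqi hqp]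
    out := fun i hi u hup huj => (hkeep i hi u hup huj).2
    add := fun i hi u hup huj => by
      rw [(hmerge i hi u hup huj).2.2.2, helpCount, hgH i hi u huj] }
  have main : ∀ u < I.n, t u < f u ∧
      ((Finset.range I.n).filter fun w => I.adj u w ≠ 0 ∧ Late t f u w).card ≤ 1 ∧
      (t u = 0 ∨ I.L < t u ∨
        1 ≤ ((Finset.range I.n).filter fun w => I.adj u w ≠ 0 ∧ Helps t f u w).card) ∧
      (I.inV u = 0 ∨ t u ≤ I.L) := by
    intro u hun
    have hi := h.li_lt hun
    have hu := h.mem_li hun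
    have hj := h.ord_lt _ hi
    have hji := h.idx_ord _ hi
    have hup : u ∉ I.X (I.par (I.ord (I.li u))) := fun hup => by
      have := (h.mem_par_iff hj hu).1 hup
      omega
    have hok := (((hr.rel _ hi).1 u hu).resolve_right fun h' => h'.1 <|
      (h.pos_zero _ (h.par_ord_le hi) u hun).2 hup).2
    rw [ForgetOK, lateCount, helpCount, hgL _ hi u hu, hgH _ hi u hu,
      ht _ hj.le u hu _ hji.ge, hf _ hj.le u hu _ hji.ge] at hok
    have h2 := hC2.final h hi hu hup
    have h3 := hC3.final h hi hu hup
    refine ⟨hok.1, by omega, ?_, hok.2.2.2⟩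
    rcases hok.2.2.1 with h' | h' | h'
    · exact Or.inl h'
    · exact Or.inr (Or.inl h')
    · exact Or.inr (Or.inr (by omega))
  exact ⟨fun u hu => (main u hu).1, fun u hu => (main u hu).2.1, fun u hu => (main u hu).2.2.1,
    fun u hu => (main u hu).2.2.2⟩

end run

/-! ### Certificates give runs -/

/-- The number with the `m` digits `g 0, …, g (m - 1)`. -/
theorem exists_digits (B : ℕ) (hB : 0 < B) (g : ℕ → ℕ) (hg : ∀ z, g z < B) (m : ℕ) :
    ∃ s < B ^ m, ∀ z < m, s / B ^ z % B = g z := by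
  induction m with
  | zero => exact ⟨0, by simp, by simp⟩
  | succ m ih =>
    obtain ⟨s, hs, hd⟩ := ih
    refine ⟨s + B ^ m * g m, ?_, fun z hz => ?_⟩
    · calc s + B ^ m * g m < B ^ m * (g m + 1) := by rw [Nat.mul_add]; omega
        _ ≤ B ^ m * B := Nat.mul_le_mul_left _ (hg m)
        _ = B ^ (m + 1) := (pow_succ _ _).symm
    · rcases (Nat.lt_succ_iff.1 hz).lt_or_eq with hz' | rfl
      · obtain ⟨d, rfl⟩ : ∃ d, m = z + (d + 1) := ⟨m - z - 1, by omega⟩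
        rw [pow_add, mul_assoc, Nat.add_mul_div_left _ _ (pow_pos hB z), pow_succ', mul_assoc,
          Nat.add_mul_mod_self_left]
        exact hd z (by omega)
      · rw [Nat.add_mul_div_left _ _ (pow_pos hB z), Nat.div_eq_of_lt hs, zero_add,
          Nat.mod_eq_of_lt (hg z)]

/-- States with prescribed labels exist; with zero counters, there is an initial one. -/
theorem Good.exists_state {I : Inst} (h : I.Good) {q : ℕ} (hq : q ≤ I.N) (g : ℕ → ℕ → ℕ)
    (hg : ∀ y u, g y u < I.B) :
    ∃ s < I.M, (∀ y < 4, ∀ u ∈ I.X q, I.lab y q s u = g y u) ∧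
      ((∀ u ∈ I.X q, g 2 u = 0 ∧ g 3 u = 0) → s < I.B ^ (2 * I.K + 1)) ∧
      (I.X q = ∅ → s = 0) := by
  classical
  by_cases hX : I.X q = ∅
  · exact ⟨0, pow_pos I.B_pos _, by simp [hX], fun _ => pow_pos I.B_pos _, fun _ => rfl⟩
  have huniq : ∀ y < 4, ∀ u ∈ I.X q, ∀ y' < 4, ∀ u' ∈ I.X q,
      y * I.K + I.pos q u = y' * I.K + I.pos q u' → y = y' ∧ u = u' := by
    intro y _ u hu y' _ u' hu' he
    have h1 := h.pos_le q hq u (h.bag_lt q hq u hu)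
    have h1' := h.pos_le q hq u' (h.bag_lt q hq u' hu')
    have h2 := h.pos_ne hq hu
    have h2' := h.pos_ne hq hu'
    have hy : y = y' := by
      rcases lt_trichotomy y y' with hlt | heq | hlt
      · have := Nat.mul_le_mul_right I.K (Nat.succ_le_of_lt hlt)
        rw [Nat.succ_mul] at this
        omega
      · exact heq
      · have := Nat.mul_le_mul_right I.K (Nat.succ_le_of_lt hlt)
        rw [Nat.succ_mul] at this
        omega
    subst hy
    exact ⟨rfl, h.pos_inj q hq u hu u' hu' (by omega)⟩
  let P : ℕ → ℕ × ℕ → Prop := fun z yu => yu.1 < 4 ∧ yu.2 ∈ I.X q ∧ z = yu.1 * I.K + I.pos q yu.2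
  let dg : ℕ → ℕ := fun z => if hz : ∃ yu, P z yu then g hz.choose.1 hz.choose.2 else 0
  have hdg : ∀ z, dg z < I.B := fun z => by
    by_cases hz : ∃ yu, P z yu
    · simp only [dg, dif_pos hz]; exact hg _ _
    · simp only [dg, dif_neg hz]; exact I.B_pos
  have hval : ∀ y < 4, ∀ u ∈ I.X q, dg (y * I.K + I.pos q u) = g y u := by
    intro y hy u hu
    have hz : ∃ yu, P (y * I.K + I.pos q u) yu := ⟨(y, u), hy, hu, rfl⟩
    obtain ⟨h1, h2, h3⟩ := hz.choose_spec
    obtain ⟨e1, e2⟩ := huniq y hy u hu _ h1 _ h2 h3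
    simp only [dg, dif_pos hz, ← e1, ← e2]
  have hlt : ∀ y < 4, ∀ u ∈ I.X q, y * I.K + I.pos q u < 4 * I.K + 1 := by
    intro y hy u hu
    have h1 := h.pos_le q hq u (h.bag_lt q hq u hu)
    have := Nat.mul_le_mul_right I.K (show y ≤ 3 by omega)
    omega
  by_cases hzero : ∀ u ∈ I.X q, g 2 u = 0 ∧ g 3 u = 0
  · obtain ⟨s, hs, hd⟩ := exists_digits I.B I.B_pos dg hdg (2 * I.K + 1)
    refine ⟨s, hs.trans_le (Nat.pow_le_pow_right I.B_pos (by omega)), fun y hy u hu => ?_,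
      fun _ => hs, fun h' => absurd h' hX⟩
    by_cases hy2 : y < 2
    · rw [← hval y hy u hu]
      have h1 := h.pos_le q hq u (h.bag_lt q hq u hu)
      have := Nat.mul_le_mul_right I.K (show y ≤ 1 by omega)
      exact hd _ (by omega)
    · rw [lab_init (h.pos_ne hq hu) (by omega) hs]
      have : y = 2 ∨ y = 3 := by omega
      rcases this with rfl | rfl
      · exact (hzero u hu).1.symm
      · exact (hzero u hu).2.symm
  · obtain ⟨s, hs, hd⟩ := exists_digits I.B I.B_pos dg hdg (4 * I.K + 1)
    exact ⟨s, hs, fun y hy u hu => (hd _ (hlt y hy u hu)).trans (hval y hy u hu),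
      fun h' => absurd h' hzero, fun h' => absurd h' hX⟩

/-- The counters in a run with labels `t` and `f`, by recursion on time. -/
def counter (I : Inst) (φ : ℕ → ℕ → Prop) [∀ u w, Decidable (φ u w)] : ℕ → ℕ → ℕ → ℕ
  | 0, _, _ => 0
  | i + 1, q, u =>
    if q = I.par (I.ord i) ∧ I.pos (I.ord i) u ≠ 0 then
      min (counter I φ i q u + (counter I φ i (I.ord i) u + I.gain φ (I.ord i) q u)) 2
    else counter I φ i q u

theorem counter_lt (I : Inst) (φ : ℕ → ℕ → Prop) [∀ u w, Decidable (φ u w)] (i q u : ℕ) :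
    I.counter φ i q u < I.B := by
  have hB : 3 ≤ I.B := by simp [B]
  induction i with
  | zero => exact I.B_pos
  | succ i ih =>
    rw [counter]
    split_ifs
    · omega
    · exact ih

theorem Good.isCounter {I : Inst} (h : I.Good) (φ : ℕ → ℕ → Prop) [∀ u w, Decidable (φ u w)] :
    I.IsCounter φ (I.counter φ) where
  zero _ _ _ _ := rfl
  keep i _ q _ _ hqp _ _ := by rw [counter, if_neg fun h' => hqp h'.1]
  out i hi u hup huj := by
    rw [counter, if_neg fun h' => h'.2 <|
      (h.pos_zero _ (h.ord_lt i hi).le u (h.bag_lt _ (h.par_ord_le hi) u hup)).2 huj]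
  add i hi u _ huj := by
    rw [counter, if_pos ⟨rfl, h.pos_ne (h.ord_lt i hi).le huj⟩]

/-- Every certificate consists of the labels of some run, with the counters determined by recursion.
The additional root, having an empty bag, can be kept in state `0`. -/
theorem Cert.exists_run {I : Inst} (h : I.Good) {t f : ℕ → ℕ} (hc : I.Cert t f)
    (ht : ∀ u, t u < I.B) (hf : ∀ u, f u < I.B) :
    ∃ cur, I.IsRun cur ∧ (∀ i, ∀ q ≤ I.N, cur i q < I.M) ∧ (∀ i, cur i I.N = 0) ∧
      ∀ q ≤ I.N, ∀ u ∈ I.X q, ∀ i, I.lab 0 q (cur i q) u = t u := by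
  let g : ℕ → ℕ → ℕ → ℕ → ℕ := fun i q y u =>
    if y = 0 then t u else if y = 1 then f u else
      if y = 2 then I.counter (Late t f) i q u else I.counter (Helps t f) i q u
  have hg : ∀ i q y u, g i q y u < I.B := by
    intro i q y u
    simp only [g]
    split_ifs
    · exact ht u
    · exact hf u
    · exact counter_lt _ _ _ _ _
    · exact counter_lt _ _ _ _ _
  -- the same digits get the same state, so that the states of uninvolved nodes are kept
  have hst : ∀ q, ∀ G : {G : ℕ → ℕ → ℕ // ∀ y u, G y u < I.B}, ∃ s, q ≤ I.N →
      s < I.M ∧ (∀ y < 4, ∀ u ∈ I.X q, I.lab y q s u = G.1 y u) ∧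
      ((∀ u ∈ I.X q, G.1 2 u = 0 ∧ G.1 3 u = 0) → s < I.B ^ (2 * I.K + 1)) ∧
      (I.X q = ∅ → s = 0) := by
    intro q G
    by_cases hq : q ≤ I.N
    · obtain ⟨s, hs⟩ := h.exists_state hq G.1 G.2
      exact ⟨s, fun _ => hs⟩
    · exact ⟨0, fun h' => absurd h' hq⟩
  choose st hst using hst
  let cur : ℕ → ℕ → ℕ := fun i q => st q ⟨g i q, hg i q⟩
  have hlab : ∀ i, ∀ q ≤ I.N, ∀ y < 4, ∀ u ∈ I.X q, I.lab y q (cur i q) u = g i q y u :=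
    fun i q hq => (hst q ⟨g i q, hg i q⟩ hq).2.1
  have h0 : ∀ i, ∀ q ≤ I.N, ∀ u ∈ I.X q, I.lab 0 q (cur i q) u = t u :=
    fun i q hq u hu => hlab i q hq 0 (by omega) u hu
  have h1 : ∀ i, ∀ q ≤ I.N, ∀ u ∈ I.X q, I.lab 1 q (cur i q) u = f u :=
    fun i q hq u hu => hlab i q hq 1 (by omega) u hu
  have h2 : ∀ i, ∀ q ≤ I.N, ∀ u ∈ I.X q, I.lab 2 q (cur i q) u = I.counter (Late t f) i q u :=
    fun i q hq u hu => hlab i q hq 2 (by omega) u hu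
  have h3 : ∀ i, ∀ q ≤ I.N, ∀ u ∈ I.X q, I.lab 3 q (cur i q) u = I.counter (Helps t f) i q u :=
    fun i q hq u hu => hlab i q hq 3 (by omega) u hu
  refine ⟨cur, ⟨fun q hq => (hst q ⟨g 0 q, hg 0 q⟩ hq).2.2.1 fun _ _ => ⟨rfl, rfl⟩,
    fun i hi => ?_, fun i hi q hq hqi hqp => ?_⟩,
    fun i q hq => (hst q ⟨g i q, hg i q⟩ hq).1,
    fun i => (hst I.N ⟨g i I.N, hg i I.N⟩ le_rfl).2.2.2 h.root, fun q hq u hu i => h0 i q hq u hu⟩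
  · have hj := (h.ord_lt i hi).le
    have hp := h.par_ord_le hi
    have hL : ∀ u ∈ I.X (I.ord i), I.lateCount (I.ord i) (I.par (I.ord i)) (cur i (I.ord i)) u =
        I.counter (Late t f) i (I.ord i) u +
          I.gain (Late t f) (I.ord i) (I.par (I.ord i)) u := by
      intro u hu
      rw [lateCount, h2 i _ hj u hu]
      congr 1
      exact gain_congr fun w hw => by rw [Late, h0 i _ hj w hw, h1 i _ hj u hu]
    have hH : ∀ u ∈ I.X (I.ord i), I.helpCount (I.ord i) (I.par (I.ord i)) (cur i (I.ord i)) u =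
        I.counter (Helps t f) i (I.ord i) u +
          I.gain (Helps t f) (I.ord i) (I.par (I.ord i)) u := by
      intro u hu
      rw [helpCount, h3 i _ hj u hu]
      congr 1
      exact gain_congr fun w hw => by
        rw [Helps, h0 i _ hj w hw, h1 i _ hj w hw, h0 i _ hj u hu]
    constructor
    · intro u hu
      have hun := h.bag_lt _ hj u hu
      by_cases hpu : I.pos (I.par (I.ord i)) u = 0
      · refine Or.inl ⟨hpu, ?_⟩
        have hup := (h.pos_zero _ hp u hun).1 hpu
        have e2 := (h.isCounter (Late t f)).final h hi hu hup
        have e3 := (h.isCounter (Helps t f)).final h hi hu hup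
        have c1 := hc.late u hun
        rw [ForgetOK, hL u hu, hH u hu, h0 i _ hj u hu, h1 i _ hj u hu]
        refine ⟨hc.lt u hun, by omega, ?_, hc.target u hun⟩
        rcases hc.helps u hun with h' | h' | h'
        · exact Or.inl h'
        · exact Or.inr (Or.inl h')
        · exact Or.inr (Or.inr (by omega))
      · refine Or.inr ⟨hpu, ?_⟩
        have hup : u ∈ I.X (I.par (I.ord i)) := by
          by_contra h'
          exact hpu ((h.pos_zero _ hp u hun).2 h')
        rw [MergeOK, hL u hu, hH u hu, h0 i _ hj u hu, h1 i _ hj u hu, h0 i _ hp u hup,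
          h1 i _ hp u hup, h2 i _ hp u hup, h3 i _ hp u hup, h2 (i + 1) _ hp u hup,
          h3 (i + 1) _ hp u hup]
        exact ⟨rfl, rfl, (h.isCounter (Late t f)).add i hi u hup hu,
          (h.isCounter (Helps t f)).add i hi u hup hu⟩
    · intro u hup
      rw [KeepOK, h0 i _ hp u hup, h1 i _ hp u hup, h0 (i + 1) _ hp u hup, h1 (i + 1) _ hp u hup,
        h2 i _ hp u hup, h3 i _ hp u hup, h2 (i + 1) _ hp u hup, h3 (i + 1) _ hp u hup]
      refine ⟨rfl, rfl, ?_⟩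
      by_cases huj : u ∈ I.X (I.ord i)
      · exact Or.inl (h.pos_ne hj huj)
      · exact Or.inr ⟨(h.isCounter (Late t f)).out i hi u hup huj,
          (h.isCounter (Helps t f)).out i hi u hup huj⟩
  · have : g (i + 1) q = g i q := by
      funext y u
      simp only [g, counter, if_neg fun h' : q = I.par (I.ord i) ∧ _ => hqp h'.1]
    simp only [cur, this]

end Inst

/-! ### The tables of the dynamic program -/

namespace Inst

open Classical in
/-- The value that states `a` of `p` and `b` of `j` contribute to state `s` of `p` when `j` is
merged into `p`.  The entries of a table `T` are profits: `n + 1` minus the cost of a cheapest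
partial solution, and `0` if there is none, so that truncated subtraction keeps invalid
combinations at `0`. -/
noncomputable def cand (I : Inst) (T : ℕ → ℕ → ℕ) (j p s a b : ℕ) : ℕ :=
  if I.Rel j p a b s then T p a + T j b - (I.n + 1) - I.cost j p b else 0

/-- `tab i q s` is the table entry of node `q` for state `s` after `i` merges. -/
noncomputable def tab (I : Inst) : ℕ → ℕ → ℕ → ℕ
  | 0, _, s => if s < I.B ^ (2 * I.K + 1) then I.n + 1 else 0
  | i + 1, q, s =>
    if q = I.par (I.ord i) then
      (Finset.range I.M).sup fun a => (Finset.range I.M).sup fun b =>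
        I.cand (tab I i) (I.ord i) (I.par (I.ord i)) s a b
    else tab I i q s

theorem tab_par (I : Inst) (i s : ℕ) : I.tab (i + 1) (I.par (I.ord i)) s =
    (Finset.range I.M).sup fun a => (Finset.range I.M).sup fun b =>
      I.cand (I.tab i) (I.ord i) (I.par (I.ord i)) s a b := by
  rw [tab, if_pos rfl]

theorem tab_of_ne (I : Inst) {i q : ℕ} (hq : q ≠ I.par (I.ord i)) (s : ℕ) :
    I.tab (i + 1) q s = I.tab i q s := by
  rw [tab, if_neg hq]

theorem tab_le (I : Inst) (i q s : ℕ) : I.tab i q s ≤ I.n + 1 := by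
  induction i generalizing q s with
  | zero => rw [tab]; split_ifs <;> omega
  | succ i ih =>
    by_cases hq : q = I.par (I.ord i)
    · subst hq
      rw [tab_par]
      refine Finset.sup_le fun a _ => Finset.sup_le fun b _ => ?_
      have h1 := ih (I.par (I.ord i)) a
      have h2 := ih (I.ord i) b
      rw [cand]
      split_ifs <;> omega
    · rw [tab_of_ne I hq]; exact ih q s

/-- The total loss of profit in the live nodes; along a run it is at most the cost paid so far. -/
noncomputable def deficit (I : Inst) (cur : ℕ → ℕ → ℕ) (i : ℕ) : ℕ :=
  ∑ q ∈ I.live i, (I.n + 1 - I.tab i q (cur i q))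

theorem deficit_zero {I : Inst} {cur : ℕ → ℕ → ℕ}
    (hinit : ∀ q ≤ I.N, cur 0 q < I.B ^ (2 * I.K + 1)) :
    I.deficit cur 0 = 0 := by
  refine Finset.sum_eq_zero fun q hq => ?_
  simp only [live, Finset.mem_filter, Finset.mem_range] at hq
  rw [tab, if_pos (hinit q (by omega)), Nat.sub_self]

section
variable {I : Inst} (h : I.Good) {cur : ℕ → ℕ → ℕ}
include h

/-- Only the merged node and its parent change their contributions. -/
theorem deficit_step (hk : ∀ i < I.N, ∀ q ≤ I.N, i < I.idx q → q ≠ I.par (I.ord i) →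
    cur (i + 1) q = cur i q) {i : ℕ} (hi : i < I.N) :
    I.deficit cur i +
        (I.n + 1 - I.tab (i + 1) (I.par (I.ord i)) (cur (i + 1) (I.par (I.ord i)))) =
      I.deficit cur (i + 1) + (I.n + 1 - I.tab i (I.ord i) (cur i (I.ord i))) +
        (I.n + 1 - I.tab i (I.par (I.ord i)) (cur i (I.par (I.ord i)))) := by
  refine h.sum_live hi (fun q => I.n + 1 - I.tab i q (cur i q))
    (fun q => I.n + 1 - I.tab (i + 1) q (cur (i + 1) q)) fun q hq hqi hqp => ?_
  simp only [hk i hi q hq hqi hqp, I.tab_of_ne hqp]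

theorem deficit_last : I.deficit cur I.N = I.n + 1 - I.tab I.N I.N (cur I.N I.N) := by
  rw [deficit, h.live_last, Finset.sum_singleton]

/-- No run is better than the final table entry. -/
theorem IsRun.le_tab (hr : I.IsRun cur) (hM : ∀ i, ∀ q ≤ I.N, cur i q < I.M) :
    I.n + 1 ≤ I.tab I.N I.N (cur I.N I.N) +
      ∑ i ∈ Finset.range I.N, I.cost (I.ord i) (I.par (I.ord i)) (cur i (I.ord i)) := by
  have key : ∀ i ≤ I.N, I.deficit cur i ≤
      ∑ i ∈ Finset.range i, I.cost (I.ord i) (I.par (I.ord i)) (cur i (I.ord i)) := by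
    intro i
    induction i with
    | zero => intro _; rw [deficit_zero hr.init]; exact Nat.zero_le _
    | succ i ih =>
      intro hi
      have hstep := deficit_step h hr.keep (i := i) (by omega)
      have ih := ih (by omega)
      have hle : I.cand (I.tab i) (I.ord i) (I.par (I.ord i)) (cur (i + 1) (I.par (I.ord i)))
          (cur i (I.par (I.ord i))) (cur i (I.ord i)) ≤
          I.tab (i + 1) (I.par (I.ord i)) (cur (i + 1) (I.par (I.ord i))) := by
        rw [tab_par]
        exact (Finset.le_sup (f := fun b => I.cand (I.tab i) (I.ord i) (I.par (I.ord i))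
            (cur (i + 1) (I.par (I.ord i))) (cur i (I.par (I.ord i))) b)
            (Finset.mem_range.2 (hM i _ (h.ord_lt i (by omega)).le))).trans
          (Finset.le_sup (f := fun a => (Finset.range I.M).sup fun b =>
            I.cand (I.tab i) (I.ord i) (I.par (I.ord i))
            (cur (i + 1) (I.par (I.ord i))) a b)
            (Finset.mem_range.2 (hM i _ (h.par_ord_le (by omega)))))
      rw [cand, if_pos (hr.rel i (by omega))] at hle
      rw [Finset.sum_range_succ]
      have h1 := I.tab_le i (I.ord i) (cur i (I.ord i))
      have h2 := I.tab_le i (I.par (I.ord i)) (cur i (I.par (I.ord i)))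
      omega
  have := key I.N le_rfl
  rw [deficit_last h] at this
  omega

/-- Pointers `A j s` and `B' j s` to states of the parent of `j` and of `j` itself whose
combination gives the entry for state `s` of the parent. -/
structure IsPointer (I : Inst) (A B' : ℕ → ℕ → ℕ) : Prop where
  lt : ∀ i < I.N, ∀ s < I.M, I.tab (i + 1) (I.par (I.ord i)) s ≠ 0 →
    A (I.ord i) s < I.M ∧ B' (I.ord i) s < I.M
  eq : ∀ i < I.N, ∀ s < I.M, I.tab (i + 1) (I.par (I.ord i)) s ≠ 0 →
    I.tab (i + 1) (I.par (I.ord i)) s =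
      I.cand (I.tab i) (I.ord i) (I.par (I.ord i)) s (A (I.ord i) s) (B' (I.ord i) s)

end

/-- The states of the nodes when the pointers have been followed for the last `k` merges. -/
def back (I : Inst) (A B' : ℕ → ℕ → ℕ) : ℕ → ℕ → ℕ
  | 0 => fun _ => 0
  | k + 1 =>
    let j := I.ord (I.N - 1 - k)
    let s := back I A B' k (I.par j)
    Function.update (Function.update (back I A B' k) (I.par j) (A j s)) j (B' j s)

section
variable {I : Inst} (h : I.Good) {A B' : ℕ → ℕ → ℕ} (hP : I.IsPointer A B')
include h hP

/-- Following the pointers gives an optimal run. -/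
theorem IsPointer.exists_run (h0 : I.tab I.N I.N 0 ≠ 0) :
    I.IsRun (fun i => I.back A B' (I.N - i)) ∧ I.n + 1 = I.tab I.N I.N 0 +
      ∑ i ∈ Finset.range I.N,
        I.cost (I.ord i) (I.par (I.ord i)) (I.back A B' (I.N - i) (I.ord i)) := by
  set cur : ℕ → ℕ → ℕ := fun i => I.back A B' (I.N - i) with hcur
  have hback : ∀ i < I.N, cur i = Function.update (Function.update (cur (i + 1))
      (I.par (I.ord i)) (A (I.ord i) (cur (i + 1) (I.par (I.ord i))))) (I.ord i)
        (B' (I.ord i) (cur (i + 1) (I.par (I.ord i)))) := by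
    intro i hi
    have e1 : I.N - i = (I.N - (i + 1)) + 1 := by omega
    have e2 : I.N - 1 - (I.N - (i + 1)) = i := by omega
    simp only [hcur]
    rw [e1, back, e2]
  have hne : ∀ i < I.N, I.par (I.ord i) ≠ I.ord i := by
    intro i hi he
    have := h.lt_idx_par hi
    rw [he, h.idx_ord i hi] at this
    omega
  have hj : ∀ i < I.N, cur i (I.ord i) = B' (I.ord i) (cur (i + 1) (I.par (I.ord i))) := by
    intro i hi
    rw [hback i hi, Function.update_self]
  have hp : ∀ i < I.N, cur i (I.par (I.ord i)) =
      A (I.ord i) (cur (i + 1) (I.par (I.ord i))) := by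
    intro i hi
    rw [hback i hi, Function.update_of_ne (hne i hi), Function.update_self]
  have hk : ∀ i < I.N, ∀ q ≤ I.N, i < I.idx q → q ≠ I.par (I.ord i) →
      cur (i + 1) q = cur i q := by
    intro i hi q _ hqi hqp
    have : q ≠ I.ord i := by
      rintro rfl
      rw [h.idx_ord i hi] at hqi
      omega
    rw [hback i hi, Function.update_of_ne this, Function.update_of_ne hqp]
  have hN : cur I.N I.N = 0 := by simp [hcur, back]
  -- all entries that are met are valid
  have hpos : ∀ d ≤ I.N, ∀ q ≤ I.N, I.N - d ≤ I.idx q →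
      I.tab (I.N - d) q (cur (I.N - d) q) ≠ 0 ∧ cur (I.N - d) q < I.M := by
    intro d
    induction d with
    | zero =>
      intro _ q hq hqN
      have : q ∈ I.live I.N := by simp [live]; omega
      rw [h.live_last, Finset.mem_singleton] at this
      subst this
      rw [Nat.sub_zero, hN]
      exact ⟨h0, pow_pos I.B_pos _⟩
    | succ d ih =>
      intro hd q hq hqi
      have ih := ih (by omega)
      obtain ⟨i, hi⟩ : ∃ i, i = I.N - (d + 1) := ⟨_, rfl⟩
      rw [show I.N - d = i + 1 by omega] at ih
      rw [← hi] at hqi ⊢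
      have hiN : i < I.N := by omega
      have ihp := ih _ (h.par_ord_le hiN) (h.lt_idx_par hiN)
      have hlt := hP.lt i hiN _ ihp.2 ihp.1
      have heq := hP.eq i hiN _ ihp.2 ihp.1
      rw [← hp i hiN, ← hj i hiN] at hlt heq
      have hc : I.cand (I.tab i) (I.ord i) (I.par (I.ord i)) (cur (i + 1) (I.par (I.ord i)))
          (cur i (I.par (I.ord i))) (cur i (I.ord i)) ≠ 0 := heq ▸ ihp.1
      rw [cand] at hc
      have h1 := I.tab_le i (I.ord i) (cur i (I.ord i))
      have h2 := I.tab_le i (I.par (I.ord i)) (cur i (I.par (I.ord i)))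
      split_ifs at hc
      · by_cases hqp : q = I.par (I.ord i)
        · subst hqp
          exact ⟨by omega, hlt.1⟩
        · by_cases hqi' : i < I.idx q
          · have := ih q hq hqi'
            rwa [hk i hiN q hq hqi' hqp, I.tab_of_ne hqp] at this
          · obtain rfl : q = I.ord i := by
              have hqN : q < I.N := by
                rcases hq.lt_or_eq with hq | rfl
                · exact hq
                · rw [h.idx_root] at hqi'; omega
              rw [← h.ord_idx q hqN, show I.idx q = i by omega]
            exact ⟨by omega, hlt.2⟩
      · exact absurd rfl hc
  have hpos : ∀ i ≤ I.N, ∀ q ≤ I.N, i ≤ I.idx q →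
      I.tab i q (cur i q) ≠ 0 ∧ cur i q < I.M := by
    intro i hi q hq hqi
    have := hpos (I.N - i) (by omega) q hq (by omega)
    rwa [show I.N - (I.N - i) = i by omega] at this
  have hstep : ∀ i < I.N, I.Rel (I.ord i) (I.par (I.ord i)) (cur i (I.par (I.ord i)))
      (cur i (I.ord i)) (cur (i + 1) (I.par (I.ord i))) ∧
      I.tab (i + 1) (I.par (I.ord i)) (cur (i + 1) (I.par (I.ord i))) ≠ 0 ∧
      I.tab (i + 1) (I.par (I.ord i)) (cur (i + 1) (I.par (I.ord i))) =
        I.tab i (I.par (I.ord i)) (cur i (I.par (I.ord i))) + I.tab i (I.ord i) (cur i (I.ord i)) -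
          (I.n + 1) - I.cost (I.ord i) (I.par (I.ord i)) (cur i (I.ord i)) := by
    intro i hi
    have h1 := hpos (i + 1) (by omega) _ (h.par_ord_le hi) (h.lt_idx_par hi)
    have heq := hP.eq i hi _ h1.2 h1.1
    rw [← hp i hi, ← hj i hi] at heq
    have hc := heq ▸ h1.1
    rw [cand] at hc heq
    split_ifs at hc heq with hR
    · exact ⟨hR, h1.1, heq⟩
    · exact absurd rfl hc
  have hinit : ∀ q ≤ I.N, cur 0 q < I.B ^ (2 * I.K + 1) := by
    intro q hq
    by_contra hc
    have := (hpos 0 (Nat.zero_le _) q hq (Nat.zero_le _)).1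
    rw [tab, if_neg hc] at this
    exact this rfl
  refine ⟨⟨hinit, fun i hi => (hstep i hi).1, hk⟩, ?_⟩
  have key : ∀ i ≤ I.N, I.deficit cur i =
      ∑ i ∈ Finset.range i, I.cost (I.ord i) (I.par (I.ord i)) (cur i (I.ord i)) := by
    intro i
    induction i with
    | zero => intro _; rw [deficit_zero hinit]; rfl
    | succ i ih =>
      intro hi
      have hs := deficit_step h hk (i := i) (by omega)
      have ih := ih (by omega)
      rw [Finset.sum_range_succ, ← ih]
      have h1 := I.tab_le i (I.ord i) (cur i (I.ord i))
      have h2 := I.tab_le i (I.par (I.ord i)) (cur i (I.par (I.ord i)))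
      obtain ⟨-, h3, h4⟩ := hstep i (by omega)
      omega
  have := key I.N le_rfl
  rw [deficit_last h, hN] at this
  have h3 := I.tab_le I.N I.N 0
  simp only [hcur] at this ⊢
  omega

/-- Following the pointers gives a certificate of minimum cost, stored in the labels of the
resulting states. -/
theorem IsPointer.optimal (hex : ∃ t f, I.Cert t f ∧ (∀ u, t u < I.B) ∧ ∀ u, f u < I.B) :
    ∃ t f, I.Cert t f ∧ (∀ q ≤ I.N, I.back A B' I.N q < I.M) ∧
      (∀ q < I.N, ∀ u ∈ I.X q, I.lab 0 q (I.back A B' I.N q) u = t u) ∧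
      ∀ t' f', I.Cert t' f' → (∀ u, t' u < I.B) → (∀ u, f' u < I.B) →
        ((Finset.range I.n).filter fun u => t u = 0).card ≤
          ((Finset.range I.n).filter fun u => t' u = 0).card := by
  have hle : ∀ t' f', I.Cert t' f' → (∀ u, t' u < I.B) → (∀ u, f' u < I.B) →
      I.n + 1 ≤ I.tab I.N I.N 0 + ((Finset.range I.n).filter fun u => t' u = 0).card := by
    intro t' f' hc ht' hf'
    obtain ⟨cur, hr, hM, hN, hlab⟩ := hc.exists_run h ht' hf'
    have := hr.le_tab h hM
    rwa [hN, h.sum_cost fun q hq u hu i _ => hlab q hq u hu i] at this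
  have h0 : I.tab I.N I.N 0 ≠ 0 := by
    obtain ⟨t, f, hc, ht, hf⟩ := hex
    have h1 := hle t f hc ht hf
    have h2 := Finset.card_filter_le (Finset.range I.n) fun u => t u = 0
    rw [Finset.card_range] at h2
    omega
  obtain ⟨hr, hsum⟩ := hP.exists_run h h0
  obtain ⟨t, ht⟩ := hr.exists_label h (y := 0) (by omega)
  obtain ⟨f, hf⟩ := hr.exists_label h (y := 1) (by omega)
  refine ⟨t, f, hr.cert h ht hf, fun q hq => (hr.init q hq).trans_le
    (Nat.pow_le_pow_right I.B_pos (by omega)), fun q hq u hu => ?_, fun t' f' hc ht' hf' => ?_⟩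
  · have := ht q hq.le u hu 0 (Nat.zero_le _)
    rwa [Nat.sub_zero] at this
  · have := hle t' f' hc ht' hf'
    rw [h.sum_cost ht] at hsum
    omega

end

end Inst

/-! ### Rooting a tree and its tree decomposition -/

/-- In a tree with root `r`, every other vertex has a parent, and there are no further edges. -/
theorem SimpleGraph.IsTree.exists_parent {V : Type*} {T : SimpleGraph V} (hT : T.IsTree) (r : V) :
    ∃ π : V → V, (∀ x, x ≠ r → T.Adj x (π x) ∧ T.dist r (π x) < T.dist r x) ∧
      ∀ x y, T.Adj x y → (x ≠ r ∧ y = π x) ∨ (y ≠ r ∧ x = π y) := by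
  classical
  have hex : ∀ x, ∃ z, x ≠ r → T.Adj x z ∧ T.dist r x = T.dist r z + 1 := by
    intro x
    by_cases hx : x = r
    · exact ⟨x, fun h => absurd hx h⟩
    obtain ⟨p, hp⟩ := hT.connected.exists_walk_length_eq_dist x r
    cases p with
    | nil => exact absurd rfl hx
    | cons hadj p =>
      rename_i z
      refine ⟨z, fun _ => ⟨hadj, ?_⟩⟩
      rw [SimpleGraph.Walk.length_cons] at hp
      have h1 := SimpleGraph.dist_le p
      rw [SimpleGraph.dist_comm (u := r) (v := x), SimpleGraph.dist_comm (u := r) (v := z)]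
      rcases hT.dist_eq_dist_add_one_of_adj r hadj with h2 | h2
      · rw [SimpleGraph.dist_comm (u := r) (v := x), SimpleGraph.dist_comm (u := r) (v := z)] at h2
        exact h2
      · rw [SimpleGraph.dist_comm (u := r) (v := x), SimpleGraph.dist_comm (u := r) (v := z)] at h2
        omega
  choose π hπ using hex
  -- a shortest walk through a neighbour that is closer to the root is the path to the root
  have huniq : ∀ x z z', T.Adj x z → T.Adj x z' → T.dist r x = T.dist r z + 1 →
      T.dist r x = T.dist r z' + 1 → z = z' := by
    intro x z z' hz hz' h1 h2
    obtain ⟨p, hp⟩ := hT.connected.exists_walk_length_eq_dist z r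
    obtain ⟨p', hp'⟩ := hT.connected.exists_walk_length_eq_dist z' r
    have e1 : (SimpleGraph.Walk.cons hz p).IsPath := by
      apply SimpleGraph.Walk.isPath_of_length_eq_dist
      rw [SimpleGraph.Walk.length_cons, hp, SimpleGraph.dist_comm, ← h1, SimpleGraph.dist_comm]
    have e2 : (SimpleGraph.Walk.cons hz' p').IsPath := by
      apply SimpleGraph.Walk.isPath_of_length_eq_dist
      rw [SimpleGraph.Walk.length_cons, hp', SimpleGraph.dist_comm, ← h2, SimpleGraph.dist_comm]
    have := (hT.existsUnique_path x r).unique e1 e2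
    have := congrArg SimpleGraph.Walk.snd this
    simpa using this
  refine ⟨π, fun x hx => ⟨(hπ x hx).1, by have := (hπ x hx).2; omega⟩, fun x y hxy => ?_⟩
  rcases hT.dist_eq_dist_add_one_of_adj r hxy with h | h
  · have hx : x ≠ r := by rintro rfl; simp at h
    exact Or.inl ⟨hx, huniq x y _ hxy (hπ x hx).1 h (hπ x hx).2⟩
  · have hy : y ≠ r := by rintro rfl; simp at h
    exact Or.inr ⟨hy, huniq y x _ hxy.symm (hπ y hy).1 h (hπ y hy).2⟩

/-- `par` makes the numbers below `N` into a tree with root `0`, the parent of which is the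
additional root `N`; the edges of this tree are those of `T`. -/
structure IsRooting {N : ℕ} (T : SimpleGraph (Fin N)) (par dep : ℕ → ℕ) : Prop where
  zero : par 0 = N
  lt : ∀ x < N, x ≠ 0 → par x < N ∧ dep (par x) < dep x
  adj : ∀ x y : Fin N, T.Adj x y ↔
    (x.val ≠ 0 ∧ par x = y) ∨ (y.val ≠ 0 ∧ par y = x)

/-- Rooting the tree at node `0`, with the distance from it as depth. -/
theorem SimpleGraph.IsTree.exists_rooting {N : ℕ} {T : SimpleGraph (Fin N)} (hT : T.IsTree) :
    ∃ par dep, IsRooting T par dep := by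
  obtain ⟨r⟩ := hT.connected.nonempty
  have hN : 0 < N := r.pos
  obtain ⟨π, h1, h2⟩ := hT.exists_parent ⟨0, hN⟩
  have hne : ∀ x : Fin N, x.val ≠ 0 → x ≠ ⟨0, hN⟩ := fun x hx h => hx (congrArg Fin.val h)
  have hpar : ∀ x : Fin N, x.val ≠ 0 →
      (if hx : x.val < N then if x.val = 0 then N else (π ⟨x.val, hx⟩).val else 0) = π x := by
    intro x hx
    rw [dif_pos x.isLt, if_neg hx]
  refine ⟨fun x => if hx : x < N then if x = 0 then N else π ⟨x, hx⟩ else 0,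
    fun x => if hx : x < N then T.dist ⟨0, hN⟩ ⟨x, hx⟩ else 0, by simp [hN], ?_, ?_⟩
  · intro x hx hx0
    have := (h1 ⟨x, hx⟩ (hne _ hx0)).2
    simp only [dif_pos hx, if_neg hx0, Fin.is_lt, Fin.eta, dite_true, true_and]
    exact this
  · intro x y
    constructor
    · intro hxy
      rcases h2 x y hxy with ⟨hx, rfl⟩ | ⟨hy, rfl⟩
      · have hx' : x.val ≠ 0 := fun h => hx (Fin.ext h)
        exact Or.inl ⟨hx', hpar x hx'⟩
      · have hy' : y.val ≠ 0 := fun h => hy (Fin.ext h)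
        exact Or.inr ⟨hy', hpar y hy'⟩
    · rintro (⟨hx, h⟩ | ⟨hy, h⟩)
      · have h' := (hpar x hx).symm.trans h
        rw [← Fin.ext h']
        exact (h1 x (hne x hx)).1
      · have h' := (hpar y hy).symm.trans h
        rw [← Fin.ext h']
        exact (h1 y (hne y hy)).1.symm

theorem sum_range_getD {α : Type*} (l : List α) (F G : α → ℕ) (φ : ℕ → ℕ → ℕ) :
    ∑ e ∈ Finset.range l.length, φ ((l.map F).getD e 0) ((l.map G).getD e 0) =
      (l.map fun a => φ (F a) (G a)).sum := by
  induction l with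
  | nil => simp
  | cons a l ih =>
    rw [List.length_cons, Finset.sum_range_succ', List.map_cons (f := fun a => φ (F a) (G a)),
      List.sum_cons, ← ih, add_comm]
    simp

/-- Summing over the ends of the edges at `x` is summing over the parent and the children. -/
theorem IsRooting.sum_edges {N : ℕ} {T : SimpleGraph (Fin N)} {par dep : ℕ → ℕ}
    (h : IsRooting T par dep) {F : List (Fin N × Fin N)} (hF : IsEdgeList T F) (g : ℕ → ℕ)
    {x : ℕ} (hx : x < N) :
    ∑ e ∈ Finset.range F.length,
        ((if (F.map fun p => p.1.val).getD e 0 = x then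
            g ((F.map fun p => p.2.val).getD e 0) else 0) +
          if (F.map fun p => p.2.val).getD e 0 = x then
            g ((F.map fun p => p.1.val).getD e 0) else 0) + (if x = 0 then g N else 0) =
      g (par x) + ∑ y ∈ (Finset.range N).filter fun y => par y = x, g y := by
  classical
  let φ : ℕ → ℕ → ℕ := fun a b => (if a = x then g b else 0) + if b = x then g a else 0
  have hsum := sum_range_getD F (fun p => p.1.val) (fun p => p.2.val) φ
  let ψ : Sym2 (Fin N) → ℕ := Sym2.lift ⟨fun a b => φ a b, fun a b => Nat.add_comm _ _⟩
  have hmap : (F.map fun p => φ p.1 p.2) = (F.map fun p => s(p.1, p.2)).map ψ := by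
    rw [List.map_map]; rfl
  have hne : ∀ y : Fin N, y.val ≠ 0 → par y < N := fun y hy => (h.lt y y.isLt hy).1
  let e : Fin N → Sym2 (Fin N) := fun y =>
    if hy : y.val ≠ 0 then s(y, ⟨par y, hne y hy⟩) else s(y, y)
  have he : ∀ y : Fin N, ∀ hy : y.val ≠ 0, e y = s(y, ⟨par y, hne y hy⟩) := fun y hy => dif_pos hy
  have himg : (F.map fun p => s(p.1, p.2)).toFinset =
      (Finset.univ.filter fun y : Fin N => y.val ≠ 0).image e := by
    ext z
    rw [List.mem_toFinset, ← hF.2]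
    simp only [Finset.mem_image, Finset.mem_filter, Finset.mem_univ, true_and]
    induction z with
    | _ a b =>
      rw [SimpleGraph.mem_edgeSet, h.adj]
      constructor
      · rintro (⟨ha, hab⟩ | ⟨hb, hab⟩)
        · exact ⟨a, ha, by rw [he a ha]; congr⟩
        · refine ⟨b, hb, ?_⟩
          rw [he b hb, Sym2.eq_swap]
          congr
      · rintro ⟨y, hy, hye⟩
        rw [he y hy, Sym2.eq_iff] at hye
        rcases hye with ⟨rfl, rfl⟩ | ⟨rfl, rfl⟩
        · exact Or.inl ⟨hy, rfl⟩
        · exact Or.inr ⟨hy, rfl⟩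
  have hinj : Set.InjOn e (Finset.univ.filter fun y : Fin N => y.val ≠ 0) := by
    intro y hy z hz hyz
    simp only [Finset.coe_filter, Finset.mem_univ, true_and, Set.mem_ofPred_eq] at hy hz
    rw [he y hy, he z hz, Sym2.eq_iff] at hyz
    rcases hyz with ⟨h1, _⟩ | ⟨h1, h2⟩
    · exact h1
    · have h3 := (h.lt y y.isLt hy).2
      have h4 := (h.lt z z.isLt hz).2
      rw [h1] at h3
      have h2 := congrArg Fin.val h2
      simp only at h2
      rw [h1] at h2
      simp only at h2 h3
      rw [h2] at h3
      omega
  have hmain : (F.map fun p => φ p.1 p.2).sum =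
      ∑ y ∈ Finset.range N, if y = 0 then 0 else φ y (par y) := by
    rw [hmap, ← List.sum_toFinset ψ hF.1, himg, Finset.sum_image hinj, Finset.sum_filter,
      ← Fin.sum_univ_eq_sum_range (fun y => if y = 0 then 0 else φ y (par y))]
    refine Finset.sum_congr rfl fun y _ => ?_
    by_cases hy : y.val = 0
    · simp [hy]
    · simp only [ne_eq, hy, not_false_eq_true, if_true, if_false, he y hy]
      rfl
  have hsplit : ∀ y, (if y = 0 then 0 else φ y (par y)) + (if y = 0 then φ 0 N else 0) =
      (if y = x then g (par y) else 0) + if par y = x then g y else 0 := by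
    intro y
    by_cases hy : y = 0
    · subst hy; simp [φ, h.zero]
    · simp [hy, φ]
  have htot : (∑ y ∈ Finset.range N, if y = 0 then 0 else φ y (par y)) + φ 0 N =
      g (par x) + ∑ y ∈ (Finset.range N).filter fun y => par y = x, g y := by
    have h1 := Finset.sum_congr (rfl : Finset.range N = Finset.range N) fun y _ => hsplit y
    rw [Finset.sum_add_distrib, Finset.sum_add_distrib, Finset.sum_ite_eq',
      Finset.sum_ite_eq', if_pos (by simp; omega), if_pos (by simpa using hx)] at h1
    rw [h1, Finset.sum_filter]
  have hφ0 : φ 0 N = if x = 0 then g N else 0 := by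
    have : N ≠ x := by omega
    simp [φ, this, eq_comm]
  simp only [φ] at hsum hmain hφ0
  simp only [φ] at htot
  rw [hsum, hmain, ← htot, ← hφ0]

/-- `ord` lists the nodes such that children come before their parents. -/
structure IsBottomUp (N : ℕ) (par ord : ℕ → ℕ) : Prop where
  lt : ∀ i < N, ord i < N
  inj : ∀ i < N, ∀ i' < N, ord i = ord i' → i = i'
  child : ∀ i < N, ∀ y < N, par y = ord i → ∃ i' < i, ord i' = y

theorem IsBottomUp.exists_idx {N : ℕ} {par ord : ℕ → ℕ} (h : IsBottomUp N par ord)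
    (hp : ∀ q < N, par q ≤ N) :
    ∃ idx : ℕ → ℕ, (∀ i < N, idx (ord i) = i) ∧ (∀ q < N, ord (idx q) = q) ∧
      (∀ q < N, idx q < N) ∧ idx N = N ∧ ∀ q < N, idx q < idx (par q) := by
  classical
  have hsurj : ∀ q < N, ∃ i < N, ord i = q := by
    intro q hq
    have hs := Finset.surj_on_of_inj_on_of_card_le (s := Finset.range N) (t := Finset.range N)
      (fun i _ => ord i) (fun i hi => by simpa using h.lt i (by simpa using hi))
      (fun i i' hi hi' he => h.inj i (by simpa using hi) i' (by simpa using hi') he) le_rfl q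
      (by simpa using hq)
    obtain ⟨i, hi, he⟩ := hs
    exact ⟨i, by simpa using hi, he.symm⟩
  have hex : ∀ q, ∃ i, (q < N → i < N ∧ ord i = q) ∧ (¬ q < N → i = q) := by
    intro q
    by_cases hq : q < N
    · obtain ⟨i, hi, he⟩ := hsurj q hq
      exact ⟨i, fun _ => ⟨hi, he⟩, fun h' => absurd hq h'⟩
    · exact ⟨q, fun h' => absurd h' hq, fun _ => rfl⟩
  choose idx h1 h2 using hex
  have hio : ∀ i < N, idx (ord i) = i := fun i hi =>
    h.inj _ (h1 _ (h.lt i hi)).1 i hi (h1 _ (h.lt i hi)).2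
  refine ⟨idx, hio, fun q hq => (h1 q hq).2, fun q hq => (h1 q hq).1, h2 N (by omega), ?_⟩
  intro q hq
  rcases (hp q hq).lt_or_eq with hlt | heq
  · obtain ⟨i', hi', he⟩ := h.child _ (h1 _ hlt).1 q hq (h1 _ hlt).2.symm
    have : idx q = i' := by rw [← he]; exact hio i' (by have := (h1 _ hlt).1; omega)
    omega
  · rw [heq, h2 N (by omega)]
    exact (h1 q hq).1

/-- The running intersection property along a bottom-up order. -/
theorem TreeDecomposition.mem_bag_par {n N : ℕ} {G : SimpleGraph (Fin n)}
    (D : TreeDecomposition G (Fin N)) {par dep idx : ℕ → ℕ} (h : IsRooting D.tree par dep)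
    (hidx : ∀ q < N, idx q < idx (par q)) {q q' : Fin N} (hlt : idx q < idx q') {v : Fin n}
    (hq : v ∈ D.bag q) (hq' : v ∈ D.bag q') : ∃ r : Fin N, par q = r ∧ v ∈ D.bag r := by
  classical
  -- a path that goes down once goes down all the way
  have down : ∀ (x y : Fin N) (p : D.tree.Walk x y), p.IsPath → ∀ x' : Fin N, par x = x' →
      x' ∉ p.support → idx y ≤ idx x := by
    intro x y p
    induction p with
    | nil => intro _ _ _ _; exact le_rfl
    | cons hadj p ih =>
      rename_i x z y
      intro hp x' hx hx'
      rw [SimpleGraph.Walk.cons_isPath_iff] at hp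
      simp only [SimpleGraph.Walk.support_cons, List.mem_cons, not_or] at hx'
      have hz : par z = x := by
        rcases (h.adj x z).1 hadj with ⟨_, h'⟩ | ⟨_, h'⟩
        · have : x' = z := Fin.ext (hx.symm.trans h')
          exact absurd (this ▸ p.start_mem_support) hx'.2
        · exact h'
      have h1 := ih hp.1 x hz hp.2
      have h2 := hidx z z.isLt
      rw [hz] at h2
      omega
  obtain ⟨p, hp, -⟩ := D.isTree.existsUnique_path q q'
  have hbag := D.bag_of_path q
  cases p with
  | nil => omega
  | cons hadj p =>
    rename_i z
    have hz := hbag z q' _ hp (by simp) v hq hq'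
    rcases (h.adj q z).1 hadj with ⟨_, h'⟩ | ⟨_, h'⟩
    · exact ⟨z, h', hz⟩
    · rw [SimpleGraph.Walk.cons_isPath_iff] at hp
      have h1 := down z q' p hp.1 q h' hp.2
      have h2 := hidx z z.isLt
      rw [h'] at h2
      omega

namespace RAM

/-! ### Memory layout -/

infixr:60 " ;; " => Prog.seq

/-- The program leaves the registers and arrays alone that hold the description of the instance. -/
def Prog.safe (p : Prog) : Bool :=
  (List.range 10).all (fun x => !p.wr x) &&
    (List.range 15).all fun a => !(p.wa a) || a == 7

/-- The memory holds the description of the instance `I`: registers `0` to `9`, the input arrays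
`2`, `5`, `6`, and in arrays `8` and `11` the multiples of `n` and of `M`, in array `9` the
adjacency matrix, in array `10` the ranks of the vertices in the bags, in array `12` the digits of
all states, and in arrays `13` and `14` the parents and the order of the nodes. The tables of
multiples replace the missing multiplication in the computation of addresses: matrices are stored
row by row. -/
structure Ready (I : Inst) (σ : State) : Prop where
  n : σ.reg 0 = I.n
  N : σ.reg 2 = I.N
  L : σ.reg 4 = I.L
  K : σ.reg 5 = I.K
  M : σ.reg 7 = I.M
  K2 : σ.reg 8 = 2 * I.K
  K3 : σ.reg 9 = 3 * I.K
  inV : ∀ u < I.n, σ.arr 2 u = I.inV u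
  off : ∀ j ≤ I.N + 1, σ.arr 5 j = I.off j
  bag : σ.arr 6 = I.bag
  mulN : ∀ j ≤ I.N + I.n, σ.arr 8 j = j * I.n
  adj : ∀ u < I.n, ∀ w < I.n, σ.arr 9 (u * I.n + w) = I.adj u w
  pos : ∀ j ≤ I.N, ∀ u < I.n, σ.arr 10 (j * I.n + u) = I.pos j u
  mulM : ∀ j ≤ 2 * I.N + (4 * I.K + 1), σ.arr 11 j = j * I.M
  digit : ∀ z < 4 * I.K + 1, ∀ s < I.M, σ.arr 12 (z * I.M + s) = s / I.B ^ z % I.B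
  par : ∀ q < I.N, σ.arr 13 q = I.par q
  ord : ∀ i < I.N, σ.arr 14 i = I.ord i

theorem Agree.of_safe {p : Prog} {σ σ' : State} (h : Agree p σ σ') (hp : p.safe = true) :
    (∀ x < 10, σ'.reg x = σ.reg x) ∧ ∀ a < 15, a ≠ 7 → σ'.arr a = σ.arr a := by
  simp only [Prog.safe, Bool.and_eq_true, List.all_eq_true, List.mem_range, Bool.not_eq_true',
    Bool.or_eq_true, beq_iff_eq] at hp
  exact ⟨fun x hx => h.reg x (hp.1 x hx),
    fun a ha ha' => h.arr a ((hp.2 a ha).resolve_right ha')⟩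

theorem Ready.of_eq {I : Inst} {σ σ' : State} (hI : Ready I σ)
    (hr : ∀ x < 10, σ'.reg x = σ.reg x) (ha : ∀ a < 15, a ≠ 7 → σ'.arr a = σ.arr a) :
    Ready I σ' := by
  constructor
  · rw [hr 0 (by omega)]; exact hI.n
  · rw [hr 2 (by omega)]; exact hI.N
  · rw [hr 4 (by omega)]; exact hI.L
  · rw [hr 5 (by omega)]; exact hI.K
  · rw [hr 7 (by omega)]; exact hI.M
  · rw [hr 8 (by omega)]; exact hI.K2
  · rw [hr 9 (by omega)]; exact hI.K3
  · rw [ha 2 (by omega) (by omega)]; exact hI.inV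
  · rw [ha 5 (by omega) (by omega)]; exact hI.off
  · rw [ha 6 (by omega) (by omega)]; exact hI.bag
  · rw [ha 8 (by omega) (by omega)]; exact hI.mulN
  · rw [ha 9 (by omega) (by omega)]; exact hI.adj
  · rw [ha 10 (by omega) (by omega)]; exact hI.pos
  · rw [ha 11 (by omega) (by omega)]; exact hI.mulM
  · rw [ha 12 (by omega) (by omega)]; exact hI.digit
  · rw [ha 13 (by omega) (by omega)]; exact hI.par
  · rw [ha 14 (by omega) (by omega)]; exact hI.ord

theorem Ready.agree {I : Inst} {p : Prog} {σ σ' : State} (hI : Ready I σ) (h : Agree p σ σ')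
    (hp : p.safe = true) : Ready I σ' :=
  hI.of_eq (h.of_safe hp).1 (h.of_safe hp).2

theorem Ready.setReg {I : Inst} {σ : State} (hI : Ready I σ) {x : ℕ} (hx : 10 ≤ x) (v : ℕ) :
    Ready I (σ.setReg x v) :=
  hI.of_eq (fun y hy => by simp; omega) fun _ _ _ => rfl

/-! ### Checking the merge relation -/

/-- The rank of the vertex `u` in the bag of node `j`. -/
def posE (j u : Expr) : Expr := .get 10 (.get 8 j + u)
/-- The digit of the vertex `u` in state `s` of node `j`, where `k` is `y * K` for the digit of
type `y`. -/
def labE (k j s u : Expr) : Expr := .get 12 (.get 11 (k + posE j u) + s)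

/-- The first position of the bag of the node in register `r`. -/
def bagLo (r : ℕ) : Expr := .get 5 (.reg r)
/-- The position after the bag of the node in register `r`. -/
def bagHi (r : ℕ) : Expr := .get 5 (.reg r + .lit 1)

theorem eval_posE {I : Inst} {σ : State} (hR : Ready I σ) {j u : Expr}
    (hj : j.eval σ ≤ I.N) (hu : u.eval σ < I.n) :
    (posE j u).eval σ = I.pos (j.eval σ) (u.eval σ) := by
  simp [posE, hR.mulN _ (hj.trans (Nat.le_add_right _ _)), hR.pos _ hj _ hu]

theorem eval_labE {I : Inst} (h : I.Good) {σ : State} (hR : Ready I σ) {k j s u : Expr} {y : ℕ}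
    (hy : y < 4) (hk : k.eval σ = y * I.K) (hj : j.eval σ ≤ I.N) (hs : s.eval σ < I.M)
    (hu : u.eval σ < I.n) :
    (labE k j s u).eval σ = I.lab y (j.eval σ) (s.eval σ) (u.eval σ) := by
  have hp := h.pos_le _ hj _ hu
  have := Nat.mul_le_mul_right I.K (show y ≤ 3 by omega)
  simp only [labE, Expr.eval_get, Expr.eval_add, eval_posE hR hj hu, hk]
  rw [hR.mulM _ (by omega), hR.digit _ (by omega) _ hs, Inst.lab]

theorem lt_of_mem_bag {I : Inst} (h : I.Good) {j x : ℕ} (hj : j ≤ I.N) (h1 : I.off j ≤ x)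
    (h2 : x < I.off (j + 1)) : I.bag x ∈ I.X j ∧ I.bag x < I.n := by
  have hm : I.bag x ∈ I.X j := Finset.mem_image_of_mem _ (by simp [h1, h2])
  exact ⟨hm, h.bag_lt j hj _ hm⟩

theorem _root_.Inst.Good.sum_bag {I : Inst} (h : I.Good) {j : ℕ} (hj : j ≤ I.N) (g : ℕ → ℕ) :
    ∑ x ∈ Finset.Ico (I.off j) (I.off (j + 1)), g (I.bag x) = ∑ u ∈ I.X j, g u :=
  (Finset.sum_image (h.bag_inj j hj)).symm

/-- Register conventions for merging node `j` (register 11), in state `b` (13), into node `p` (12),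
in state `a` (14), with result `q` (15). -/
structure Regs (I : Inst) (σ : State) (j p b a q : ℕ) : Prop where
  hj : σ.reg 11 = j
  hp : σ.reg 12 = p
  hb : σ.reg 13 = b
  ha : σ.reg 14 = a
  hq : σ.reg 15 = q
  jN : j ≤ I.N
  pN : p ≤ I.N
  bM : b < I.M
  aM : a < I.M
  qM : q < I.M

/-- The program leaves the registers alone that are described by `Regs`. -/
def Prog.keepsMergeRegs (p : Prog) : Bool := (List.range 5).all fun x => !p.wr (x + 11)

theorem Regs.agree {I : Inst} {p : Prog} {σ σ' : State} {j r b a q : ℕ}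
    (hI : Regs I σ j r b a q) (h : Agree p σ σ') (hp : p.keepsMergeRegs = true) :
    Regs I σ' j r b a q := by
  simp only [Prog.keepsMergeRegs, List.all_eq_true, List.mem_range, Bool.not_eq_true'] at hp
  refine ⟨?_, ?_, ?_, ?_, ?_, hI.jN, hI.pN, hI.bM, hI.aM, hI.qM⟩
  · rw [h.reg _ (hp 0 (by omega))]; exact hI.hj
  · rw [h.reg _ (hp 1 (by omega))]; exact hI.hp
  · rw [h.reg _ (hp 2 (by omega))]; exact hI.hb
  · rw [h.reg _ (hp 3 (by omega))]; exact hI.ha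
  · rw [h.reg _ (hp 4 (by omega))]; exact hI.hq

theorem Regs.setReg {I : Inst} {σ : State} {j r b a q : ℕ} (hI : Regs I σ j r b a q) {x : ℕ}
    (hx : 16 ≤ x) (v : ℕ) : Regs I (σ.setReg x v) j r b a q := by
  obtain ⟨h1, h2, h3, h4, h5, h6, h7, h8, h9, h10⟩ := hI
  refine ⟨?_, ?_, ?_, ?_, ?_, h6, h7, h8, h9, h10⟩ <;> simp only [State.setReg_reg] <;>
    rw [if_neg (by omega)] <;> assumption

/-- Digit of type `y` of the vertex in register `u`, in the state of node `j`. -/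
def lj (y u : ℕ) : Expr := labE ([.lit 0, .reg 5, .reg 8, .reg 9].getD y (.lit 0)) (.reg 11)
  (.reg 13) (.reg u)
/-- Digit of type `y` of the vertex in register `u`, in the old state of node `p`. -/
def lp (y u : ℕ) : Expr := labE ([.lit 0, .reg 5, .reg 8, .reg 9].getD y (.lit 0)) (.reg 12)
  (.reg 14) (.reg u)
/-- Digit of type `y` of the vertex in register `u`, in the new state of node `p`. -/
def lq (y u : ℕ) : Expr := labE ([.lit 0, .reg 5, .reg 8, .reg 9].getD y (.lit 0)) (.reg 12)
  (.reg 15) (.reg u)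

theorem eval_lj {I : Inst} (h : I.Good) {σ : State} (hR : Ready I σ) {j p b a q : ℕ}
    (hr : Regs I σ j p b a q) {y x u : ℕ} (hy : y < 4) (hx : σ.reg x = u) (hu : u < I.n) :
    (lj y x).eval σ = I.lab y j b u := by
  rw [lj, eval_labE h hR hy]
  · simp [hr.hj, hr.hb, hx]
  · interval_cases y <;> simp [hR.K, hR.K2, hR.K3]
  · simpa [hr.hj] using hr.jN
  · simpa [hr.hb] using hr.bM
  · simpa [hx] using hu

theorem eval_lp {I : Inst} (h : I.Good) {σ : State} (hR : Ready I σ) {j p b a q : ℕ}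
    (hr : Regs I σ j p b a q) {y x u : ℕ} (hy : y < 4) (hx : σ.reg x = u) (hu : u < I.n) :
    (lp y x).eval σ = I.lab y p a u := by
  rw [lp, eval_labE h hR hy]
  · simp [hr.hp, hr.ha, hx]
  · interval_cases y <;> simp [hR.K, hR.K2, hR.K3]
  · simpa [hr.hp] using hr.pN
  · simpa [hr.ha] using hr.aM
  · simpa [hx] using hu

theorem eval_lq {I : Inst} (h : I.Good) {σ : State} (hR : Ready I σ) {j p b a q : ℕ}
    (hr : Regs I σ j p b a q) {y x u : ℕ} (hy : y < 4) (hx : σ.reg x = u) (hu : u < I.n) :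
    (lq y x).eval σ = I.lab y p q u := by
  rw [lq, eval_labE h hR hy]
  · simp [hr.hp, hr.hq, hx]
  · interval_cases y <;> simp [hR.K, hR.K2, hR.K3]
  · simpa [hr.hp] using hr.pN
  · simpa [hr.hq] using hr.qM
  · simpa [hx] using hu

theorem eval_pos {I : Inst} {σ : State} (hR : Ready I σ) {x y j u : ℕ} (hx : σ.reg x = j)
    (hj : j ≤ I.N) (hy : σ.reg y = u) (hu : u < I.n) :
    (posE (.reg x) (.reg y)).eval σ = I.pos j u := by
  rw [eval_posE hR] <;> simp [hx, hy, hj, hu]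

/-- Whether the edge between the vertices in registers `17` and `19` is accounted for. -/
def edgeE : Expr :=
  (Expr.get 9 (.get 8 (.reg 17) + .reg 19)).and
    ((posE (.reg 12) (.reg 17)).not.or (posE (.reg 12) (.reg 19)).not)

/-- The update of the two counters in registers `20` and `21` for one neighbour. -/
def gainBody : Prog :=
  .assign 19 (.get 6 (.reg 18)) ;;
  .assign 20 (.reg 20 + edgeE.and ((lj 1 17).le (lj 0 19))) ;;
  .assign 21 (.reg 21 + edgeE.and ((lj 0 19).not.or ((lj 1 19).le (lj 0 17))))

/-- The update of the two counters for all neighbours of the vertex in register `17`. -/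
def gainP : Prog := .for 18 (bagLo 11) (bagHi 11) gainBody

theorem eval_edgeE {I : Inst} {σ : State} (hR : Ready I σ) {p u w : ℕ} (hp : σ.reg 12 = p)
    (hpN : p ≤ I.N) (hu : σ.reg 17 = u) (hun : u < I.n) (hw : σ.reg 19 = w) (hwn : w < I.n) :
    edgeE.eval σ = if I.adj u w ≠ 0 ∧ (I.pos p u = 0 ∨ I.pos p w = 0) then 1 else 0 := by
  simp only [edgeE, Expr.eval_and, Expr.eval_or, Expr.eval_not, eval_pos hR hp hpN hu hun,
    eval_pos hR hp hpN hw hwn, Expr.eval_get, Expr.eval_add, Expr.eval_reg, hu, hw,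
    hR.mulN u (by omega), hR.adj u hun w hwn]
  simp [or_iff_not_imp_left]

theorem gainP_runs {I : Inst} (h : I.Good) {σ : State} (hR : Ready I σ) {j p b a q u : ℕ}
    (hr : Regs I σ j p b a q) (hu : σ.reg 17 = u) (hun : u < I.n) :
    Runs gainP σ ((I.K + 1) * (gainBody.size + ((bagLo 11).cost + (bagHi 11).cost + 10)))
      (fun σ' =>
        σ'.reg 20 = σ.reg 20 + I.gain (Inst.Late (I.lab 0 j b) (I.lab 1 j b)) j p u ∧
        σ'.reg 21 = σ.reg 21 + I.gain (Inst.Helps (I.lab 0 j b) (I.lab 1 j b)) j p u) := by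
  have hoff := h.off_sub j hr.jN
  refine (Runs.for (m := I.off j) (k := I.off (j + 1)) (T := gainBody.size) (fun i σ' =>
    σ'.reg 20 = σ.reg 20 + ∑ x ∈ Finset.Ico (I.off j) i, (if I.adj u (I.bag x) ≠ 0 ∧
      (I.pos p u = 0 ∨ I.pos p (I.bag x) = 0) ∧
        Inst.Late (I.lab 0 j b) (I.lab 1 j b) u (I.bag x) then 1 else 0) ∧
    σ'.reg 21 = σ.reg 21 + ∑ x ∈ Finset.Ico (I.off j) i, (if I.adj u (I.bag x) ≠ 0 ∧
      (I.pos p u = 0 ∨ I.pos p (I.bag x) = 0) ∧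
        Inst.Helps (I.lab 0 j b) (I.lab 1 j b) u (I.bag x) then 1 else 0))
    (by rfl) ?_ (h.off_le j hr.jN) (by simp) ?_ ?_).mono ?_ ?_
  · simp [bagLo, hr.hj, hR.off j (by have := hr.jN; omega)]
  · intro σ' i hA _
    have hR' := hR.agree hA (by rfl)
    have hr' := hr.agree hA (by rfl)
    simp [bagHi, hr'.hj, hR'.off (j + 1) (by have := hr.jN; omega)]
  · intro i σ' hi1 hi2 hA hx ⟨h1, h2⟩
    have hw := (lt_of_mem_bag h hr.jN hi1 hi2).2
    refine Runs.flat (by rfl) le_rfl ?_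
    have hR1 : Ready I (σ'.setReg 19 (I.bag i)) :=
      (hR.agree hA (by rfl)).setReg (by omega) _
    have hr1 : Regs I (σ'.setReg 19 (I.bag i)) j p b a q :=
      (hr.agree hA (by rfl)).setReg (by omega) _
    have hu1 : σ'.reg 17 = u := (hA.reg 17 (by rfl)).trans hu
    have hb : σ'.arr 6 = I.bag := (hR.agree hA (by rfl)).bag
    set σ₁ := σ'.setReg 19 (I.bag i) with hσ₁
    have hu1 : σ₁.reg 17 = u := by simpa [hσ₁] using hu1
    have hw1 : σ₁.reg 19 = I.bag i := by simp [hσ₁]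
    have e20 : σ₁.reg 20 = σ'.reg 20 := by simp [hσ₁]
    have e21 : σ₁.reg 21 = σ'.reg 21 := by simp [hσ₁]
    have hR2 : ∀ v, Ready I (σ₁.setReg 20 v) := fun v =>
      hR1.setReg (by omega) v
    have hr2 : ∀ v, Regs I (σ₁.setReg 20 v) j p b a q := fun v =>
      hr1.setReg (by omega) v
    have hden : gainBody.den σ' = (σ₁.setReg 20 (σ₁.reg 20 +
        if I.adj u (I.bag i) ≠ 0 ∧ (I.pos p u = 0 ∨ I.pos p (I.bag i) = 0) ∧
          Inst.Late (I.lab 0 j b) (I.lab 1 j b) u (I.bag i) then 1 else 0)).setReg 21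
        (σ₁.reg 21 +
        if I.adj u (I.bag i) ≠ 0 ∧ (I.pos p u = 0 ∨ I.pos p (I.bag i) = 0) ∧
          Inst.Helps (I.lab 0 j b) (I.lab 1 j b) u (I.bag i) then 1 else 0) := by
      simp only [gainBody, Prog.den, Expr.eval_get, Expr.eval_reg, hx, hb, ← hσ₁, Expr.eval_add,
        Expr.eval_and, Expr.eval_or, Expr.eval_not, Expr.eval_le,
        eval_edgeE hR1 hr1.hp hr.pN hu1 hun hw1 hw,
        eval_lj h hR1 hr1 (y := 1) (by omega) hu1 hun,
        eval_lj h hR1 hr1 (y := 0) (by omega) hw1 hw]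
      rw [eval_edgeE (hR2 _) (hr2 _).hp hr.pN (by simpa using hu1) hun (by simpa using hw1) hw,
        eval_lj h (hR2 _) (hr2 _) (y := 0) (by omega) (by simpa using hw1) hw,
        eval_lj h (hR2 _) (hr2 _) (y := 1) (by omega) (by simpa using hw1) hw,
        eval_lj h (hR2 _) (hr2 _) (y := 0) (by omega) (by simpa using hu1) hun]
      simp [and_assoc, or_iff_not_imp_left, Inst.Late, Inst.Helps]
    rw [hden, Finset.sum_Ico_succ_top hi1, Finset.sum_Ico_succ_top hi1]
    simp only [State.setReg_reg, e20, e21, h1, h2]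
    simp [add_assoc]
  · exact Nat.mul_le_mul_right _ (by omega)
  · rintro σ' - ⟨h1, h2⟩
    rw [h1, h2]
    exact ⟨by rw [h.sum_bag hr.jN fun w => if I.adj u w ≠ 0 ∧ (I.pos p u = 0 ∨ I.pos p w = 0) ∧
        Inst.Late (I.lab 0 j b) (I.lab 1 j b) u w then 1 else 0]; rfl,
      by rw [h.sum_bag hr.jN fun w => if I.adj u w ≠ 0 ∧ (I.pos p u = 0 ∨ I.pos p w = 0) ∧
        Inst.Helps (I.lab 0 j b) (I.lab 1 j b) u w then 1 else 0]; rfl⟩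

/-- Whether the vertex in register `17` of the merged bag, with counters in registers `20` and
`21`, meets the conditions of the merge relation. -/
def vertexE : Expr :=
  ((posE (.reg 12) (.reg 17)).not.and (((lj 0 17).lt (lj 1 17)).and
    (((Expr.reg 20).le (.lit 1)).and
      (((lj 0 17).not.or (((Expr.reg 4).lt (lj 0 17)).or ((Expr.lit 1).le (.reg 21)))).and
        ((Expr.get 2 (.reg 17)).not.or ((lj 0 17).le (.reg 4))))))).or
  ((posE (.reg 12) (.reg 17)).and (((lj 0 17).eq (lp 0 17)).and (((lj 1 17).eq (lp 1 17)).and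
    (((lq 2 17).eq ((lp 2 17 + .reg 20) - ((lp 2 17 + .reg 20) - .lit 2))).and
      ((lq 3 17).eq ((lp 3 17 + .reg 21) - ((lp 3 17 + .reg 21) - .lit 2)))))))

/-- Whether the vertex in register `17` keeps its labels, and its counters if it has to. -/
def keepE : Expr :=
  ((lq 0 17).eq (lp 0 17)).and (((lq 1 17).eq (lp 1 17)).and
    ((posE (.reg 11) (.reg 17)).or (((lq 2 17).eq (lp 2 17)).and ((lq 3 17).eq (lp 3 17)))))

/-- Loads the vertex and its counters. -/
def vertexHead : Prog :=
  .assign 17 (.get 6 (.reg 16)) ;; .assign 20 (lj 2 17) ;; .assign 21 (lj 3 17)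
/-- Evaluates the conditions for the vertex, once its neighbours have been counted. -/
def vertexTail : Prog :=
  .assign 22 (.reg 22 + vertexE.not) ;;
  .assign 23 (.reg 23 + (posE (.reg 12) (.reg 17)).not.and (lj 0 17).not)

/-- The check of one vertex of the merged bag: violations are counted in register `22`, the cost in
register `23`. -/
def vertexP : Prog := vertexHead ;; gainP ;; vertexTail

/-- The check of one vertex of the other bag. -/
def keepP : Prog := .assign 17 (.get 6 (.reg 16)) ;; .assign 22 (.reg 22 + keepE.not)

/-- The check of the merge relation for the states in registers `13` to `15`; register `22` is zero
afterwards if and only if it holds, and register `23` contains the cost. -/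
def checkP : Prog :=
  (.assign 22 (.lit 0) ;; .assign 23 (.lit 0)) ;; .for 16 (bagLo 11) (bagHi 11) vertexP ;;
    .for 16 (bagLo 12) (bagHi 12) keepP

theorem ite_flip (P : Prop) [Decidable P] :
    (if (if P then 1 else 0 : ℕ) = 0 then 1 else 0 : ℕ) = if P then 0 else 1 := by
  split_ifs <;> simp_all

open Classical in
theorem vertexP_runs {I : Inst} (h : I.Good) {σ : State} (hR : Ready I σ) {j p b a q x : ℕ}
    (hr : Regs I σ j p b a q) (hx : σ.reg 16 = x) (hun : I.bag x < I.n) :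
    Runs vertexP σ (vertexHead.size +
      ((I.K + 1) * (gainBody.size + ((bagLo 11).cost + (bagHi 11).cost + 10)) + vertexTail.size))
      (fun σ' =>
        σ'.reg 22 = σ.reg 22 + (if (I.pos p (I.bag x) = 0 ∧ I.ForgetOK j p b (I.bag x)) ∨
          (I.pos p (I.bag x) ≠ 0 ∧ I.MergeOK j p a b q (I.bag x)) then 0 else 1) ∧
        σ'.reg 23 = σ.reg 23 +
          if I.pos p (I.bag x) = 0 ∧ I.lab 0 j b (I.bag x) = 0 then 1 else 0) := by
  obtain ⟨u, hu⟩ : ∃ u, u = I.bag x := ⟨_, rfl⟩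
  rw [← hu] at hun ⊢
  have hR1 : Ready I (σ.setReg 17 u) := hR.setReg (by omega) _
  have hr1 : Regs I (σ.setReg 17 u) j p b a q := hr.setReg (by omega) _
  have hden : vertexHead.den σ = ((σ.setReg 17 u).setReg 20 (I.lab 2 j b u)).setReg 21
      (I.lab 3 j b u) := by
    simp only [vertexHead, Prog.den, Expr.eval_get, Expr.eval_reg, hx, hR.bag, ← hu]
    rw [eval_lj h hR1 hr1 (by omega) (u := u) (by simp) hun,
      eval_lj h (hR1.setReg (by omega) _) (hr1.setReg (by omega) _) (by omega) (u := u) (by simp)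
        hun]
  refine (Runs.flat (Q := fun σ' => σ' = vertexHead.den σ) (by rfl) le_rfl rfl).seq ?_
  rintro σ₁ - hσ₁
  rw [hden] at hσ₁
  have hR2 : Ready I σ₁ := by
    rw [hσ₁]; exact (hR1.setReg (by omega) _).setReg (by omega) _
  have hr2 : Regs I σ₁ j p b a q := by
    rw [hσ₁]; exact (hr1.setReg (by omega) _).setReg (by omega) _
  have hu2 : σ₁.reg 17 = u := by simp [hσ₁]
  refine (gainP_runs h hR2 hr2 hu2 hun).seq ?_
  rintro σ₂ hA ⟨h20, h21⟩
  have hR3 := hR2.agree hA (by rfl)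
  have hr3 := hr2.agree hA (by rfl)
  have hu3 : σ₂.reg 17 = u := (hA.reg 17 (by rfl)).trans hu2
  have h22 : σ₂.reg 22 = σ.reg 22 := (hA.reg 22 (by rfl)).trans (by simp [hσ₁])
  have h23 : σ₂.reg 23 = σ.reg 23 := (hA.reg 23 (by rfl)).trans (by simp [hσ₁])
  replace h20 : σ₂.reg 20 = I.lateCount j p b u := by rw [h20, hσ₁]; simp [Inst.lateCount]
  replace h21 : σ₂.reg 21 = I.helpCount j p b u := by rw [h21, hσ₁]; simp [Inst.helpCount]
  refine Runs.flat (by rfl) le_rfl ?_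
  have hsat : ∀ z, z - (z - 2) = min z 2 := by intro z; omega
  have hE : vertexE.eval σ₂ = if (I.pos p u = 0 ∧ I.ForgetOK j p b u) ∨
      (I.pos p u ≠ 0 ∧ I.MergeOK j p a b q u) then 1 else 0 := by
    simp only [vertexE, Expr.eval_and, Expr.eval_or, Expr.eval_not, Expr.eval_le, Expr.eval_lt,
      Expr.eval_eq, Expr.eval_add, Expr.eval_sub, Expr.eval_get, Expr.eval_lit, Expr.eval_reg,
      eval_pos hR3 hr3.hp hr3.pN hu3 hun, eval_lj h hR3 hr3 (y := 0) (by omega) hu3 hun,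
      eval_lj h hR3 hr3 (y := 1) (by omega) hu3 hun,
      eval_lp h hR3 hr3 (y := 0) (by omega) hu3 hun,
      eval_lp h hR3 hr3 (y := 1) (by omega) hu3 hun,
      eval_lp h hR3 hr3 (y := 2) (by omega) hu3 hun,
      eval_lp h hR3 hr3 (y := 3) (by omega) hu3 hun,
      eval_lq h hR3 hr3 (y := 2) (by omega) hu3 hun,
      eval_lq h hR3 hr3 (y := 3) (by omega) hu3 hun, h20, h21, hu3, hR3.inV u hun, hR3.L, hsat]
    simp only [ite_eq_right_iff, one_ne_zero, imp_false, ne_eq, Decidable.not_not]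
    exact if_congr Iff.rfl rfl rfl
  simp only [vertexTail, Prog.den, Expr.eval_add, Expr.eval_not, hE, ite_flip]
  constructor
  · simp [h22]
  · rw [State.setReg_reg, if_pos rfl, Expr.eval_and, Expr.eval_not, Expr.eval_not,
      eval_pos (hR3.setReg (by omega) _) (hr3.setReg (by omega) _).hp hr3.pN (by simpa using hu3)
        hun, eval_lj h (hR3.setReg (by omega) _) (hr3.setReg (by omega) _) (y := 0) (by omega)
        (by simpa using hu3) hun]
    simp [h23]

/-- An upper bound for the running time of the check. -/
def checkTime (K : ℕ) : ℕ :=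
  7 + ((K + 1) * (vertexHead.size + ((K + 1) * (gainBody.size +
      ((bagLo 11).cost + (bagHi 11).cost + 10)) + vertexTail.size) +
      ((bagLo 11).cost + (bagHi 11).cost + 10)) +
    (K + 1) * (keepP.size + ((bagLo 12).cost + (bagHi 12).cost + 10)))

open Classical in
theorem checkP_runs {I : Inst} (h : I.Good) {σ : State} (hR : Ready I σ) {j p b a q : ℕ}
    (hr : Regs I σ j p b a q) :
    Runs checkP σ (checkTime I.K)
      (fun σ' => (σ'.reg 22 = 0 ↔ I.Rel j p a b q) ∧ σ'.reg 23 = I.cost j p b) := by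
  have hoffj := h.off_sub j hr.jN
  have hoffp := h.off_sub p hr.pN
  refine (Runs.flat (Q := fun σ' => σ' = (σ.setReg 22 0).setReg 23 0) (T := 7) (by rfl)
    (by decide) rfl).seq ?_
  rintro σ₁ - hσ₁
  have hR1 : Ready I σ₁ := by rw [hσ₁]; exact (hR.setReg (by omega) _).setReg (by omega) _
  have hr1 : Regs I σ₁ j p b a q := by
    rw [hσ₁]; exact (hr.setReg (by omega) _).setReg (by omega) _
  have h22 : σ₁.reg 22 = 0 := by simp [hσ₁]
  have h23 : σ₁.reg 23 = 0 := by simp [hσ₁]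
  clear hσ₁
  let bad : ℕ → ℕ := fun u => if (I.pos p u = 0 ∧ I.ForgetOK j p b u) ∨
    (I.pos p u ≠ 0 ∧ I.MergeOK j p a b q u) then 0 else 1
  let bad' : ℕ → ℕ := fun u => if I.KeepOK j p a q u then 0 else 1
  have hbad : ∀ u, bad u = 0 ↔ (I.pos p u = 0 ∧ I.ForgetOK j p b u) ∨
    (I.pos p u ≠ 0 ∧ I.MergeOK j p a b q u) := by intro u; simp only [bad]; split_ifs <;> simp_all
  have hbad' : ∀ u, bad' u = 0 ↔ I.KeepOK j p a q u := by
    intro u; simp only [bad']; split_ifs <;> simp_all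
  refine Runs.seq (R := fun σ' => σ'.reg 22 = ∑ u ∈ I.X j, bad u ∧ σ'.reg 23 = I.cost j p b)
    ((Runs.for (m := I.off j) (k := I.off (j + 1)) (fun i σ' =>
      σ'.reg 22 = ∑ x ∈ Finset.Ico (I.off j) i, bad (I.bag x) ∧
      σ'.reg 23 = ∑ x ∈ Finset.Ico (I.off j) i,
        if I.pos p (I.bag x) = 0 ∧ I.lab 0 j b (I.bag x) = 0 then 1 else 0)
      (by rfl) ?_ (h.off_le j hr.jN) (by simp [h22, h23]) ?_ ?_).mono
      (Nat.mul_le_mul_right _ (by omega)) ?_) ?_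
  · simp [bagLo, hr1.hj, hR1.off j (by have := hr.jN; omega)]
  · intro σ' i hA _
    simp [bagHi, (hr1.agree hA (by rfl)).hj,
      (hR1.agree hA (by rfl)).off (j + 1) (by have := hr.jN; omega)]
  · rintro i σ' hi1 hi2 hA hx ⟨h1, h2⟩
    refine (vertexP_runs h (hR1.agree hA (by rfl)) (hr1.agree hA (by rfl)) hx
      (lt_of_mem_bag h hr.jN hi1 hi2).2).mono le_rfl ?_
    rintro σ'' - ⟨h3, h4⟩
    rw [Finset.sum_Ico_succ_top hi1, Finset.sum_Ico_succ_top hi1, ← h1, ← h2]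
    simpa using ⟨h3, h4⟩
  · rintro σ' - ⟨h1, h2⟩
    rw [h1, h2, h.sum_bag hr.jN bad, h.sum_bag hr.jN fun u =>
      if I.pos p u = 0 ∧ I.lab 0 j b u = 0 then 1 else 0]
    exact ⟨rfl, by simp [Inst.cost]⟩
  rintro σ₂ hA₂ ⟨h22, h23⟩
  have hR2 := hR1.agree hA₂ (by rfl)
  have hr2 := hr1.agree hA₂ (by rfl)
  refine (Runs.for (m := I.off p) (k := I.off (p + 1)) (fun i σ' =>
      σ'.reg 22 = ∑ u ∈ I.X j, bad u + ∑ x ∈ Finset.Ico (I.off p) i, bad' (I.bag x))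
      (by rfl) ?_ (h.off_le p hr.pN) (by simp [h22]) ?_ ?_).mono
      (Nat.mul_le_mul_right _ (by omega)) ?_
  · simp [bagLo, hr2.hp, hR2.off p (by have := hr.pN; omega)]
  · intro σ' i hA _
    simp [bagHi, (hr2.agree hA (by rfl)).hp,
      (hR2.agree hA (by rfl)).off (p + 1) (by have := hr.pN; omega)]
  · rintro i σ' hi1 hi2 hA hx h1
    have hun := (lt_of_mem_bag h hr.pN hi1 hi2).2
    refine Runs.flat (by rfl) le_rfl ?_
    have hR3 : Ready I (σ'.setReg 17 (I.bag i)) := (hR2.agree hA (by rfl)).setReg (by omega) _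
    have hr3 : Regs I (σ'.setReg 17 (I.bag i)) j p b a q :=
      (hr2.agree hA (by rfl)).setReg (by omega) _
    have hu3 : (σ'.setReg 17 (I.bag i)).reg 17 = I.bag i := by simp
    have hE : keepE.eval (σ'.setReg 17 (I.bag i)) =
        if I.KeepOK j p a q (I.bag i) then 1 else 0 := by
      simp only [keepE, Expr.eval_and, Expr.eval_or, Expr.eval_eq,
        eval_pos hR3 hr3.hj hr3.jN hu3 hun,
        eval_lp h hR3 hr3 (y := 0) (by omega) hu3 hun,
        eval_lp h hR3 hr3 (y := 1) (by omega) hu3 hun,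
        eval_lp h hR3 hr3 (y := 2) (by omega) hu3 hun,
        eval_lp h hR3 hr3 (y := 3) (by omega) hu3 hun,
        eval_lq h hR3 hr3 (y := 0) (by omega) hu3 hun,
        eval_lq h hR3 hr3 (y := 1) (by omega) hu3 hun,
        eval_lq h hR3 hr3 (y := 2) (by omega) hu3 hun,
        eval_lq h hR3 hr3 (y := 3) (by omega) hu3 hun]
      simp only [ite_eq_right_iff, one_ne_zero, imp_false, ne_eq, Decidable.not_not]
      exact if_congr Iff.rfl rfl rfl
    have hb : σ'.arr 6 = I.bag := (hR2.agree hA (by rfl)).bag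
    rw [Finset.sum_Ico_succ_top hi1, ← add_assoc, ← h1]
    simp only [keepP, Prog.den, Expr.eval_get, Expr.eval_reg, hx, hb, Expr.eval_add, Expr.eval_not,
      hE, ite_flip]
    simp [bad']
  · rintro σ₃ hA h1
    rw [h1, h.sum_bag hr.pN bad', hA.reg 23 (by rfl)]
    refine ⟨?_, h23⟩
    rw [Nat.add_eq_zero_iff, Finset.sum_eq_zero_iff, Finset.sum_eq_zero_iff]
    simp only [hbad, hbad']
    rfl

end RAM

namespace RAM

/-! ### The dynamic program -/

/-- Different positions in a matrix with rows of length `M` have different addresses. -/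
theorem addr_inj {M j s j' s' : ℕ} (hs : s < M) (hs' : s' < M) (h : j * M + s = j' * M + s') :
    j = j' ∧ s = s' := by
  have hj : j = j' := by
    rcases lt_trichotomy j j' with hlt | heq | hlt
    · have := Nat.mul_le_mul_right M (Nat.succ_le_of_lt hlt)
      rw [Nat.succ_mul] at this
      omega
    · exact heq
    · have := Nat.mul_le_mul_right M (Nat.succ_le_of_lt hlt)
      rw [Nat.succ_mul] at this
      omega
  subst hj
  exact ⟨rfl, by omega⟩

/-- The new entry if the pair of states in registers `14` and `13` is combined. -/
def candE : Expr :=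
  .get 15 (.get 11 (.reg 12) + .reg 14) + .get 15 (.get 11 (.reg 11) + .reg 13) -
    (.reg 0 + .lit 1) - .reg 23

/-- Replaces the best entry so far if the new one is larger and the merge relation holds. -/
def pairTail : Prog :=
  .assign 27 candE ;;
  .ite ((Expr.reg 22).not.and ((Expr.reg 24).lt (.reg 27)))
    (.assign 24 (.reg 27) ;; .assign 25 (.reg 14) ;; .assign 26 (.reg 13)) .skip

/-- Tries one pair of states; the best entry so far and the pair that attains it are in registers
`24`, `25`, `26`. -/
def pairP : Prog := checkP ;; pairTail

/-- Resets the best entry. -/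
def stateHead : Prog := .assign 24 (.lit 0) ;; .assign 25 (.lit 0) ;; .assign 26 (.lit 0)

/-- Stores the best entry and the pointers. -/
def stateTail : Prog :=
  .store 16 (.get 11 (.reg 11) + .reg 15) (.reg 24) ;;
  .store 17 (.get 11 (.reg 11) + .reg 15) (.reg 25) ;;
  .store 18 (.get 11 (.reg 11) + .reg 15) (.reg 26)

/-- Computes the new entry for the state in register `15` and stores it in array `16`, with
pointers in arrays `17` and `18`. -/
def stateP : Prog :=
  stateHead ;;
    .for 14 (.lit 0) (.reg 7) (.for 13 (.lit 0) (.reg 7) pairP) ;; stateTail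

/-- Loads the node and its parent. -/
def mergeHead : Prog := .assign 11 (.get 14 (.reg 28)) ;; .assign 12 (.get 13 (.reg 11))

/-- Copies the new entry of the parent from array `16`, where it could not disturb the old ones, to
the table. -/
def copyP : Prog :=
  .store 15 (.get 11 (.reg 12) + .reg 15) (.get 16 (.get 11 (.reg 11) + .reg 15))

/-- Merges the node with the index in register `28` into its parent. -/
def mergeP : Prog :=
  mergeHead ;; .for 15 (.lit 0) (.reg 7) stateP ;; .for 15 (.lit 0) (.reg 7) copyP

/-- The main loop: all nodes are merged into their parents, bottom-up. -/
def dpP : Prog := .for 28 (.lit 0) (.reg 2) mergeP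

theorem pairP_runs {I : Inst} (h : I.Good) {σ : State} (hR : Ready I σ) {j p b a q : ℕ}
    (hr : Regs I σ j p b a q) {T : ℕ → ℕ → ℕ}
    (hT : ∀ q ≤ I.N, ∀ s < I.M, σ.arr 15 (q * I.M + s) = T q s) :
    Runs pairP σ (checkTime I.K + pairTail.size) (fun σ' =>
      (σ.reg 24 < I.cand T j p q a b ∧ σ'.reg 24 = I.cand T j p q a b ∧ σ'.reg 25 = a ∧
        σ'.reg 26 = b) ∨
      (I.cand T j p q a b ≤ σ.reg 24 ∧ σ'.reg 24 = σ.reg 24 ∧ σ'.reg 25 = σ.reg 25 ∧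
        σ'.reg 26 = σ.reg 26)) := by
  refine (checkP_runs h hR hr).seq ?_
  rintro σ₁ hA ⟨h22, h23⟩
  have hR1 := hR.agree hA (by rfl)
  have hr1 := hr.agree hA (by rfl)
  refine Runs.flat (by rfl) le_rfl ?_
  have hval : candE.eval σ₁ = T p a + T j b - (I.n + 1) - I.cost j p b := by
    have hjN := hr.jN
    have hpN := hr.pN
    simp only [candE, Expr.eval_sub, Expr.eval_add, Expr.eval_get, Expr.eval_reg, Expr.eval_lit,
      hr1.hj, hr1.hp, hr1.ha, hr1.hb, h23, hR1.n, hR1.mulM p (by omega), hR1.mulM j (by omega),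
      hA.arr 15 (by rfl), hT p hpN a hr.aM, hT j hjN b hr.bM]
  have h24 := hA.reg 24 (by rfl)
  have h25 := hA.reg 25 (by rfl)
  have h26 := hA.reg 26 (by rfl)
  have ha := hr1.ha
  have hb := hr1.hb
  simp only [pairTail, Prog.den, hval]
  by_cases hRel : I.Rel j p a b q
  · have e22 : σ₁.reg 22 = 0 := h22.2 hRel
    rw [Inst.cand, if_pos hRel]
    by_cases hlt : σ.reg 24 < T p a + T j b - (I.n + 1) - I.cost j p b
    · left
      simp [e22, h24, hlt, ha, hb]
    · right
      simp [e22, h24, hlt, h25, h26, not_lt.1 hlt]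
  · have e22 : σ₁.reg 22 ≠ 0 := fun h' => hRel (h22.1 h')
    rw [Inst.cand, if_neg hRel]
    right
    simp [e22, h24, h25, h26]

/-- Register `24` holds the best value, and registers `25` and `26` a pair that attains it. -/
structure Best (I : Inst) (f : ℕ → ℕ → ℕ) (v : ℕ) (σ : State) : Prop where
  val : σ.reg 24 = v
  attain : v ≠ 0 → σ.reg 25 < I.M ∧ σ.reg 26 < I.M ∧ v = f (σ.reg 25) (σ.reg 26)

theorem Best.setReg {I : Inst} {f : ℕ → ℕ → ℕ} {v : ℕ} {σ : State} (h : Best I f v σ) {x : ℕ}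
    (hx : x < 24) (w : ℕ) : Best I f v (σ.setReg x w) := by
  obtain ⟨h1, h2⟩ := h
  have e : ∀ y, 24 ≤ y → (σ.setReg x w).reg y = σ.reg y := fun y hy => by
    rw [State.setReg_reg, if_neg (by omega)]
  exact ⟨by rw [e 24 le_rfl, h1], by rw [e 25 (by omega), e 26 (by omega)]; exact h2⟩

/-- Time for one state. -/
def stateTime (K M : ℕ) : ℕ :=
  stateHead.size + ((M + 1) * ((M + 1) * (checkTime K + pairTail.size + 12) + 12) +
    stateTail.size)

theorem stateP_runs {I : Inst} (h : I.Good) {σ : State} (hR : Ready I σ) {j p q : ℕ}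
    (hj : σ.reg 11 = j) (hjN : j ≤ I.N) (hp : σ.reg 12 = p) (hpN : p ≤ I.N)
    (hq : σ.reg 15 = q) (hqM : q < I.M) {T : ℕ → ℕ → ℕ}
    (hT : ∀ q ≤ I.N, ∀ s < I.M, σ.arr 15 (q * I.M + s) = T q s) :
    Runs stateP σ (stateTime I.K I.M) (fun σ' => ∃ v x y,
      v = ((Finset.range I.M).sup fun a => (Finset.range I.M).sup fun b => I.cand T j p q a b) ∧
      (v ≠ 0 → x < I.M ∧ y < I.M ∧ v = I.cand T j p q x y) ∧
      σ'.arr 16 = Function.update (σ.arr 16) (j * I.M + q) v ∧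
      σ'.arr 17 = Function.update (σ.arr 17) (j * I.M + q) x ∧
      σ'.arr 18 = Function.update (σ.arr 18) (j * I.M + q) y) := by
  refine (Runs.flat (Q := fun σ' => σ' = stateHead.den σ) (by rfl) le_rfl rfl).seq ?_
  rintro σ₀ hA₀ hσ₀
  have hR0 := hR.agree hA₀ (by rfl)
  have hj0 := (hA₀.reg 11 (by rfl)).trans hj
  have hp0 := (hA₀.reg 12 (by rfl)).trans hp
  have hq0 := (hA₀.reg 15 (by rfl)).trans hq
  have h15 := hA₀.arr 15 (by rfl)
  have h16 := hA₀.arr 16 (by rfl)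
  have h17 := hA₀.arr 17 (by rfl)
  have h18 := hA₀.arr 18 (by rfl)
  have h24 : σ₀.reg 24 = 0 := by simp [hσ₀, stateHead, Prog.den]
  clear hσ₀
  let f : ℕ → ℕ → ℕ := fun a b => I.cand T j p q a b
  refine Runs.seq (R := Best I f ((Finset.range I.M).sup fun a => (Finset.range I.M).sup (f a)))
    ((Runs.for (m := 0) (k := I.M) (T := (I.M + 1) * (checkTime I.K + pairTail.size + 12))
      (fun i σ' => Best I f ((Finset.range i).sup fun a => (Finset.range I.M).sup (f a)) σ')
      (by rfl) rfl (Nat.zero_le _) ⟨by simpa using h24, by simp⟩ ?_ ?_).mono le_rfl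
      fun _ _ h' => h') ?_
  · intro σ' i hA _
    exact (hR0.agree hA (by rfl)).M
  · intro a σ₁ _ haM hA₁ ha hB
    have hR1 := hR0.agree hA₁ (by rfl)
    refine (Runs.for (m := 0) (k := I.M) (fun i σ' => Best I f
      (max ((Finset.range a).sup fun a => (Finset.range I.M).sup (f a))
        ((Finset.range i).sup (f a))) σ')
      (by rfl) rfl (Nat.zero_le _) ?_ ?_ ?_).mono le_rfl ?_
    · have := hB.setReg (x := 13) (by omega) 0
      simpa using this
    · intro σ' i hA _
      exact (hR1.agree hA (by rfl)).M
    · intro b σ₂ _ hbM hA₂ hb hB2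
      have hR2 := hR1.agree hA₂ (by rfl)
      have hr2 : Regs I σ₂ j p b a q :=
        ⟨(hA₂.reg 11 (by rfl)).trans ((hA₁.reg 11 (by rfl)).trans hj0),
          (hA₂.reg 12 (by rfl)).trans ((hA₁.reg 12 (by rfl)).trans hp0), hb,
          (hA₂.reg 14 (by rfl)).trans ha,
          (hA₂.reg 15 (by rfl)).trans ((hA₁.reg 15 (by rfl)).trans hq0), hjN, hpN, hbM, haM, hqM⟩
      refine (pairP_runs h hR2 hr2 (T := T) (by
        rw [hA₂.arr 15 (by rfl), hA₁.arr 15 (by rfl), h15]; exact hT)).mono le_rfl ?_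
      intro σ₃ _ h3
      refine Best.setReg ?_ (by omega) _
      rw [Finset.range_add_one, Finset.sup_insert]
      obtain ⟨e1, e2⟩ := hB2
      generalize hW : ((Finset.range a).sup fun a => (Finset.range I.M).sup (f a)) = W at *
      generalize hW' : (Finset.range b).sup (f a) = W' at *
      have hf : f a b = I.cand T j p q a b := rfl
      rcases h3 with ⟨h1, h2, h3, h4⟩ | ⟨h1, h2, h3, h4⟩
      · have hm : max W (max (f a b) W') = f a b := by
          rw [hf]; omega
        refine ⟨by rw [hm, h2], fun _ => ?_⟩
        rw [hm, h3, h4]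
        exact ⟨haM, hbM, rfl⟩
      · have hm : max W (max (f a b) W') = max W W' := by
          rw [hf]; omega
        refine ⟨by rw [hm, h2, e1], fun hne => ?_⟩
        rw [hm, h3, h4] at *
        exact e2 hne
    · intro σ' _ h'
      refine Best.setReg ?_ (by omega) _
      rw [Finset.range_add_one, Finset.sup_insert]
      rwa [max_comm] at h'
  intro σ₁ hA₁ hB
  refine Runs.flat (by rfl) le_rfl ?_
  have hR1 := hR0.agree hA₁ (by rfl)
  have hj1 := (hA₁.reg 11 (by rfl)).trans hj0
  have hq1 := (hA₁.reg 15 (by rfl)).trans hq0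
  have hm := hR1.mulM j (by omega)
  refine ⟨_, σ₁.reg 25, σ₁.reg 26, rfl, hB.attain, ?_, ?_, ?_⟩
  · simp [stateTail, Prog.den, hj1, hq1, hm, hB.val, hA₁.arr 16 (by rfl), h16, f]
  · simp [stateTail, Prog.den, hj1, hq1, hm, hA₁.arr 17 (by rfl), h17]
  · simp [stateTail, Prog.den, hj1, hq1, hm, hA₁.arr 18 (by rfl), h18]

/-- Time for one merge. -/
def mergeTime (K M : ℕ) : ℕ :=
  mergeHead.size + ((M + 1) * (stateTime K M + 12) + (M + 1) * (copyP.size + 12))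

/-- The pointers stored in arrays `17` and `18`. -/
def ptr (I : Inst) (σ : State) (a j s : ℕ) : ℕ := σ.arr a (j * I.M + s)

/-- The pointers for step `i` are correct. -/
def PtrOK (I : Inst) (σ : State) (i : ℕ) : Prop :=
  ∀ s < I.M, I.tab (i + 1) (I.par (I.ord i)) s ≠ 0 →
    ptr I σ 17 (I.ord i) s < I.M ∧ ptr I σ 18 (I.ord i) s < I.M ∧
      I.tab (i + 1) (I.par (I.ord i)) s =
        I.cand (I.tab i) (I.ord i) (I.par (I.ord i)) s (ptr I σ 17 (I.ord i) s)
          (ptr I σ 18 (I.ord i) s)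

theorem mergeP_runs {I : Inst} (h : I.Good) {σ : State} (hR : Ready I σ) {i : ℕ}
    (hi : σ.reg 28 = i) (hiN : i < I.N)
    (hT : ∀ q ≤ I.N, ∀ s < I.M, σ.arr 15 (q * I.M + s) = I.tab i q s) :
    Runs mergeP σ (mergeTime I.K I.M) (fun σ' =>
      (∀ q ≤ I.N, ∀ s < I.M, σ'.arr 15 (q * I.M + s) = I.tab (i + 1) q s) ∧ PtrOK I σ' i ∧
      ∀ j, j ≠ I.ord i → ∀ s < I.M, ptr I σ' 17 j s = ptr I σ 17 j s ∧
        ptr I σ' 18 j s = ptr I σ 18 j s) := by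
  obtain ⟨j, hj⟩ : ∃ j, j = I.ord i := ⟨_, rfl⟩
  obtain ⟨p, hp⟩ : ∃ p, p = I.par j := ⟨_, rfl⟩
  have hjN : j < I.N := hj ▸ h.ord_lt i hiN
  have hpN : p ≤ I.N := hp ▸ h.par_le j hjN
  have htab : ∀ s, I.tab (i + 1) p s = (Finset.range I.M).sup fun a =>
      (Finset.range I.M).sup fun b => I.cand (I.tab i) j p s a b := by
    intro s; rw [hp, hj]; exact I.tab_par i s
  refine (Runs.flat (Q := fun σ' => σ'.reg 11 = j ∧ σ'.reg 12 = p) (by rfl) le_rfl ?_).seq ?_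
  · simp [mergeHead, Prog.den, hi, hR.ord i hiN, ← hj, hR.par j hjN, ← hp]
  rintro σ₀ hA₀ ⟨hj0, hp0⟩
  have hR0 := hR.agree hA₀ (by rfl)
  have h15 : ∀ q ≤ I.N, ∀ s < I.M, σ₀.arr 15 (q * I.M + s) = I.tab i q s := by
    rw [hA₀.arr 15 (by rfl)]; exact hT
  refine Runs.seq (R := fun σ' => ∀ s < I.M, σ'.arr 16 (j * I.M + s) = I.tab (i + 1) p s ∧
      (I.tab (i + 1) p s ≠ 0 → ptr I σ' 17 j s < I.M ∧ ptr I σ' 18 j s < I.M ∧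
        I.tab (i + 1) p s = I.cand (I.tab i) j p s (ptr I σ' 17 j s) (ptr I σ' 18 j s)) ∧
      ∀ j', j' ≠ j → ptr I σ' 17 j' s = ptr I σ₀ 17 j' s ∧ ptr I σ' 18 j' s = ptr I σ₀ 18 j' s)
    ((Runs.for (m := 0) (k := I.M) (T := stateTime I.K I.M) (fun k σ' =>
      (∀ s < k, σ'.arr 16 (j * I.M + s) = I.tab (i + 1) p s ∧
      (I.tab (i + 1) p s ≠ 0 → ptr I σ' 17 j s < I.M ∧ ptr I σ' 18 j s < I.M ∧
        I.tab (i + 1) p s = I.cand (I.tab i) j p s (ptr I σ' 17 j s) (ptr I σ' 18 j s))) ∧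
      ∀ s < I.M, ∀ j', j' ≠ j →
        ptr I σ' 17 j' s = ptr I σ₀ 17 j' s ∧ ptr I σ' 18 j' s = ptr I σ₀ 18 j' s)
      (by rfl) rfl (Nat.zero_le _) ⟨by simp, fun s _ j' _ => ⟨rfl, rfl⟩⟩ ?_ ?_).mono le_rfl
      fun _ _ h' s hs => ⟨(h'.1 s hs).1, (h'.1 s hs).2, h'.2 s hs⟩) ?_
  · intro σ' i hA _
    exact (hR0.agree hA (by rfl)).M
  · rintro q σ₁ _ hqM hA₁ hq ⟨hB, hB'⟩
    refine (stateP_runs h (hR0.agree hA₁ (by rfl)) ((hA₁.reg 11 (by rfl)).trans hj0) hjN.le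
      ((hA₁.reg 12 (by rfl)).trans hp0) hpN hq hqM (T := I.tab i)
      (by rw [hA₁.arr 15 (by rfl)]; exact h15)).mono le_rfl ?_
    rintro σ₂ - ⟨v, x, y, hv, hxy, h16, h17, h18⟩
    rw [← htab] at hv
    subst hv
    have hne : ∀ j' s, s < I.M → (j' ≠ j ∨ s ≠ q) → j' * I.M + s ≠ j * I.M + q := by
      intro j' s hs hor he
      obtain ⟨e1, e2⟩ := addr_inj hs hqM he
      tauto
    refine ⟨fun s hs => ?_, fun s hs j' hj' => ?_⟩
    · rcases (Nat.lt_succ_iff.1 hs).lt_or_eq with hs' | rfl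
      · have hn := hne j s (by omega) (Or.inr (by omega))
        have := hB s hs'
        simpa [ptr, h16, h17, h18, Function.update_of_ne hn] using this
      · simpa [ptr, h16, h17, h18] using hxy
    · have hn := hne j' s hs (Or.inl hj')
      have := hB' s hs j' hj'
      simpa [ptr, h17, h18, Function.update_of_ne hn] using this
  intro σ₁ hA₁ hB
  have hR1 := hR0.agree hA₁ (by rfl)
  have hj1 := (hA₁.reg 11 (by rfl)).trans hj0
  have hp1 := (hA₁.reg 12 (by rfl)).trans hp0
  refine (Runs.for (m := 0) (k := I.M) (T := copyP.size) (fun k σ' =>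
      (∀ s < k, σ'.arr 15 (p * I.M + s) = I.tab (i + 1) p s) ∧
      ∀ q, q ≠ p → ∀ s < I.M, σ'.arr 15 (q * I.M + s) = σ₁.arr 15 (q * I.M + s))
      (by rfl) rfl (Nat.zero_le _) ⟨by simp, fun s _ _ _ => rfl⟩ ?_ ?_).mono le_rfl ?_
  · intro σ' i hA _
    exact (hR1.agree hA (by rfl)).M
  · rintro s σ₂ _ hsM hA₂ hs ⟨hC, hC'⟩
    have hR2 := hR1.agree hA₂ (by rfl)
    have hj2 := (hA₂.reg 11 (by rfl)).trans hj1
    have hp2 := (hA₂.reg 12 (by rfl)).trans hp1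
    have hmj := hR2.mulM j (by omega)
    have hmp := hR2.mulM p (by omega)
    have h16 : σ₂.arr 16 = σ₁.arr 16 := hA₂.arr 16 (by rfl)
    refine Runs.flat (by rfl) le_rfl ?_
    have e15 : ((copyP.den σ₂).setReg 15 (s + 1)).arr 15 =
        Function.update (σ₂.arr 15) (p * I.M + s) (I.tab (i + 1) p s) := by
      simp [copyP, Prog.den, hj2, hp2, hs, hmj, hmp, h16, (hB s hsM).1]
    rw [e15]
    refine ⟨fun s' hs' => ?_, fun q hq s' hs' => ?_⟩
    · rcases (Nat.lt_succ_iff.1 hs').lt_or_eq with hs'' | rfl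
      · rw [Function.update_of_ne (by omega)]
        exact hC s' hs''
      · rw [Function.update_self]
    · rw [Function.update_of_ne fun he => hq (addr_inj hs' hsM he).1]
      exact hC' q hq s' hs'
  · rintro σ₂ hA₂ ⟨hC, hC'⟩
    have e17 : σ₂.arr 17 = σ₁.arr 17 := hA₂.arr 17 (by rfl)
    have e18 : σ₂.arr 18 = σ₁.arr 18 := hA₂.arr 18 (by rfl)
    have f17 : σ₀.arr 17 = σ.arr 17 := hA₀.arr 17 (by rfl)
    have f18 : σ₀.arr 18 = σ.arr 18 := hA₀.arr 18 (by rfl)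
    refine ⟨fun q hq s hs => ?_, ?_, fun j' hj' s hs => ?_⟩
    · by_cases hqp : q = p
      · rw [hqp]; exact hC s hs
      · rw [hC' q hqp s hs, hA₁.arr 15 (by rfl), h15 q hq s hs, I.tab_of_ne]
        rwa [← hj, ← hp]
    · intro s hs
      have := (hB s hs).2.1
      simp only [ptr, ← hj, ← hp, e17, e18] at this ⊢
      exact this
    · have := (hB s hs).2.2 j' (by rwa [hj])
      simp only [ptr, e17, e18, f17, f18] at this ⊢
      exact this

/-- Time of the main loop. -/
def dpTime (N K M : ℕ) : ℕ := (N + 1) * (mergeTime K M + 12)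

theorem dpP_runs {I : Inst} (h : I.Good) {σ : State} (hR : Ready I σ)
    (hT : ∀ q ≤ I.N, ∀ s < I.M, σ.arr 15 (q * I.M + s) = I.tab 0 q s) :
    Runs dpP σ (dpTime I.N I.K I.M) (fun σ' => I.IsPointer (ptr I σ' 17) (ptr I σ' 18)) := by
  refine (Runs.for (m := 0) (k := I.N) (T := mergeTime I.K I.M) (fun i σ' =>
      (∀ q ≤ I.N, ∀ s < I.M, σ'.arr 15 (q * I.M + s) = I.tab i q s) ∧ ∀ i' < i, PtrOK I σ' i')
      (by rfl) rfl (Nat.zero_le _) ⟨by simpa using hT, by simp⟩ ?_ ?_).mono le_rfl ?_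
  · intro σ' i hA _
    exact (hR.agree hA (by rfl)).N
  · rintro i σ₁ _ hiN hA₁ hi ⟨hB, hB'⟩
    refine (mergeP_runs h (hR.agree hA₁ (by rfl)) hi hiN hB).mono le_rfl ?_
    rintro σ₂ - ⟨h1, h2, h3⟩
    refine ⟨by simpa using h1, fun i' hi' => ?_⟩
    rcases (Nat.lt_succ_iff.1 hi').lt_or_eq with hlt | rfl
    · have hne : I.ord i' ≠ I.ord i := fun he => by
        have := congrArg I.idx he
        rw [h.idx_ord i' (by omega), h.idx_ord i hiN] at this
        omega
      intro s hs hs0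
      have := hB' i' hlt s hs hs0
      have e := h3 _ hne s hs
      rw [← e.1, ← e.2] at this
      exact this
    · exact h2
  · rintro σ' - ⟨-, hP⟩
    exact ⟨fun i hi s hs h0 => ⟨(hP i hi s hs h0).1, (hP i hi s hs h0).2.1⟩,
      fun i hi s hs h0 => (hP i hi s hs h0).2.2⟩

/-! ### Traceback and output -/

/-- Undoes one merge: the states of the node and of its parent before the merge are read off from
the state of the parent after it. -/
def traceBody : Prog :=
  .assign 11 (.get 14 (.reg 2 - .lit 1 - .reg 28)) ;; .assign 12 (.get 13 (.reg 11)) ;;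
  .assign 24 (.get 19 (.reg 12)) ;;
  .store 19 (.reg 12) (.get 17 (.get 11 (.reg 11) + .reg 24)) ;;
  .store 19 (.reg 11) (.get 18 (.get 11 (.reg 11) + .reg 24))

/-- Follows the pointers, top-down; array `19` holds the states. -/
def traceP : Prog := .for 28 (.lit 0) (.reg 2) traceBody

/-- Writes whether the vertex at the position in register `16` has round `0`. -/
def outBody : Prog :=
  .assign 17 (.get 6 (.reg 16)) ;; .assign 13 (.get 19 (.reg 11)) ;;
  .store 7 (.reg 17) (labE (.lit 0) (.reg 11) (.reg 13) (.reg 17)).not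

/-- Writes the characteristic function of the solution. -/
def outP : Prog := .for 11 (.lit 0) (.reg 2) (.for 16 (bagLo 11) (bagHi 11) outBody)

theorem traceP_runs {I : Inst} (h : I.Good) {σ : State} (hR : Ready I σ)
    (h19 : σ.arr 19 = fun _ => 0) :
    Runs traceP σ ((I.N + 1) * (traceBody.size + 12))
      (fun σ' => σ'.arr 19 = I.back (ptr I σ 17) (ptr I σ 18) I.N) := by
  refine (Runs.for (m := 0) (k := I.N) (T := traceBody.size) (fun i σ' =>
      σ'.arr 19 = I.back (ptr I σ 17) (ptr I σ 18) i)
      (by rfl) rfl (Nat.zero_le _) (by simpa [Inst.back] using h19) ?_ ?_).mono le_rfl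
      fun _ _ h' => h'
  · intro σ' i hA _
    exact (hR.agree hA (by rfl)).N
  · intro k σ₁ _ hk hA hk' hB
    have hR1 := hR.agree hA (by rfl)
    have hjN := h.ord_lt (I.N - 1 - k) (by omega)
    have hpN := h.par_le _ hjN
    refine Runs.flat (by rfl) le_rfl ?_
    have hm := hR1.mulM (I.ord (I.N - 1 - k)) (by omega)
    have h17 : σ₁.arr 17 = σ.arr 17 := hA.arr 17 (by rfl)
    have h18 : σ₁.arr 18 = σ.arr 18 := hA.arr 18 (by rfl)
    simp [traceBody, Prog.den, hk', hR1.N, hR1.ord (I.N - 1 - k) (by omega), hR1.par _ hjN, hm,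
      hB, h17, h18, Inst.back, ptr]

theorem outP_runs {I : Inst} (h : I.Good) {σ : State} (hR : Ready I σ) {t : ℕ → ℕ}
    (h19 : ∀ q < I.N, σ.arr 19 q < I.M)
    (ht : ∀ q < I.N, ∀ u ∈ I.X q, I.lab 0 q (σ.arr 19 q) u = t u) :
    Runs outP σ ((I.N + 1) * ((I.K + 1) *
        (outBody.size + ((bagLo 11).cost + (bagHi 11).cost + 10)) + 12))
      (fun σ' => ∀ q < I.N, ∀ u ∈ I.X q, σ'.arr 7 u = if t u = 0 then 1 else 0) := by
  refine (Runs.for (m := 0) (k := I.N) (T := (I.K + 1) *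
      (outBody.size + ((bagLo 11).cost + (bagHi 11).cost + 10))) (fun i σ' =>
      ∀ q < i, ∀ u ∈ I.X q, σ'.arr 7 u = if t u = 0 then 1 else 0)
      (by rfl) rfl (Nat.zero_le _) (by simp) ?_ ?_).mono le_rfl fun _ _ h' => h'
  · intro σ' i hA _
    exact (hR.agree hA (by rfl)).N
  · intro j σ₁ _ hjN hA hj hB
    have hR1 := hR.agree hA (by rfl)
    have hoff := h.off_sub j hjN.le
    refine (Runs.for (m := I.off j) (k := I.off (j + 1)) (T := outBody.size) (fun i σ' =>
      (∀ q < j, ∀ u ∈ I.X q, σ'.arr 7 u = if t u = 0 then 1 else 0) ∧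
      ∀ x, I.off j ≤ x → x < i → σ'.arr 7 (I.bag x) = if t (I.bag x) = 0 then 1 else 0)
      (by rfl) ?_ (h.off_le j hjN.le) ⟨by simpa using hB, fun x h1 h2 => by omega⟩ ?_ ?_).mono
      (Nat.mul_le_mul_right _ (by omega)) ?_
    · simp [bagLo, hj, hR1.off j (by omega)]
    · intro σ' i hA' _
      simp [bagHi, (hA'.reg 11 (by rfl)).trans hj, (hR1.agree hA' (by rfl)).off (j + 1) (by omega)]
    · rintro x σ₂ hx1 hx2 hA₂ hx ⟨hC, hC'⟩
      have hR2 := hR1.agree hA₂ (by rfl)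
      have hj2 : σ₂.reg 11 = j := (hA₂.reg 11 (by rfl)).trans hj
      have e19 : σ₂.arr 19 = σ.arr 19 := (hA₂.arr 19 (by rfl)).trans (hA.arr 19 (by rfl))
      obtain ⟨hmem, hlt⟩ := lt_of_mem_bag h hjN.le hx1 hx2
      refine Runs.flat (by rfl) le_rfl ?_
      have hR3 : Ready I ((σ₂.setReg 17 (I.bag x)).setReg 13 (σ.arr 19 j)) :=
        (hR2.setReg (by omega) _).setReg (by omega) _
      have hlab : (labE (.lit 0) (.reg 11) (.reg 13) (.reg 17)).eval
          ((σ₂.setReg 17 (I.bag x)).setReg 13 (σ.arr 19 j)) = t (I.bag x) := by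
        rw [eval_labE h hR3 (y := 0) (by omega) (by simp) (by simpa [hj2] using hjN.le)
          (by simpa using h19 j hjN) (by simpa using hlt)]
        simpa [hj2] using ht j hjN _ hmem
      have e7 : ((outBody.den σ₂).setReg 16 (x + 1)).arr 7 =
          Function.update (σ₂.arr 7) (I.bag x) (if t (I.bag x) = 0 then 1 else 0) := by
        simp only [outBody, Prog.den, Expr.eval_get, Expr.eval_reg, hx, hR2.bag]
        simp [hj2, e19, hlab]
      rw [e7]
      -- a vertex that is written again gets the same value
      have hupd : ∀ u, σ₂.arr 7 u = (if t u = 0 then 1 else 0) →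
          Function.update (σ₂.arr 7) (I.bag x) (if t (I.bag x) = 0 then 1 else 0) u =
            if t u = 0 then 1 else 0 := by
        intro u hu
        by_cases hux : u = I.bag x
        · subst hux; rw [Function.update_self]
        · rw [Function.update_of_ne hux, hu]
      refine ⟨fun q hq u hu => hupd u (hC q hq u hu), fun x' h1 h2 => ?_⟩
      rcases (Nat.lt_succ_iff.1 h2).lt_or_eq with h3 | rfl
      · exact hupd _ (hC' x' h1 h3)
      · rw [Function.update_self]
    · rintro σ₂ - ⟨hC, hC'⟩ q hq u hu
      rcases (Nat.lt_succ_iff.1 hq).lt_or_eq with hq' | rfl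
      · exact hC q hq' u hu
      · obtain ⟨x, hx, rfl⟩ := Finset.mem_image.1 hu
        rw [Finset.mem_coe.symm, Finset.coe_Ico, Set.mem_Ico] at hx
        exact hC' x hx.1 hx.2

end RAM

namespace RAM

/-! ### Preparing the memory -/

theorem update_add (f : ℕ → ℕ) (a v : ℕ) :
    Function.update f a (f a + v) = fun z => f z + if a = z then v else 0 := by
  funext z
  by_cases h : z = a
  · subst h; simp
  · rw [Function.update_of_ne h, if_neg (Ne.symm h), add_zero]

/-- Takes the size of one bag into account. -/
def widthBody : Prog :=
  .assign 11 (.get 5 (.reg 10 + .lit 1) - .get 5 (.reg 10)) ;;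
  .ite (.lt (.reg 5) (.reg 11)) (.assign 5 (.reg 11)) .skip

/-- Computes the maximum size of a bag in register `5`. -/
def widthP : Prog := .for 10 (.lit 0) (.reg 2) widthBody

theorem widthP_runs {σ : State} (h5 : σ.reg 5 = 0) :
    Runs widthP σ ((σ.reg 2 + 1) * (widthBody.size + 12)) (fun σ' =>
      σ'.reg 5 = (Finset.range (σ.reg 2)).sup fun j => σ.arr 5 (j + 1) - σ.arr 5 j) := by
  refine (Runs.for (m := 0) (k := σ.reg 2) (T := widthBody.size) (fun i σ' =>
      σ'.reg 5 = (Finset.range i).sup fun j => σ.arr 5 (j + 1) - σ.arr 5 j)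
      (by rfl) rfl (Nat.zero_le _) (by simpa using h5) ?_ ?_).mono le_rfl fun _ _ h' => h'
  · intro σ' i hA _
    exact hA.reg 2 (by rfl)
  · intro i σ' _ _ hA hx h
    refine Runs.flat (by rfl) le_rfl ?_
    have h5 : σ'.arr 5 = σ.arr 5 := hA.arr 5 (by rfl)
    rw [Finset.range_add_one, Finset.sup_insert]
    generalize ((Finset.range i).sup fun j => σ.arr 5 (j + 1) - σ.arr 5 j) = W at h ⊢
    by_cases hlt : σ'.reg 5 < σ.arr 5 (i + 1) - σ.arr 5 i
    · simp [widthBody, Prog.den, hx, h5, hlt]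
      omega
    · simp [widthBody, Prog.den, hx, h5, hlt]
      omega

/-- The remaining parameters. If no bag has two elements, then the graph has no edges and one round
does the same as many; this keeps the number of states bounded in that case. Repeating the last
entry of array `5` provides the additional root `N` with an empty bag. -/
def paramP : Prog :=
  .ite (.lt (.reg 5) (.lit 2)) (.assign 4 (.lit 1)) .skip ;;
  .assign 6 (.reg 4 + .lit 3) ;; .assign 8 (.reg 5 + .reg 5) ;; .assign 9 (.reg 8 + .reg 5) ;;
  .store 5 (.reg 2 + .lit 1) (.get 5 (.reg 2))

/-- Computes one more multiple. -/
def mulBody (a : ℕ) (e : Expr) : Prog := .store a (.reg 10 + .lit 1) (.get a (.reg 10) + e)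

/-- Fills array `a` with the multiples of the value of `e`, up to the bound `b`. -/
def mulP (a : ℕ) (b e : Expr) : Prog := .for 10 (.lit 0) b (mulBody a e)

theorem mulP_runs {σ : State} {a m v : ℕ} {b e : Expr} (ha : σ.arr a = fun _ => 0)
    (hb : ∀ σ', Agree (mulP a b e) σ σ' → b.eval σ' = m)
    (he : ∀ σ', Agree (mulP a b e) σ σ' → e.eval σ' = v) :
    Runs (mulP a b e) σ ((m + 1) * ((mulBody a e).size + (b.cost + 11)))
      (fun σ' => ∀ z ≤ m, σ'.arr a z = z * v) := by
  refine (Runs.for (m := 0) (k := m) (T := (mulBody a e).size) (fun i σ' =>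
      ∀ z ≤ i, σ'.arr a z = z * v)
      (by rfl) rfl (Nat.zero_le _) ?_ (fun σ' i hA _ => hb σ' hA) ?_).mono ?_ fun _ _ h' => h'
  · intro z hz
    obtain rfl : z = 0 := by omega
    simp [ha]
  · intro i σ' _ _ hA hx h
    refine Runs.flat (by rfl) le_rfl fun z hz => ?_
    have hi := h i le_rfl
    rcases hz.lt_or_eq with hz | rfl
    · simp only [mulBody, Prog.den, State.setReg_arr, State.setArr_arr, if_true, Expr.eval_add,
        Expr.eval_reg, Expr.eval_lit, hx]
      rw [Function.update_of_ne (by omega)]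
      exact h z (by omega)
    · simp [mulBody, Prog.den, hx, hi, he σ' hA, Nat.succ_mul]
  · refine Nat.mul_le_mul_left _ (Nat.add_le_add_left ?_ _)
    simp only [Expr.cost]; omega

/-- Enters one edge into the adjacency matrix, in both directions. -/
def adjBody : Prog :=
  .assign 11 (.get 0 (.reg 10)) ;; .assign 12 (.get 1 (.reg 10)) ;;
  .store 9 (.get 8 (.reg 11) + .reg 12) (.get 9 (.get 8 (.reg 11) + .reg 12) + .lit 1) ;;
  .store 9 (.get 8 (.reg 12) + .reg 11) (.get 9 (.get 8 (.reg 12) + .reg 11) + .lit 1)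

/-- Computes the adjacency matrix. -/
def adjP : Prog := .for 10 (.lit 0) (.reg 1) adjBody

theorem adjP_runs {σ : State} (h9 : σ.arr 9 = fun _ => 0) :
    Runs adjP σ ((σ.reg 1 + 1) * (adjBody.size + 12)) (fun σ' =>
      σ'.arr 9 = fun z => ∑ e ∈ Finset.range (σ.reg 1),
        ((if σ.arr 8 (σ.arr 0 e) + σ.arr 1 e = z then 1 else 0) +
          if σ.arr 8 (σ.arr 1 e) + σ.arr 0 e = z then 1 else 0)) := by
  refine (Runs.for (m := 0) (k := σ.reg 1) (T := adjBody.size) (fun i σ' =>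
      σ'.arr 9 = fun z => ∑ e ∈ Finset.range i,
        ((if σ.arr 8 (σ.arr 0 e) + σ.arr 1 e = z then 1 else 0) +
          if σ.arr 8 (σ.arr 1 e) + σ.arr 0 e = z then 1 else 0))
      (by rfl) rfl (Nat.zero_le _) (by simpa using h9) ?_ ?_).mono le_rfl fun _ _ h' => h'
  · intro σ' i hA _
    exact hA.reg 1 (by rfl)
  · intro i σ' _ _ hA hx h
    refine Runs.flat (by rfl) le_rfl ?_
    have h0 : σ'.arr 0 = σ.arr 0 := hA.arr 0 (by rfl)
    have h1 : σ'.arr 1 = σ.arr 1 := hA.arr 1 (by rfl)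
    have h8 : σ'.arr 8 = σ.arr 8 := hA.arr 8 (by rfl)
    simp only [Finset.sum_range_succ, ← add_assoc]
    simp [adjBody, Prog.den, hx, h0, h1, h8, h, update_add]

/-- Stores the rank of one vertex of one bag. The entry is zero before, so that adding does the same
as overwriting. -/
def posBody : Prog :=
  .store 10 (.get 8 (.reg 10) + .get 6 (.reg 11))
    (.get 10 (.get 8 (.reg 10) + .get 6 (.reg 11)) + (.reg 11 + .lit 1 - .get 5 (.reg 10)))

/-- Computes the ranks of the vertices in the bags. -/
def posP : Prog := .for 10 (.lit 0) (.reg 2) (.for 11 (bagLo 10) (bagHi 10) posBody)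

theorem posP_runs {σ : State} (h10 : σ.arr 10 = fun _ => 0) {K : ℕ}
    (hle : ∀ j < σ.reg 2, σ.arr 5 j ≤ σ.arr 5 (j + 1))
    (hK : ∀ j < σ.reg 2, σ.arr 5 (j + 1) ≤ σ.arr 5 j + K) :
    Runs posP σ ((σ.reg 2 + 1) * ((K + 1) *
        (posBody.size + ((bagLo 10).cost + (bagHi 10).cost + 10)) + 12)) (fun σ' =>
      σ'.arr 10 = fun z => ∑ j ∈ Finset.range (σ.reg 2),
        ∑ x ∈ Finset.Ico (σ.arr 5 j) (σ.arr 5 (j + 1)),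
          if σ.arr 8 j + σ.arr 6 x = z then x + 1 - σ.arr 5 j else 0) := by
  refine (Runs.for (m := 0) (k := σ.reg 2) (T := (K + 1) *
      (posBody.size + ((bagLo 10).cost + (bagHi 10).cost + 10))) (fun i σ' =>
      σ'.arr 10 = fun z => ∑ j ∈ Finset.range i,
        ∑ x ∈ Finset.Ico (σ.arr 5 j) (σ.arr 5 (j + 1)),
          if σ.arr 8 j + σ.arr 6 x = z then x + 1 - σ.arr 5 j else 0)
      (by rfl) rfl (Nat.zero_le _) (by simpa using h10) ?_ ?_).mono le_rfl fun _ _ h' => h'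
  · intro σ' i hA _
    exact hA.reg 2 (by rfl)
  · intro j σ₁ _ hj hA hx h
    have h5 : σ₁.arr 5 = σ.arr 5 := hA.arr 5 (by rfl)
    have h6 : σ₁.arr 6 = σ.arr 6 := hA.arr 6 (by rfl)
    have h8 : σ₁.arr 8 = σ.arr 8 := hA.arr 8 (by rfl)
    have := hK j hj
    refine (Runs.for (m := σ.arr 5 j) (k := σ.arr 5 (j + 1)) (T := posBody.size) (fun i σ' =>
      σ'.arr 10 = fun z => (∑ j ∈ Finset.range j,
        ∑ x ∈ Finset.Ico (σ.arr 5 j) (σ.arr 5 (j + 1)),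
          if σ.arr 8 j + σ.arr 6 x = z then x + 1 - σ.arr 5 j else 0) +
        ∑ x ∈ Finset.Ico (σ.arr 5 j) i,
          if σ.arr 8 j + σ.arr 6 x = z then x + 1 - σ.arr 5 j else 0)
      (by rfl) (by simp [bagLo, hx, h5]) (hle j hj) (by simpa using h) ?_ ?_).mono
      (Nat.mul_le_mul_right _ (by omega)) ?_
    · intro σ' i hA' _
      simp [bagHi, (hA'.reg 10 (by rfl)).trans hx, (hA'.arr 5 (by rfl)).trans h5]
    · intro x σ₂ hx1 _ hA₂ hx2 h2
      refine Runs.flat (by rfl) le_rfl ?_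
      have g5 : σ₂.arr 5 = σ.arr 5 := (hA₂.arr 5 (by rfl)).trans h5
      have g6 : σ₂.arr 6 = σ.arr 6 := (hA₂.arr 6 (by rfl)).trans h6
      have g8 : σ₂.arr 8 = σ.arr 8 := (hA₂.arr 8 (by rfl)).trans h8
      have g10 : σ₂.reg 10 = j := (hA₂.reg 10 (by rfl)).trans hx
      simp only [Finset.sum_Ico_succ_top hx1, ← add_assoc]
      simp only [posBody, Prog.den, State.setReg_arr, State.setArr_arr, if_true, Expr.eval_add,
        Expr.eval_sub, Expr.eval_get, Expr.eval_reg, Expr.eval_lit, hx2, g5, g6, g8, g10,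
        update_add, h2]
    · intro σ₂ _ h2
      simp only [Finset.sum_range_succ]
      simpa using h2

/-- One addition of the repeated addition that multiplies by the base. -/
def powInner : Prog := .assign 11 (.reg 11 + .get 23 (.reg 10))

/-- Stores the new power. -/
def powTail : Prog := .store 23 (.reg 10 + .lit 1) (.reg 11)

/-- Fills array `23` with the powers of the base in register `6`. -/
def powLoop : Prog := .for 10 (.lit 0) (.reg 9 + .reg 5 + .lit 1)
  (.assign 11 (.lit 0) ;; .for 12 (.lit 0) (.reg 6) powInner ;; powTail)

/-- Computes the number of states and the number of initial states. -/
def powP : Prog := .store 23 (.lit 0) (.lit 1) ;; powLoop ;;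
  (.assign 7 (.get 23 (.reg 9 + .reg 5 + .lit 1)) ;; .assign 29 (.get 23 (.reg 8 + .lit 1)))

theorem powP_runs {σ : State} {K B : ℕ} (h5 : σ.reg 5 = K) (h6 : σ.reg 6 = B)
    (h8 : σ.reg 8 = 2 * K) (h9 : σ.reg 9 = 3 * K) :
    Runs powP σ (3 + ((4 * K + 2) * ((2 + ((B + 1) * (powInner.size + 12) + powTail.size)) + 16) +
        14)) (fun σ' => σ'.reg 7 = B ^ (4 * K + 1) ∧ σ'.reg 29 = B ^ (2 * K + 1)) := by
  refine (Runs.flat (Q := fun σ' => σ' = σ.setArr 23 0 1) (by rfl) le_rfl rfl).seq ?_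
  rintro σ₀ hA₀ hσ₀
  have h5 := (hA₀.reg 5 (by rfl)).trans h5
  have h6 := (hA₀.reg 6 (by rfl)).trans h6
  have h8 := (hA₀.reg 8 (by rfl)).trans h8
  have h9 := (hA₀.reg 9 (by rfl)).trans h9
  refine Runs.seq (R := fun σ' => ∀ z ≤ 4 * K + 1, σ'.arr 23 z = B ^ z)
    ((Runs.for (m := 0) (k := 4 * K + 1)
      (T := 2 + ((B + 1) * (powInner.size + 12) + powTail.size)) (fun i σ' =>
      ∀ z ≤ i, σ'.arr 23 z = B ^ z) (by rfl) rfl (Nat.zero_le _) ?_ ?_ ?_).mono le_rfl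
      fun _ _ h => h) ?_
  · intro z hz
    obtain rfl : z = 0 := by omega
    simp [hσ₀]
  · intro σ' i hA _
    simp [hA.reg 9 (by rfl), hA.reg 5 (by rfl), h9, h5]
    omega
  · intro z σ₁ _ hz hA hx h
    refine (Runs.flat (Q := fun σ' => σ' = σ₁.setReg 11 0) (by rfl) le_rfl rfl).seq ?_
    rintro σ₂ hA₂ hσ₂
    have g10 : σ₂.reg 10 = z := (hA₂.reg 10 (by rfl)).trans hx
    have g6 : σ₂.reg 6 = B := ((hA₂.reg 6 (by rfl)).trans (hA.reg 6 (by rfl))).trans h6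
    have g23 : σ₂.arr 23 = σ₁.arr 23 := hA₂.arr 23 (by rfl)
    refine Runs.seq (R := fun σ' => σ'.reg 11 = B * B ^ z)
      ((Runs.for (m := 0) (k := B) (T := powInner.size) (fun i σ' => σ'.reg 11 = i * B ^ z)
        (by rfl) rfl (Nat.zero_le _) (by simp [hσ₂]) ?_ ?_).mono le_rfl fun _ _ h => h) ?_
    · intro σ' i hA' _
      exact (hA'.reg 6 (by rfl)).trans g6
    · intro y σ₃ _ _ hA₃ _ h3
      refine Runs.flat (by rfl) le_rfl ?_
      simp [powInner, Prog.den, (hA₃.reg 10 (by rfl)).trans g10, h3,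
        (hA₃.arr 23 (by rfl)).trans g23, h z le_rfl, Nat.succ_mul]
    · intro σ₃ hA₃ h3
      refine Runs.flat (by rfl) le_rfl fun z' hz' => ?_
      have g10 := (hA₃.reg 10 (by rfl)).trans g10
      have g23 := (hA₃.arr 23 (by rfl)).trans g23
      rcases hz'.lt_or_eq with hlt | rfl
      · simp only [powTail, Prog.den, State.setReg_arr, State.setArr_arr, if_true, Expr.eval_add,
          Expr.eval_reg, Expr.eval_lit, g10, g23]
        rw [Function.update_of_ne (by omega)]
        exact h z' (by omega)
      · simp [powTail, Prog.den, g10, h3, pow_succ']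
  · intro σ₁ hA h
    refine Runs.flat (by rfl) (by decide) ?_
    have e5 := (hA.reg 5 (by rfl)).trans h5
    have e8 := (hA.reg 8 (by rfl)).trans h8
    have e9 := (hA.reg 9 (by rfl)).trans h9
    have h1 := h (4 * K + 1) le_rfl
    have h2 := h (2 * K + 1) (by omega)
    simp [Prog.den, e5, e8, e9, h2, ← h1]
    congr 1
    omega

/-- Computes the quotient and the remainder of the successor of the number in register `10`. -/
def divBody : Prog :=
  .ite (.eq (.get 22 (.reg 10) + .lit 1) (.reg 6))
    (.store 21 (.reg 10 + .lit 1) (.get 21 (.reg 10) + .lit 1) ;;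
      .store 22 (.reg 10 + .lit 1) (.lit 0))
    (.store 21 (.reg 10 + .lit 1) (.get 21 (.reg 10)) ;;
      .store 22 (.reg 10 + .lit 1) (.get 22 (.reg 10) + .lit 1))

/-- Tabulates quotients and remainders modulo the base. -/
def divP : Prog := .for 10 (.lit 0) (.reg 7) divBody

theorem div_mod_succ {B s : ℕ} (hB : 0 < B) :
    (s % B + 1 = B → (s + 1) / B = s / B + 1 ∧ (s + 1) % B = 0) ∧
    (s % B + 1 ≠ B → (s + 1) / B = s / B ∧ (s + 1) % B = s % B + 1) := by
  have hlt := Nat.mod_lt s hB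
  have hds := Nat.div_add_mod s B
  constructor
  · intro h
    have : s + 1 = B * (s / B + 1) := by rw [Nat.mul_add]; omega
    rw [this]
    exact ⟨Nat.mul_div_cancel_left _ hB, Nat.mul_mod_right _ _⟩
  · intro h
    have e : s + 1 = (s % B + 1) + B * (s / B) := by omega
    constructor
    · rw [e, Nat.add_mul_div_left _ _ hB, Nat.div_eq_of_lt (by omega), zero_add]
    · rw [e, Nat.add_mul_mod_self_left, Nat.mod_eq_of_lt (by omega)]

theorem divP_runs {σ : State} {B : ℕ} (hB : 0 < B) (h6 : σ.reg 6 = B)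
    (h21 : σ.arr 21 = fun _ => 0) (h22 : σ.arr 22 = fun _ => 0) :
    Runs divP σ ((σ.reg 7 + 1) * (divBody.size + 12)) (fun σ' =>
      ∀ s ≤ σ.reg 7, σ'.arr 21 s = s / B ∧ σ'.arr 22 s = s % B) := by
  refine (Runs.for (m := 0) (k := σ.reg 7) (T := divBody.size) (fun i σ' =>
      ∀ s ≤ i, σ'.arr 21 s = s / B ∧ σ'.arr 22 s = s % B)
      (by rfl) rfl (Nat.zero_le _) ?_ ?_ ?_).mono le_rfl fun _ _ h' => h'
  · intro s hs
    obtain rfl : s = 0 := by omega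
    simp [h21, h22]
  · intro σ' i hA _
    exact hA.reg 7 (by rfl)
  · intro s σ' _ _ hA hx h
    have g6 := (hA.reg 6 (by rfl)).trans h6
    obtain ⟨hs1, hs2⟩ := h s le_rfl
    refine Runs.flat (by rfl) le_rfl fun s' hs' => ?_
    by_cases hc : s % B + 1 = B
    · obtain ⟨d1, d2⟩ := (div_mod_succ hB).1 hc
      rcases hs'.lt_or_eq with hlt | rfl
      · have hne : s' ≠ s + 1 := by omega
        simpa [divBody, Prog.den, hx, hs1, hs2, g6, hc, Function.update_of_ne hne] using
          h s' (by omega)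
      · simp [divBody, Prog.den, hx, hs1, hs2, g6, hc, d1, d2]
    · obtain ⟨d1, d2⟩ := (div_mod_succ hB).2 hc
      rcases hs'.lt_or_eq with hlt | rfl
      · have hne : s' ≠ s + 1 := by omega
        simpa [divBody, Prog.den, hx, hs1, hs2, g6, hc, Function.update_of_ne hne] using
          h s' (by omega)
      · simp [divBody, Prog.den, hx, hs1, hs2, g6, hc, d1, d2]

/-- Splits off one digit from the number in register `11`. -/
def digitBody : Prog :=
  .store 12 (.get 11 (.reg 12) + .reg 10) (.get 22 (.reg 11)) ;; .assign 11 (.get 21 (.reg 11))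

/-- Tabulates the digits of all states. -/
def digitP : Prog := .for 10 (.lit 0) (.reg 7)
  (.assign 11 (.reg 10) ;; .for 12 (.lit 0) (.reg 9 + .reg 5 + .lit 1) digitBody)

theorem digitP_runs {σ : State} {K B M : ℕ} (h5 : σ.reg 5 = K) (h9 : σ.reg 9 = 3 * K)
    (h7 : σ.reg 7 = M) (h11 : ∀ z < 4 * K + 1, σ.arr 11 z = z * M)
    (hd : ∀ s ≤ M, σ.arr 21 s = s / B ∧ σ.arr 22 s = s % B) :
    Runs digitP σ ((M + 1) * ((2 + (4 * K + 2) * (digitBody.size + 16)) + 12)) (fun σ' =>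
      ∀ z < 4 * K + 1, ∀ s < M, σ'.arr 12 (z * M + s) = s / B ^ z % B) := by
  refine (Runs.for (m := 0) (k := M) (T := 2 + (4 * K + 2) * (digitBody.size + 16)) (fun i σ' =>
      ∀ z < 4 * K + 1, ∀ s < i, σ'.arr 12 (z * M + s) = s / B ^ z % B)
      (by rfl) rfl (Nat.zero_le _) (by simp) ?_ ?_).mono le_rfl fun _ _ h' => h'
  · intro σ' i hA _
    exact (hA.reg 7 (by rfl)).trans h7
  · intro s σ₁ _ hs hA hx h
    refine (Runs.flat (Q := fun σ' => σ' = σ₁.setReg 11 s) (by rfl) le_rfl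
      (by simp [Prog.den, hx])).seq ?_
    rintro σ₂ hA₂ hσ₂
    have g10 : σ₂.reg 10 = s := (hA₂.reg 10 (by rfl)).trans hx
    have g5 := ((hA₂.reg 5 (by rfl)).trans (hA.reg 5 (by rfl))).trans h5
    have g9 := ((hA₂.reg 9 (by rfl)).trans (hA.reg 9 (by rfl))).trans h9
    have g11 : σ₂.arr 11 = σ.arr 11 := (hA₂.arr 11 (by rfl)).trans (hA.arr 11 (by rfl))
    have g21 : σ₂.arr 21 = σ.arr 21 := (hA₂.arr 21 (by rfl)).trans (hA.arr 21 (by rfl))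
    have g22 : σ₂.arr 22 = σ.arr 22 := (hA₂.arr 22 (by rfl)).trans (hA.arr 22 (by rfl))
    have g12 : σ₂.arr 12 = σ₁.arr 12 := by rw [hσ₂]; rfl
    refine (Runs.for (m := 0) (k := 4 * K + 1) (T := digitBody.size) (fun i σ' =>
      σ'.reg 11 = s / B ^ i ∧ (∀ z < i, σ'.arr 12 (z * M + s) = s / B ^ z % B) ∧
      ∀ z < 4 * K + 1, ∀ s' < s, σ'.arr 12 (z * M + s') = s' / B ^ z % B)
      (by rfl) rfl (Nat.zero_le _) ⟨by simp [hσ₂], by simp, by simpa [g12] using h⟩ ?_ ?_).mono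
      le_rfl ?_
    · intro σ' i hA' _
      simp [hA'.reg 9 (by rfl), hA'.reg 5 (by rfl), g9, g5]
      omega
    · rintro z σ₃ _ hz hA₃ hz' ⟨h1, h2, h3⟩
      refine Runs.flat (by rfl) le_rfl ?_
      have f10 := (hA₃.reg 10 (by rfl)).trans g10
      have f11 := (hA₃.arr 11 (by rfl)).trans g11
      have f21 := (hA₃.arr 21 (by rfl)).trans g21
      have f22 := (hA₃.arr 22 (by rfl)).trans g22
      obtain ⟨d1, d2⟩ := hd (s / B ^ z) ((Nat.div_le_self _ _).trans hs.le)
      have e12 : ((digitBody.den σ₃).setReg 12 (z + 1)).arr 12 =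
          Function.update (σ₃.arr 12) (z * M + s) (s / B ^ z % B) := by
        simp [digitBody, Prog.den, f10, f11, f22, hz', h1, d2, h11 z hz]
      rw [e12]
      refine ⟨?_, fun z' hz'' => ?_, fun z' hz'' s' hs' => ?_⟩
      · simp [digitBody, Prog.den, f21, h1, d1, Nat.div_div_eq_div_mul, pow_succ]
      · rcases (Nat.lt_succ_iff.1 hz'').lt_or_eq with hlt | rfl
        · rw [Function.update_of_ne fun he => (by
            have := (addr_inj hs hs he).1; omega)]
          exact h2 z' hlt
        · rw [Function.update_self]
      · rw [Function.update_of_ne fun he => (by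
            have := (addr_inj (hs'.trans hs) hs he).2; omega)]
        exact h3 z' hz'' s' hs'
    · rintro σ₃ - ⟨-, h2, h3⟩ z hz s' hs'
      rcases (Nat.lt_succ_iff.1 hs').lt_or_eq with hlt | rfl
      · exact h3 z hz s' hlt
      · exact h2 z hz

/-- Gives the full profit `n + 1` to one initial state of one node. -/
def initBody : Prog := .store 15 (.get 11 (.reg 10) + .reg 11) (.reg 0 + .lit 1)

/-- Fills the tables with their initial values. -/
def initP : Prog := .for 10 (.lit 0) (.reg 2 + .lit 1) (.for 11 (.lit 0) (.reg 29) initBody)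

theorem initP_runs {σ : State} {N M Q n : ℕ} (h0 : σ.reg 0 = n) (h2 : σ.reg 2 = N)
    (h29 : σ.reg 29 = Q) (hQ : Q ≤ M) (h11 : ∀ j ≤ N, σ.arr 11 j = j * M)
    (h15 : σ.arr 15 = fun _ => 0) :
    Runs initP σ ((N + 2) * ((M + 1) * (initBody.size + 12) + 14)) (fun σ' =>
      ∀ q ≤ N, ∀ s < M, σ'.arr 15 (q * M + s) = if s < Q then n + 1 else 0) := by
  refine (Runs.for (m := 0) (k := N + 1) (T := (M + 1) * (initBody.size + 12)) (fun i σ' =>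
      (∀ q < i, ∀ s < M, σ'.arr 15 (q * M + s) = if s < Q then n + 1 else 0) ∧
      ∀ q, i ≤ q → ∀ s < M, σ'.arr 15 (q * M + s) = 0)
      (by rfl) rfl (Nat.zero_le _) ⟨by simp, by simp [h15]⟩ ?_ ?_).mono le_rfl
      fun _ _ h' q hq => h'.1 q (by omega)
  · intro σ' i hA _
    simp [(hA.reg 2 (by rfl)).trans h2]
  · rintro q σ₁ _ hq hA hx ⟨hB, hB'⟩
    have g0 := (hA.reg 0 (by rfl)).trans h0
    have g29 := (hA.reg 29 (by rfl)).trans h29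
    have g11 : σ₁.arr 11 = σ.arr 11 := hA.arr 11 (by rfl)
    refine (Runs.for (m := 0) (k := Q) (T := initBody.size) (fun i σ' =>
      (∀ q' < q, ∀ s < M, σ'.arr 15 (q' * M + s) = if s < Q then n + 1 else 0) ∧
      (∀ s < M, σ'.arr 15 (q * M + s) = if s < i then n + 1 else 0) ∧
      ∀ q', q < q' → ∀ s < M, σ'.arr 15 (q' * M + s) = 0)
      (by rfl) rfl (Nat.zero_le _) ⟨by simpa using hB, by simpa using hB' q le_rfl,
        fun q' hq' => by simpa using hB' q' hq'.le⟩ ?_ ?_).mono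
      (Nat.mul_le_mul_right _ (by omega)) ?_
    · intro σ' i hA' _
      exact (hA'.reg 29 (by rfl)).trans g29
    · rintro s σ₂ _ hs hA₂ hx₂ ⟨hC1, hC2, hC3⟩
      refine Runs.flat (by rfl) le_rfl ?_
      have f0 := (hA₂.reg 0 (by rfl)).trans g0
      have f10 := (hA₂.reg 10 (by rfl)).trans hx
      have f11 := (hA₂.arr 11 (by rfl)).trans g11
      have e15 : ((initBody.den σ₂).setReg 11 (s + 1)).arr 15 =
          Function.update (σ₂.arr 15) (q * M + s) (n + 1) := by
        simp [initBody, Prog.den, f0, f10, f11, hx₂, h11 q (by omega)]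
      rw [e15]
      refine ⟨fun q' hq' s' hs' => ?_, fun s' hs' => ?_, fun q' hq' s' hs' => ?_⟩
      · rw [Function.update_of_ne fun he => (by
            have := (addr_inj hs' (hs.trans_le hQ) he).1; omega)]
        exact hC1 q' hq' s' hs'
      · by_cases he : s' = s
        · subst he; rw [Function.update_self, if_pos (by omega)]
        · rw [Function.update_of_ne (by omega), hC2 s' hs']
          exact if_congr (by omega) rfl rfl
      · rw [Function.update_of_ne fun he => (by
            have := (addr_inj hs' (hs.trans_le hQ) he).1; omega)]
        exact hC3 q' hq' s' hs'
    · rintro σ₂ - ⟨hC1, hC2, hC3⟩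
      refine ⟨fun q' hq' s hs => ?_, fun q' hq' s hs => hC3 q' hq' s hs⟩
      rcases (Nat.lt_succ_iff.1 hq').lt_or_eq with hlt | rfl
      · exact hC1 q' hlt s hs
      · exact hC2 s hs

end RAM

/-! ### Listing the nodes of a tree bottom-up -/

/-- The nodes that are not among the first `i` entries of the queue. -/
def remaining (N : ℕ) (Q : ℕ → ℕ) (i : ℕ) : Finset ℕ :=
  (Finset.range N).filter fun y => ∀ k < i, Q k ≠ y

/-- The invariant of the elimination of leaves.  The first `i` entries of the queue `Q` of length
`qt` have been removed from the tree; `d x` is the number of remaining neighbours of the node `x`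
and `p x` their sum, where the parent is always counted.  A node enters the queue once its children
have been removed. -/
structure QInv (N : ℕ) (par : ℕ → ℕ) (i : ℕ) (Q : ℕ → ℕ) (qt : ℕ) (d p : ℕ → ℕ) : Prop where
  le : i ≤ qt
  lt : ∀ k < qt, Q k < N
  inj : ∀ k < qt, ∀ k' < qt, Q k = Q k' → k = k'
  child : ∀ k < qt, ∀ y < N, par y = Q k → ∃ k' < i, k' < k ∧ Q k' = y
  queued : ∀ x < N, (∀ y < N, par y = x → ∃ k < i, Q k = y) → ∃ k < qt, Q k = x
  deg : ∀ x ∈ remaining N Q i, d x = 1 + ((remaining N Q i).filter fun y => par y = x).card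
  sum : ∀ x ∈ remaining N Q i, p x = par x + ∑ y ∈ (remaining N Q i).filter fun y => par y = x, y
  done : ∀ k < i, p (Q k) = par (Q k)
  root : d N = 0

section
variable {N : ℕ} {T : SimpleGraph (Fin N)} {par dep : ℕ → ℕ} {i qt : ℕ} {Q d p : ℕ → ℕ}

theorem IsRooting.par_le (h : IsRooting T par dep) {x : ℕ} (hx : x < N) : par x ≤ N := by
  by_cases h0 : x = 0
  · rw [h0, h.zero]
  · exact (h.lt x hx h0).1.le

theorem IsRooting.dep_lt (h : IsRooting T par dep) {x : ℕ} (hx : x < N) (hp : par x < N) :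
    dep (par x) < dep x := by
  refine (h.lt x hx ?_).2
  rintro rfl
  rw [h.zero] at hp
  exact lt_irrefl _ hp

/-- The queue does not run empty: a deepest remaining node has no remaining children. -/
theorem QInv.lt_length (hQ : QInv N par i Q qt d p) (h : IsRooting T par dep) (hi : i < N) :
    i < qt := by
  have hne : (remaining N Q i).Nonempty := by
    rw [Finset.nonempty_iff_ne_empty]
    intro he
    have hsub : Finset.range N ⊆ (Finset.range i).image Q := by
      intro y hy
      by_contra hc
      have : y ∈ remaining N Q i := by
        refine Finset.mem_filter.2 ⟨hy, fun k hk hky => hc ?_⟩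
        exact Finset.mem_image.2 ⟨k, Finset.mem_range.2 hk, hky⟩
      simp [he] at this
    have := (Finset.card_le_card hsub).trans Finset.card_image_le
    simp at this
    omega
  obtain ⟨x, hx, hmax⟩ := Finset.exists_max_image _ dep hne
  have hx' := Finset.mem_filter.1 hx
  have hxN := Finset.mem_range.1 hx'.1
  obtain ⟨k, hk, hkx⟩ := hQ.queued x hxN fun y hy hyx => by
    by_contra hc
    push Not at hc
    have h1 := hmax y (Finset.mem_filter.2 ⟨Finset.mem_range.2 hy, hc⟩)
    have h2 := h.dep_lt hy (hyx ▸ hxN)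
    rw [hyx] at h2
    omega
  by_contra hc
  exact hx'.2 k (by omega) hkx

/-- Removing the next node `x` from the tree.  Since it has no children left, the sum `p x` of its
remaining neighbours is its parent `q`, which is ready for the queue if its degree drops to one. -/
theorem QInv.step (hQ : QInv N par i Q qt d p) (h : IsRooting T par dep) (hi : i < N) {x q : ℕ}
    (hx : x = Q i) (hq : q = p x) {d' p' : ℕ → ℕ}
    (hd' : d' = Function.update d q (d q - 1)) (hp' : p' = Function.update p q (p q - x)) :
    QInv N par (i + 1) (if d' q = 1 then Function.update Q qt q else Q)
      (if d' q = 1 then qt + 1 else qt) d' p' := by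
  have hiq := hQ.lt_length h hi
  have hxN : x < N := hx ▸ hQ.lt i hiq
  have hxrem : x ∈ remaining N Q i := by
    refine Finset.mem_filter.2 ⟨Finset.mem_range.2 hxN, fun k hk hkx => ?_⟩
    have := hQ.inj k (by omega) i hiq (hkx.trans hx)
    omega
  have hxemp : (remaining N Q i).filter (fun y => par y = x) = ∅ := by
    rw [Finset.filter_eq_empty_iff]
    intro y hy hyx
    have hy := Finset.mem_filter.1 hy
    obtain ⟨k', hk', -, hky⟩ := hQ.child i hiq y (Finset.mem_range.1 hy.1) (hyx.trans hx)
    exact hy.2 k' hk' hky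
  have hqx : q = par x := by rw [hq, hQ.sum x hxrem, hxemp]; simp
  have hqle : q ≤ N := hqx ▸ h.par_le hxN
  -- the parent is not in the queue yet
  have hqQ : ∀ k < qt, Q k ≠ q := by
    intro k hk hkq
    obtain ⟨k', hk', -, hkx⟩ := hQ.child k hk x hxN (hqx.symm.trans hkq.symm)
    have := hQ.inj k' (by omega) i hiq (hkx.trans hx)
    omega
  have hqne : q ≠ x := by rintro rfl; exact hqQ i hiq hx.symm
  have hrem : ∀ Q' : ℕ → ℕ, (∀ k < i + 1, Q' k = Q k) →
      remaining N Q' (i + 1) = (remaining N Q i).erase x := by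
    intro Q' hQ'
    ext y
    simp only [remaining, Finset.mem_filter, Finset.mem_range, Finset.mem_erase]
    constructor
    · rintro ⟨hy, hk⟩
      refine ⟨fun hyx => hk i (by omega) ?_, hy, fun k hk' => ?_⟩
      · rw [hQ' i (by omega), hyx, hx]
      · rw [← hQ' k (by omega)]; exact hk k (by omega)
    · rintro ⟨hyx, hy, hk⟩
      refine ⟨hy, fun k hk' => ?_⟩
      rw [hQ' k hk']
      rcases (Nat.lt_succ_iff.1 hk').lt_or_eq with hlt | rfl
      · exact hk k hlt
      · exact fun he => hyx (he.symm.trans hx.symm)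
  have hqrem : q < N → q ∈ remaining N Q i := fun hqN =>
    Finset.mem_filter.2 ⟨Finset.mem_range.2 hqN, fun k hk => hqQ k (by omega)⟩
  have hxq : x ∈ (remaining N Q i).filter fun y => par y = q :=
    Finset.mem_filter.2 ⟨hxrem, hqx.symm⟩
  have hfq : ((remaining N Q i).erase x).filter (fun y => par y = q) =
      ((remaining N Q i).filter fun y => par y = q).erase x := by
    ext y
    simp only [Finset.mem_filter, Finset.mem_erase, and_assoc]
  have hfz : ∀ z, z ≠ q → ((remaining N Q i).erase x).filter (fun y => par y = z) =
      (remaining N Q i).filter fun y => par y = z := by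
    intro z hz
    ext y
    simp only [Finset.mem_filter, Finset.mem_erase]
    constructor
    · rintro ⟨⟨-, hy⟩, hyz⟩; exact ⟨hy, hyz⟩
    · rintro ⟨hy, hyz⟩
      exact ⟨⟨fun he => hz (by rw [← hyz, he, hqx]), hy⟩, hyz⟩
  have hdq : q < N → d' q = 1 + (((remaining N Q i).erase x).filter fun y => par y = q).card := by
    intro hqN
    rw [hd', Function.update_self, hQ.deg q (hqrem hqN), hfq, Finset.card_erase_of_mem hxq]
    have := Finset.card_pos.2 ⟨x, hxq⟩
    omega
  have hpq : q < N → p' q = par q + ∑ y ∈ ((remaining N Q i).erase x).filter fun y => par y = q,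
      y := by
    intro hqN
    have := Finset.sum_erase_add _ (fun y : ℕ => y) hxq
    rw [hp', Function.update_self, hQ.sum q (hqrem hqN), hfq]
    omega
  have hqN : d' q = 1 → q < N := by
    intro h1
    rcases hqle.lt_or_eq with hlt | he
    · exact hlt
    · rw [hd', Function.update_self, he, hQ.root] at h1; omega
  set Q' := if d' q = 1 then Function.update Q qt q else Q with hQdef
  set qt' := if d' q = 1 then qt + 1 else qt with hqtdef
  have hold : ∀ k < qt, Q' k = Q k := by
    intro k hk
    rw [hQdef]
    split_ifs
    · exact Function.update_of_ne (by omega) _ _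
    · rfl
  have hqt : qt ≤ qt' := by rw [hqtdef]; split_ifs <;> omega
  -- an entry of the new queue is an old one, or the parent
  have hnew : ∀ k < qt', k < qt ∨ (d' q = 1 ∧ k = qt ∧ Q' k = q) := by
    intro k hk
    by_cases h1 : d' q = 1
    · rw [hqtdef, if_pos h1] at hk
      rcases (Nat.lt_succ_iff.1 hk).lt_or_eq with hlt | rfl
      · exact Or.inl hlt
      · exact Or.inr ⟨h1, rfl, by rw [hQdef, if_pos h1, Function.update_self]⟩
    · rw [hqtdef, if_neg h1] at hk
      exact Or.inl hk
  have hrem' := hrem Q' fun k hk => hold k (by omega)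
  constructor
  · omega
  · intro k hk
    rcases hnew k hk with hlt | ⟨h1, -, he⟩
    · rw [hold k hlt]; exact hQ.lt k hlt
    · rw [he]; exact hqN h1
  · intro k hk k' hk' he
    rcases hnew k hk with hlt | ⟨-, rfl, h2⟩ <;> rcases hnew k' hk' with hlt' | ⟨-, rfl, h2'⟩
    · rw [hold k hlt, hold k' hlt'] at he
      exact hQ.inj k hlt k' hlt' he
    · rw [hold k hlt, h2'] at he
      exact absurd he (hqQ k hlt)
    · rw [hold k' hlt', h2] at he
      exact absurd he.symm (hqQ k' hlt')
    · rfl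
  · intro k hk y hy hyk
    rcases hnew k hk with hlt | ⟨h1, rfl, h2⟩
    · rw [hold k hlt] at hyk
      obtain ⟨k', hk', hkk, hky⟩ := hQ.child k hlt y hy hyk
      exact ⟨k', by omega, hkk, by rw [hold k' (by omega)]; exact hky⟩
    · have hcard : (((remaining N Q i).erase x).filter fun y => par y = q) = ∅ := by
        rw [← Finset.card_eq_zero]
        have := hdq (hqN h1)
        omega
      by_contra hc
      push Not at hc
      have : y ∈ ((remaining N Q i).erase x).filter fun y => par y = q := by
        refine Finset.mem_filter.2 ⟨?_, hyk.trans h2⟩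
        rw [← hrem']
        exact Finset.mem_filter.2 ⟨Finset.mem_range.2 hy, fun k' hk' => hc k' hk' (by omega)⟩
      simp [hcard] at this
  · intro z hz hall
    by_cases hzq : z = q
    · have hempty : (((remaining N Q i).erase x).filter fun y => par y = q) = ∅ := by
        rw [Finset.filter_eq_empty_iff]
        intro y hy hyq
        rw [← hrem'] at hy
        have hy := Finset.mem_filter.1 hy
        obtain ⟨k, hk, hky⟩ := hall y (Finset.mem_range.1 hy.1) (hyq.trans hzq.symm)
        exact hy.2 k hk hky
      have h1 : d' q = 1 := by rw [hdq (hzq ▸ hz), hempty]; rfl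
      refine ⟨qt, by rw [hqtdef, if_pos h1]; omega, ?_⟩
      rw [hQdef, if_pos h1, Function.update_self, hzq]
    · obtain ⟨k, hk, hkz⟩ := hQ.queued z hz fun y hy hyz => by
        obtain ⟨k, hk, hky⟩ := hall y hy hyz
        rw [hold k (by omega)] at hky
        rcases (Nat.lt_succ_iff.1 hk).lt_or_eq with hlt | rfl
        · exact ⟨k, hlt, hky⟩
        · exact absurd (by rw [← hyz, ← hky, ← hx, hqx]) hzq
      exact ⟨k, by omega, by rw [hold k hk]; exact hkz⟩
  · intro z hz
    rw [hrem'] at hz ⊢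
    by_cases hzq : z = q
    · rw [hzq]
      exact hdq (hzq ▸ Finset.mem_range.1 (Finset.mem_filter.1 (Finset.mem_of_mem_erase hz)).1)
    · rw [hd', Function.update_of_ne hzq, hfz z hzq, hQ.deg z (Finset.mem_of_mem_erase hz)]
  · intro z hz
    rw [hrem'] at hz ⊢
    by_cases hzq : z = q
    · rw [hzq]
      exact hpq (hzq ▸ Finset.mem_range.1 (Finset.mem_filter.1 (Finset.mem_of_mem_erase hz)).1)
    · rw [hp', Function.update_of_ne hzq, hfz z hzq, hQ.sum z (Finset.mem_of_mem_erase hz)]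
  · intro k hk
    rw [hold k (by omega)]
    rcases (Nat.lt_succ_iff.1 hk).lt_or_eq with hlt | rfl
    · rw [hp', Function.update_of_ne (hqQ k (by omega))]
      exact hQ.done k hlt
    · rw [← hx, hp', Function.update_of_ne hqne.symm, ← hq, hqx]
  · rw [hd']
    by_cases he : N = q
    · rw [← he, Function.update_self, hQ.root]
    · rw [Function.update_of_ne he, hQ.root]

theorem QInv.isBottomUp (hQ : QInv N par N Q qt d p) (hpar : ∀ x < N, par x ≤ N) :
    IsBottomUp N par Q ∧ ∀ x < N, p x = par x := by
  have hle := hQ.le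
  have hb : IsBottomUp N par Q := by
    refine ⟨fun k hk => hQ.lt k (by omega), fun k hk k' hk' => hQ.inj k (by omega) k' (by omega),
      fun k hk y hy hyk => ?_⟩
    obtain ⟨k', -, hkk, hky⟩ := hQ.child k (by omega) y hy hyk
    exact ⟨k', hkk, hky⟩
  refine ⟨hb, fun x hx => ?_⟩
  obtain ⟨idx, -, h1, h2, -⟩ := hb.exists_idx hpar
  rw [← h1 x hx]
  exact hQ.done _ (h2 x hx)

/-- In the beginning, the queue consists of the leaves. -/
theorem QInv.init (hdeg : ∀ x < N, d x = 1 + ((Finset.range N).filter fun y => par y = x).card)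
    (hsum : ∀ x < N, p x = par x + ∑ y ∈ (Finset.range N).filter fun y => par y = x, y)
    (hroot : d N = 0) (h1 : ∀ k < qt, Q k < N ∧ d (Q k) = 1)
    (h2 : ∀ k < qt, ∀ k' < qt, Q k = Q k' → k = k')
    (h3 : ∀ x < N, d x = 1 → ∃ k < qt, Q k = x) : QInv N par 0 Q qt d p := by
  have hrem : remaining N Q 0 = Finset.range N := by simp [remaining]
  refine ⟨Nat.zero_le _, fun k hk => (h1 k hk).1, h2, fun k hk y hy hyk => ?_, fun x hx hall => ?_,
    fun x hx => ?_, fun x hx => ?_, by simp, hroot⟩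
  · have h4 := hdeg _ (h1 k hk).1
    rw [(h1 k hk).2] at h4
    have h5 : ((Finset.range N).filter fun z => par z = Q k) = ∅ := by
      rw [← Finset.card_eq_zero]; omega
    have : y ∈ (Finset.range N).filter fun z => par z = Q k :=
      Finset.mem_filter.2 ⟨Finset.mem_range.2 hy, hyk⟩
    simp [h5] at this
  · refine h3 x hx ?_
    rw [hdeg x hx, Finset.card_eq_zero.2]
    rw [Finset.filter_eq_empty_iff]
    intro y hy hyx
    obtain ⟨k, hk, -⟩ := hall y (Finset.mem_range.1 hy) hyx
    omega
  · rw [hrem] at hx ⊢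
    exact hdeg x (Finset.mem_range.1 hx)
  · rw [hrem] at hx ⊢
    exact hsum x (Finset.mem_range.1 hx)

end

namespace RAM

/-- Adds one edge of the tree to the degrees and the sums of neighbours of its ends. -/
def linkBody : Prog :=
  .assign 11 (.get 3 (.reg 10)) ;; .assign 12 (.get 4 (.reg 10)) ;;
  .store 20 (.reg 11) (.get 20 (.reg 11) + .lit 1) ;;
  .store 20 (.reg 12) (.get 20 (.reg 12) + .lit 1) ;;
  .store 13 (.reg 11) (.get 13 (.reg 11) + .reg 12) ;;
  .store 13 (.reg 12) (.get 13 (.reg 12) + .reg 11)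

/-- Computes the degrees of the tree nodes and the sums of their neighbours, where the root has
the additional neighbour `N`. -/
def linkP : Prog := .for 10 (.lit 0) (.reg 3) linkBody ;;
  (.store 20 (.lit 0) (.get 20 (.lit 0) + .lit 1) ;;
    .store 13 (.lit 0) (.get 13 (.lit 0) + .reg 2))

/-- Appends the node in register `12` to the queue if it has degree one; register `13`
holds the length of the queue. -/
def pushP : Prog := .ite (.eq (.get 20 (.reg 12)) (.lit 1))
  (.store 14 (.reg 13) (.reg 12) ;; .assign 13 (.reg 13 + .lit 1)) .skip

/-- Appends the node in register `10` if it is a leaf. -/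
def leafBody : Prog := .assign 12 (.reg 10) ;; pushP

/-- Initializes the queue with the leaves. -/
def leafP : Prog := .assign 13 (.lit 0) ;; .for 10 (.lit 0) (.reg 2) leafBody

/-- Removes the next node of the queue from the tree. -/
def cutBody : Prog :=
  .assign 11 (.get 14 (.reg 10)) ;; .assign 12 (.get 13 (.reg 11)) ;;
  .store 20 (.reg 12) (.get 20 (.reg 12) - .lit 1) ;;
  .store 13 (.reg 12) (.get 13 (.reg 12) - .reg 11) ;; pushP

/-- Orders the nodes of the tree by successive elimination of leaves. -/
def treeP : Prog := linkP ;; leafP ;; .for 10 (.lit 0) (.reg 2) cutBody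

theorem linkP_runs {σ : State} (h13 : σ.arr 13 = fun _ => 0) (h20 : σ.arr 20 = fun _ => 0) :
    Runs linkP σ ((σ.reg 3 + 1) * (linkBody.size + 12) + 12) (fun σ' =>
      (∀ x, σ'.arr 20 x = ∑ e ∈ Finset.range (σ.reg 3),
        ((if σ.arr 3 e = x then 1 else 0) + if σ.arr 4 e = x then 1 else 0) +
          if x = 0 then 1 else 0) ∧
      ∀ x, σ'.arr 13 x = ∑ e ∈ Finset.range (σ.reg 3),
        ((if σ.arr 3 e = x then σ.arr 4 e else 0) + if σ.arr 4 e = x then σ.arr 3 e else 0) +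
          if x = 0 then σ.reg 2 else 0) := by
  refine Runs.seq (R := fun σ' =>
      (σ'.arr 20 = fun x => ∑ e ∈ Finset.range (σ.reg 3),
        ((if σ.arr 3 e = x then 1 else 0) + if σ.arr 4 e = x then 1 else 0)) ∧
      σ'.arr 13 = fun x => ∑ e ∈ Finset.range (σ.reg 3),
        ((if σ.arr 3 e = x then σ.arr 4 e else 0) + if σ.arr 4 e = x then σ.arr 3 e else 0))
    ((Runs.for (m := 0) (k := σ.reg 3) (T := linkBody.size) (fun i σ' =>
      (σ'.arr 20 = fun x => ∑ e ∈ Finset.range i,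
        ((if σ.arr 3 e = x then 1 else 0) + if σ.arr 4 e = x then 1 else 0)) ∧
      σ'.arr 13 = fun x => ∑ e ∈ Finset.range i,
        ((if σ.arr 3 e = x then σ.arr 4 e else 0) + if σ.arr 4 e = x then σ.arr 3 e else 0))
      (by rfl) rfl (Nat.zero_le _) (by simpa using ⟨h20, h13⟩) ?_ ?_).mono le_rfl
      fun _ _ h => h) ?_
  · intro σ' i hA _
    exact hA.reg 3 (by rfl)
  · rintro i σ' _ _ hA hx ⟨h1, h2⟩
    refine Runs.flat (by rfl) le_rfl ?_
    have g3 : σ'.arr 3 = σ.arr 3 := hA.arr 3 (by rfl)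
    have g4 : σ'.arr 4 = σ.arr 4 := hA.arr 4 (by rfl)
    simp only [Finset.sum_range_succ, ← add_assoc]
    simp [linkBody, Prog.den, hx, g3, g4, h1, h2, update_add]
  · rintro σ' hA ⟨h1, h2⟩
    refine Runs.flat (by rfl) (by decide) ?_
    have g2 : σ'.reg 2 = σ.reg 2 := hA.reg 2 (by rfl)
    simp [Prog.den, h1, h2, g2, update_add, eq_comm]

theorem pushP_den (σ : State) : (pushP.den σ).arr 14 =
      (if σ.arr 20 (σ.reg 12) = 1 then Function.update (σ.arr 14) (σ.reg 13) (σ.reg 12)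
        else σ.arr 14) ∧
    (pushP.den σ).reg 13 = (if σ.arr 20 (σ.reg 12) = 1 then σ.reg 13 + 1 else σ.reg 13) ∧
    (pushP.den σ).arr 20 = σ.arr 20 ∧ (pushP.den σ).arr 13 = σ.arr 13 := by
  by_cases h : σ.arr 20 (σ.reg 12) = 1 <;> simp [pushP, Prog.den, h]

theorem leafP_runs {σ : State} :
    Runs leafP σ (2 + (σ.reg 2 + 1) * (leafBody.size + 12)) (fun σ' =>
      (∀ k < σ'.reg 13, σ'.arr 14 k < σ.reg 2 ∧ σ.arr 20 (σ'.arr 14 k) = 1) ∧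
      (∀ k < σ'.reg 13, ∀ k' < σ'.reg 13, σ'.arr 14 k = σ'.arr 14 k' → k = k') ∧
      ∀ x < σ.reg 2, σ.arr 20 x = 1 → ∃ k < σ'.reg 13, σ'.arr 14 k = x) := by
  refine (Runs.flat (Q := fun σ' => σ' = σ.setReg 13 0) (by rfl) (by decide) rfl).seq ?_
  rintro σ₁ hA₁ hσ₁
  have g2 : σ₁.reg 2 = σ.reg 2 := hA₁.reg 2 (by rfl)
  have g20 : σ₁.arr 20 = σ.arr 20 := hA₁.arr 20 (by rfl)
  refine (Runs.for (m := 0) (k := σ.reg 2) (T := leafBody.size) (fun i σ' =>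
      (∀ k < σ'.reg 13, σ'.arr 14 k < i ∧ σ.arr 20 (σ'.arr 14 k) = 1) ∧
      (∀ k < σ'.reg 13, ∀ k' < σ'.reg 13, σ'.arr 14 k = σ'.arr 14 k' → k = k') ∧
      ∀ x < i, σ.arr 20 x = 1 → ∃ k < σ'.reg 13, σ'.arr 14 k = x)
      (by rfl) rfl (Nat.zero_le _) (by simp [hσ₁]) ?_ ?_).mono le_rfl fun _ _ h => h
  · intro σ' i hA _
    exact (hA.reg 2 (by rfl)).trans g2
  · rintro i σ' _ _ hA hx ⟨h1, h2, h3⟩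
    refine Runs.flat (by rfl) le_rfl ?_
    have f20 : σ'.arr 20 = σ.arr 20 := (hA.arr 20 (by rfl)).trans g20
    have e1 : (pushP.den (σ'.setReg 12 i)).arr 14 = if σ.arr 20 i = 1 then
        Function.update (σ'.arr 14) (σ'.reg 13) i else σ'.arr 14 := by
      simpa [f20] using (pushP_den (σ'.setReg 12 i)).1
    have e2 : (pushP.den (σ'.setReg 12 i)).reg 13 =
        if σ.arr 20 i = 1 then σ'.reg 13 + 1 else σ'.reg 13 := by
      simpa [f20] using (pushP_den (σ'.setReg 12 i)).2.1
    have e0 : leafBody.den σ' = pushP.den (σ'.setReg 12 i) := by simp [leafBody, Prog.den, hx]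
    simp only [e0, State.setReg_arr, State.setReg_reg, e1, e2, show (13 : ℕ) ≠ 10 by decide,
      if_false]
    by_cases hi : σ.arr 20 i = 1
    · simp only [hi, if_true]
      refine ⟨fun k hk => ?_, fun k hk k' hk' he => ?_, fun x hx h1x => ?_⟩
      · rcases (Nat.lt_succ_iff.1 hk).lt_or_eq with hlt | rfl
        · rw [Function.update_of_ne (by omega)]
          exact ⟨(h1 k hlt).1.trans (by omega), (h1 k hlt).2⟩
        · rw [Function.update_self]
          exact ⟨by omega, hi⟩
      · rcases (Nat.lt_succ_iff.1 hk).lt_or_eq with hlt | rfl <;>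
          rcases (Nat.lt_succ_iff.1 hk').lt_or_eq with hlt' | rfl
        · rw [Function.update_of_ne (by omega), Function.update_of_ne (by omega)] at he
          exact h2 k hlt k' hlt' he
        · rw [Function.update_of_ne (by omega), Function.update_self] at he
          have := (h1 k hlt).1
          omega
        · rw [Function.update_self, Function.update_of_ne (by omega)] at he
          have := (h1 k' hlt').1
          omega
        · rfl
      · rcases (Nat.lt_succ_iff.1 hx).lt_or_eq with hlt | rfl
        · obtain ⟨k, hk, hkx⟩ := h3 x hlt h1x
          exact ⟨k, by omega, by rw [Function.update_of_ne (by omega)]; exact hkx⟩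
        · exact ⟨σ'.reg 13, by omega, Function.update_self _ _ _⟩
    · simp only [hi, if_false]
      refine ⟨fun k hk => ⟨(h1 k hk).1.trans (by omega), (h1 k hk).2⟩, h2, fun x hx h1x => ?_⟩
      rcases (Nat.lt_succ_iff.1 hx).lt_or_eq with hlt | rfl
      · exact h3 x hlt h1x
      · exact absurd h1x hi

theorem treeP_runs {σ : State} {N : ℕ} {T : SimpleGraph (Fin N)} {par dep : ℕ → ℕ}
    (h : IsRooting T par dep) {F : List (Fin N × Fin N)} (hF : IsEdgeList T F)
    (hN : 0 < N) (h2 : σ.reg 2 = N) (h3 : σ.reg 3 = F.length)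
    (a3 : σ.arr 3 = fun i => (F.map fun p => p.1.val).getD i 0)
    (a4 : σ.arr 4 = fun i => (F.map fun p => p.2.val).getD i 0)
    (h13 : σ.arr 13 = fun _ => 0) (h20 : σ.arr 20 = fun _ => 0) :
    Runs treeP σ ((F.length + 1) * (linkBody.size + 12) + 12 +
        (2 + (N + 1) * (leafBody.size + 12) + (N + 1) * (cutBody.size + 12)))
      (fun σ' => IsBottomUp N par (σ'.arr 14) ∧ ∀ x < N, σ'.arr 13 x = par x) := by
  refine ((linkP_runs h13 h20).mono (by rw [h3]) fun _ _ h => h).seq ?_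
  rintro σ₁ hA₁ ⟨e20, e13⟩
  have g2 : σ₁.reg 2 = N := (hA₁.reg 2 (by rfl)).trans h2
  have hdeg : ∀ x < N, σ₁.arr 20 x = 1 + ((Finset.range N).filter fun y => par y = x).card := by
    intro x hx
    rw [e20, h3, a3, a4, Finset.card_eq_sum_ones]
    exact h.sum_edges hF (fun _ => 1) hx
  have hsum : ∀ x < N, σ₁.arr 13 x =
      par x + ∑ y ∈ (Finset.range N).filter fun y => par y = x, y := by
    intro x hx
    rw [e13, h2, h3, a3, a4]
    exact h.sum_edges hF (fun y => y) hx
  have hroot : σ₁.arr 20 N = 0 := by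
    have hlt : ∀ f : Fin N × Fin N → Fin N, ∀ e, (F.map fun p => (f p).val).getD e 0 ≠ N := by
      intro f e
      rw [List.getD_eq_getElem?_getD, List.getElem?_map]
      cases F[e]? with
      | none => simp; omega
      | some p => exact (f p).isLt.ne
    rw [e20, a3, a4, Finset.sum_eq_zero fun e _ => ?_, if_neg hN.ne']
    rw [if_neg (hlt Prod.fst e), if_neg (hlt Prod.snd e), add_zero]
  refine (leafP_runs.mono (by rw [g2]) fun _ _ h => h).seq ?_
  rintro σ₂ hA₂ ⟨q1, q2, q3⟩
  rw [g2] at q1 q3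
  have g2 : σ₂.reg 2 = N := (hA₂.reg 2 (by rfl)).trans g2
  have g20 : σ₂.arr 20 = σ₁.arr 20 := hA₂.arr 20 (by rfl)
  have g13 : σ₂.arr 13 = σ₁.arr 13 := hA₂.arr 13 (by rfl)
  refine (Runs.for (m := 0) (k := N) (T := cutBody.size) (fun i σ' =>
      QInv N par i (σ'.arr 14) (σ'.reg 13) (σ'.arr 20) (σ'.arr 13))
      (by rfl) rfl (Nat.zero_le _) ?_ ?_ ?_).mono le_rfl
      fun σ' _ hQ => hQ.isBottomUp fun x hx => h.par_le hx
  · simp only [State.setReg_arr, State.setReg_reg, show (13 : ℕ) ≠ 10 by decide, if_false, g20, g13]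
    exact QInv.init hdeg hsum hroot q1 q2 q3
  · intro σ' i hA _
    exact (hA.reg 2 (by rfl)).trans g2
  · intro i σ' _ hi hA hx hQ
    refine Runs.flat (by rfl) le_rfl ?_
    have hs := hQ.step h hi rfl rfl rfl rfl
    let τ := (((σ'.setReg 11 (σ'.arr 14 i)).setReg 12 (σ'.arr 13 (σ'.arr 14 i))).setArr 20
      (σ'.arr 13 (σ'.arr 14 i)) (σ'.arr 20 (σ'.arr 13 (σ'.arr 14 i)) - 1)).setArr 13
      (σ'.arr 13 (σ'.arr 14 i)) (σ'.arr 13 (σ'.arr 13 (σ'.arr 14 i)) - σ'.arr 14 i)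
    have e0 : cutBody.den σ' = pushP.den τ := by simp [cutBody, Prog.den, hx, τ]
    obtain ⟨e1, e2, e3, e4⟩ := pushP_den τ
    simp only [e0, State.setReg_arr, State.setReg_reg, show (13 : ℕ) ≠ 10 by decide, if_false, e1,
      e2, e3, e4]
    simpa [τ] using hs

end RAM

/-! ### The instance given by the input -/

/-- The position at which the list of bag `j` starts. -/
def bagStart {n N : ℕ} (B : Fin N → List (Fin n)) (j : ℕ) : ℕ :=
  ((List.ofFn B).take j).flatten.length

/-- The entry at position `x` of the concatenation of the bag lists. -/
def bagEntry {n N : ℕ} (B : Fin N → List (Fin n)) (x : ℕ) : ℕ :=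
  ((List.ofFn B).flatten.map Fin.val).getD x 0

section lists
variable {n N : ℕ} (B : Fin N → List (Fin n))

theorem bagStart_succ (q : Fin N) : bagStart B (q + 1) = bagStart B q + (B q).length := by
  rw [bagStart, bagStart, List.take_succ_eq_append_getElem (by simp), List.flatten_append]
  simp

theorem bagEntry_add (q : Fin N) {i : ℕ} (hi : i < (B q).length) :
    bagEntry B (bagStart B q + i) = (B q)[i] := by
  have hq : q.val < (List.ofFn B).length := by simp
  have hsplit : (List.ofFn B).flatten = ((List.ofFn B).take q).flatten ++
      (B q ++ ((List.ofFn B).drop (q + 1)).flatten) := by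
    conv_lhs => rw [← List.take_append_drop q (List.ofFn B), List.drop_eq_getElem_cons hq]
    simp
  rw [bagEntry, hsplit, bagStart, List.getD_eq_getElem?_getD, List.getElem?_map,
    List.getElem?_append_right (Nat.le_add_right _ _), Nat.add_sub_cancel_left,
    List.getElem?_append_left hi, List.getElem?_eq_getElem hi]
  rfl

theorem mem_Ico_bag {q : Fin N} {x : ℕ}
    (hx : x ∈ Finset.Ico (bagStart B q) (bagStart B (q + 1))) :
    ∃ i, ∃ hi : i < (B q).length, x = bagStart B q + i ∧ bagEntry B x = (B q)[i] := by
  rw [Finset.mem_Ico, bagStart_succ] at hx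
  obtain ⟨i, rfl⟩ := Nat.exists_eq_add_of_le hx.1
  exact ⟨i, by omega, rfl, bagEntry_add B q (by omega)⟩

theorem mem_image_bag {q : Fin N} {u : ℕ} :
    u ∈ (Finset.Ico (bagStart B q) (bagStart B (q + 1))).image (bagEntry B) ↔
      ∃ v ∈ B q, v.val = u := by
  rw [Finset.mem_image]
  constructor
  · rintro ⟨x, hx, rfl⟩
    obtain ⟨i, hi, -, he⟩ := mem_Ico_bag B hx
    exact ⟨_, List.getElem_mem hi, he.symm⟩
  · rintro ⟨v, hv, rfl⟩
    obtain ⟨i, hi, rfl⟩ := List.mem_iff_getElem.1 hv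
    refine ⟨bagStart B q + i, ?_, bagEntry_add B q hi⟩
    rw [Finset.mem_Ico, bagStart_succ]
    omega

theorem bag_injOn {q : Fin N} (hq : (B q).Nodup) :
    Set.InjOn (bagEntry B) (Finset.Ico (bagStart B q) (bagStart B (q + 1))) := by
  intro x hx y hy he
  obtain ⟨i, hi, rfl, hi'⟩ := mem_Ico_bag B hx
  obtain ⟨j, hj, rfl, hj'⟩ := mem_Ico_bag B hy
  rw [hi', hj'] at he
  rw [(hq.getElem_inj_iff).1 (Fin.ext he)]

end lists

/-- The instance on which the algorithm works for the given input; `par`, `ord` and `idx` describe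
the rooted tree. -/
def Inst.ofInput {n N : ℕ} (L K : ℕ) (E : List (Fin n × Fin n)) (V' : Finset (Fin n))
    (B : Fin N → List (Fin n)) (par ord idx : ℕ → ℕ) : Inst where
  n := n
  N := N
  L := L
  K := K
  off j := bagStart B (min j N)
  bag := bagEntry B
  ord := ord
  par := par
  idx := idx
  pos j u := ∑ x ∈ Finset.Ico (bagStart B (min j N)) (bagStart B (min (j + 1) N)),
    if bagEntry B x = u then x + 1 - bagStart B (min j N) else 0
  adj u w := ∑ e ∈ Finset.range E.length,
    ((if (E.map fun p => p.1.val).getD e 0 = u ∧ (E.map fun p => p.2.val).getD e 0 = w then 1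
        else 0) +
      if (E.map fun p => p.2.val).getD e 0 = u ∧ (E.map fun p => p.1.val).getD e 0 = w then 1
        else 0)
  inV u := (List.ofFn fun v => if v ∈ V' then 1 else 0).getD u 0

namespace Inst

section ofInput
variable {n N L K : ℕ} {E : List (Fin n × Fin n)} {V' : Finset (Fin n)}
  {B : Fin N → List (Fin n)} {par ord idx : ℕ → ℕ}

theorem ofInput_adj {G : SimpleGraph (Fin n)} (hE : IsEdgeList G E) (u w : Fin n) :
    (ofInput L K E V' B par ord idx).adj u w ≠ 0 ↔ G.Adj u w := by
  have h := sum_range_getD E (fun p => p.1.val) (fun p => p.2.val) fun a b =>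
    (if a = u.val ∧ b = w.val then 1 else 0) + if b = u.val ∧ a = w.val then 1 else 0
  have hadj : (ofInput L K E V' B par ord idx).adj u w = (E.map fun a =>
      (if a.1.val = u.val ∧ a.2.val = w.val then 1 else 0) +
        if a.2.val = u.val ∧ a.1.val = w.val then 1 else 0).sum := h
  rw [hadj, Ne, List.sum_eq_zero_iff, ← SimpleGraph.mem_edgeSet, hE.2]
  simp only [List.mem_map, forall_exists_index, and_imp, forall_apply_eq_imp_iff₂, not_forall,
    Sym2.eq_iff, ← Fin.ext_iff]
  constructor
  · rintro ⟨a, ha, h0⟩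
    refine ⟨a, ha, ?_⟩
    by_contra hc
    push Not at hc
    refine h0 ?_
    rw [if_neg fun h => hc.1 h.1 h.2, if_neg fun h => hc.2 h.2 h.1, add_zero]
  · rintro ⟨a, ha, h1 | h1⟩
    · exact ⟨a, ha, by rw [if_pos h1]; omega⟩
    · exact ⟨a, ha, by rw [if_pos (And.intro h1.2 h1.1)]; omega⟩

theorem ofInput_inV (u : Fin n) :
    (ofInput L K E V' B par ord idx).inV u = if u ∈ V' then 1 else 0 := by
  simp [ofInput, List.getD_eq_getElem?_getD]

theorem ofInput_X (q : Fin N) : (ofInput L K E V' B par ord idx).X q =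
    (Finset.Ico (bagStart B q) (bagStart B (q + 1))).image (bagEntry B) := by
  have := q.isLt
  rw [X]
  show (Finset.Ico (bagStart B (min q N)) (bagStart B (min (q + 1) N))).image (bagEntry B) = _
  rw [min_eq_left (by omega), min_eq_left (by omega)]

theorem ofInput_root : (ofInput L K E V' B par ord idx).X N = ∅ := by
  rw [X]
  show (Finset.Ico (bagStart B (min N N)) (bagStart B (min (N + 1) N))).image (bagEntry B) = _
  rw [min_eq_left (by omega), min_eq_right (by omega), Finset.Ico_self, Finset.image_empty]

theorem mem_ofInput_X {G : SimpleGraph (Fin n)} {D : TreeDecomposition G (Fin N)}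
    (hB : IsBagList D B) {q : Fin N} {u : ℕ} :
    u ∈ (ofInput L K E V' B par ord idx).X q ↔ ∃ v ∈ D.bag q, v.val = u := by
  rw [ofInput_X, mem_image_bag]
  simp only [(hB q).2]

theorem ofInput_pos (q : Fin N) (u : ℕ) : (ofInput L K E V' B par ord idx).pos q u =
    ∑ x ∈ Finset.Ico (bagStart B q) (bagStart B (q + 1)),
      if bagEntry B x = u then x + 1 - bagStart B q else 0 := by
  have := q.isLt
  show ∑ x ∈ Finset.Ico (bagStart B (min q N)) (bagStart B (min (q + 1) N)),
    (if bagEntry B x = u then x + 1 - bagStart B (min q N) else 0) = _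
  rw [min_eq_left (by omega), min_eq_left (by omega)]

theorem ofInput_pos_root (u : ℕ) : (ofInput L K E V' B par ord idx).pos N u = 0 := by
  show ∑ x ∈ Finset.Ico (bagStart B (min N N)) (bagStart B (min (N + 1) N)), _ = _
  rw [min_eq_left (by omega), min_eq_right (by omega), Finset.Ico_self, Finset.sum_empty]

theorem ofInput_pos_of_mem {q : Fin N} (hq : (B q).Nodup) {x : ℕ}
    (hx : x ∈ Finset.Ico (bagStart B q) (bagStart B (q + 1))) :
    (ofInput L K E V' B par ord idx).pos q (bagEntry B x) = x + 1 - bagStart B q := by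
  rw [ofInput_pos, Finset.sum_eq_single_of_mem x hx, if_pos rfl]
  intro y hy hyx
  rw [if_neg fun he => hyx (bag_injOn B hq hy hx he)]

theorem ofInput_pos_of_notMem {q : Fin N} {u : ℕ}
    (hu : u ∉ (ofInput L K E V' B par ord idx).X q) :
    (ofInput L K E V' B par ord idx).pos q u = 0 := by
  rw [ofInput_X, Finset.mem_image] at hu
  rw [ofInput_pos]
  exact Finset.sum_eq_zero fun x hx => if_neg fun he => hu ⟨x, hx, he⟩

theorem ofInput_good {G : SimpleGraph (Fin n)} {D : TreeDecomposition G (Fin N)} {dep : ℕ → ℕ}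
    (hE : IsEdgeList G E) (hB : IsBagList D B) (hK : ∀ q, (B q).length ≤ K)
    (hr : IsRooting D.tree par dep) (hlt : ∀ i < N, ord i < N) (h1 : ∀ i < N, idx (ord i) = i)
    (h2 : ∀ q < N, ord (idx q) = q) (h3 : ∀ q < N, idx q < N) (h4 : idx N = N)
    (h5 : ∀ q < N, idx q < idx (par q)) : (ofInput L K E V' B par ord idx).Good := by
  have hcase : ∀ {P : ℕ → Prop}, (∀ q : Fin N, P q) → P N → ∀ j ≤ N, P j := by
    intro P hP hN j hj
    rcases hj.lt_or_eq with hj | rfl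
    · exact hP ⟨j, hj⟩
    · exact hN
  have hoff : ∀ q : Fin N, (ofInput L K E V' B par ord idx).off q = bagStart B q :=
    fun q => congrArg (bagStart B) (min_eq_left q.isLt.le)
  have hoff' : ∀ q : Fin N, (ofInput L K E V' B par ord idx).off (q + 1) = bagStart B (q + 1) :=
    fun q => congrArg (bagStart B) (min_eq_left q.isLt)
  have hoffN : (ofInput L K E V' B par ord idx).off (N + 1) =
      (ofInput L K E V' B par ord idx).off N := by
    show bagStart B (min (N + 1) N) = bagStart B (min N N)
    rw [min_self, min_eq_right (by omega)]
  have hX := ofInput_X (L := L) (K := K) (E := E) (V' := V') (B := B) (par := par) (ord := ord)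
    (idx := idx)
  have hroot := ofInput_root (L := L) (K := K) (E := E) (V' := V') (B := B) (par := par)
    (ord := ord) (idx := idx)
  have hex : ∀ q : Fin N, ∀ u ∈ (ofInput L K E V' B par ord idx).X q, ∃ x,
      x ∈ Finset.Ico (bagStart B q) (bagStart B (q + 1)) ∧ u = bagEntry B x ∧
      (ofInput L K E V' B par ord idx).pos q u = x + 1 - bagStart B q := by
    intro q u hu
    rw [hX, Finset.mem_image] at hu
    obtain ⟨x, hx, rfl⟩ := hu
    exact ⟨x, hx, rfl, ofInput_pos_of_mem (hB q).1 hx⟩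
  constructor
  · refine hcase (fun q => ?_) hoffN.ge
    rw [hoff, hoff', bagStart_succ]; omega
  · refine hcase (fun q => ?_) (hoffN.le.trans (Nat.le_add_right _ _))
    rw [hoff, hoff', bagStart_succ]
    exact Nat.add_le_add_left (hK q) _
  · refine hcase (fun q u hu => ?_) (fun u hu => by simp [hroot] at hu)
    obtain ⟨v, -, rfl⟩ := (mem_ofInput_X hB).1 hu
    exact v.isLt
  · refine hcase (fun q => ?_) (by rw [hoffN]; simp)
    rw [hoff, hoff']
    exact bag_injOn B (hB q).1
  · refine hcase (fun q u _ => ?_) (fun u _ => by rw [ofInput_pos_root]; omega)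
    by_cases hu : u ∈ (ofInput L K E V' B par ord idx).X q
    · obtain ⟨x, hx, -, he⟩ := hex q u hu
      rw [Finset.mem_Ico, bagStart_succ] at hx
      have := hK q
      show _ ≤ K
      omega
    · rw [ofInput_pos_of_notMem hu]; omega
  · refine hcase (fun q u _ => ⟨fun h0 hu => ?_, ofInput_pos_of_notMem⟩)
      (fun u _ => by rw [ofInput_pos_root, hroot]; simp)
    obtain ⟨x, hx, -, he⟩ := hex q u hu
    rw [Finset.mem_Ico] at hx
    omega
  · refine hcase (fun q u hu w hw he => ?_) (fun u hu => by simp [hroot] at hu)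
    obtain ⟨x, hx, hxu, hx'⟩ := hex q u hu
    obtain ⟨y, hy, hyw, hy'⟩ := hex q w hw
    rw [Finset.mem_Ico] at hx hy
    rw [hxu, hyw, show x = y by omega]
  · exact hroot
  · exact hlt
  · exact h1
  · exact h2
  · exact h3
  · exact h4
  · exact fun q hq => hr.par_le hq
  · exact h5
  · intro q hq q' hq' hqq u hu hu'
    obtain ⟨v, hv, rfl⟩ := (mem_ofInput_X hB (q := ⟨q, hq⟩)).1 hu
    obtain ⟨v', hv', he⟩ := (mem_ofInput_X hB (q := ⟨q', hq'⟩)).1 hu'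
    rw [Fin.ext he] at hv'
    obtain ⟨r, hr, hvr⟩ := D.mem_bag_par hr h5 (q := ⟨q, hq⟩) (q' := ⟨q', hq'⟩) hqq hv hv'
    have : (ofInput L K E V' B par ord idx).par q = r := hr
    rw [this]
    exact (mem_ofInput_X hB).2 ⟨v, hvr, rfl⟩
  · intro u hu
    obtain ⟨q, hq⟩ := D.exists_mem_bag ⟨u, hu⟩
    exact ⟨q, q.isLt, (mem_ofInput_X hB).2 ⟨_, hq, rfl⟩⟩
  · intro u hu w hw ha
    obtain ⟨q, hq, hq'⟩ := D.exists_adj_bag ⟨u, hu⟩ ⟨w, hw⟩ ((ofInput_adj hE ⟨u, hu⟩ ⟨w, hw⟩).1 ha)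
    exact ⟨q, q.isLt, (mem_ofInput_X hB).2 ⟨_, hq, rfl⟩, (mem_ofInput_X hB).2 ⟨_, hq', rfl⟩⟩

open Classical in
/-- The counting conditions for the instance are the conditions for the graph. -/
theorem ofInput_cert_iff {G : SimpleGraph (Fin n)} (hE : IsEdgeList G E) {t f : ℕ → ℕ} :
    (ofInput L K E V' B par ord idx).Cert t f ↔
      IsCert G V' L (fun v => t v) (fun v => f v) := by
  have hadj := ofInput_adj (L := L) (K := K) (V' := V') (B := B) (par := par) (ord := ord)
    (idx := idx) hE
  have hV := ofInput_inV (L := L) (K := K) (V' := V') (B := B) (par := par) (ord := ord)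
    (idx := idx) (E := E)
  constructor
  · intro h
    refine ⟨fun u => h.lt u u.isLt, fun u w w' hw hw' ht ht' => ?_, fun u => ?_, fun u hu => ?_⟩
    · refine Fin.ext (Finset.card_le_one.1 (h.late u u.isLt) w ?_ w' ?_) <;>
        refine Finset.mem_filter.2 ⟨Finset.mem_range.2 (Fin.isLt _), ?_, ?_⟩
      · exact (hadj u w).2 hw
      · exact ht
      · exact (hadj u w').2 hw'
      · exact ht'
    · refine (h.helps u u.isLt).imp_right (Or.imp_right fun h1 => ?_)
      obtain ⟨w, hw⟩ := Finset.card_pos.1 h1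
      obtain ⟨hw, ha, hh⟩ := Finset.mem_filter.1 hw
      exact ⟨⟨w, Finset.mem_range.1 hw⟩, (hadj u ⟨w, Finset.mem_range.1 hw⟩).1 ha, hh⟩
    · refine (h.target u u.isLt).resolve_left ?_
      rw [hV, if_pos hu]
      omega
  · intro h
    refine ⟨fun u hu => h.lt ⟨u, hu⟩, fun u hu => Finset.card_le_one.2 fun w hw w' hw' => ?_,
      fun u hu => ?_, fun u hu => ?_⟩
    · obtain ⟨hw, ha, hh⟩ := Finset.mem_filter.1 hw
      obtain ⟨hw', ha', hh'⟩ := Finset.mem_filter.1 hw'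
      have hw := Finset.mem_range.1 hw
      have hw' := Finset.mem_range.1 hw'
      exact congrArg Fin.val (h.unique ⟨u, hu⟩ ⟨w, hw⟩ ⟨w', hw'⟩ ((hadj ⟨u, hu⟩ ⟨w, hw⟩).1 ha)
        ((hadj ⟨u, hu⟩ ⟨w', hw'⟩).1 ha') hh hh')
    · refine (h.cause ⟨u, hu⟩).imp_right (Or.imp_right ?_)
      rintro ⟨w, hw, hh⟩
      exact Finset.card_pos.2 ⟨w, Finset.mem_filter.2
        ⟨Finset.mem_range.2 w.isLt, (hadj ⟨u, hu⟩ w).2 hw, hh⟩⟩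
    · by_cases hmem : (⟨u, hu⟩ : Fin n) ∈ V'
      · exact Or.inr (h.target ⟨u, hu⟩ hmem)
      · left
        have := hV ⟨u, hu⟩
        rwa [if_neg hmem] at this

/-- A certificate that is minimum among those with small values gives an optimal solution, because
all solutions have such certificates. -/
theorem isMinPowerDom_of_cert {G : SimpleGraph (Fin n)} (hE : IsEdgeList G E) (hL : 1 ≤ L)
    {t f : ℕ → ℕ} (hc : (ofInput L K E V' B par ord idx).Cert t f)
    (hmin : ∀ t' f', (ofInput L K E V' B par ord idx).Cert t' f' → (∀ u, t' u < L + 3) →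
      (∀ u, f' u < L + 3) → ((Finset.range n).filter fun u => t u = 0).card ≤
        ((Finset.range n).filter fun u => t' u = 0).card) :
    IsMinPowerDom G V' L (Finset.univ.filter fun v : Fin n => t v = 0) := by
  have hcard : ∀ t : ℕ → ℕ, ((Finset.range n).filter fun u => t u = 0).card =
      (Finset.univ.filter fun v : Fin n => t v = 0).card := by
    intro t
    rw [Finset.card_filter, Finset.card_filter]
    exact (Fin.sum_univ_eq_sum_range (fun u => if t u = 0 then 1 else 0) n).symm
  have hc' := (ofInput_cert_iff hE).1 hc
  refine ⟨fun u hu => ?_, fun S' hS' => ?_⟩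
  · exact hc'.mem_powerDom (by simp) L u (hc'.target u hu) le_rfl hL
  · obtain ⟨t', f', h', h0, ht', hf'⟩ := exists_isCert hS'
    let ext : (Fin n → ℕ) → ℕ → ℕ := fun g u => if h : u < n then g ⟨u, h⟩ else 0
    have hext : ∀ g : Fin n → ℕ, (fun v : Fin n => ext g v) = g := by
      intro g; funext v; simp [ext]
    have hlt : ∀ g : Fin n → ℕ, (∀ v, g v ≤ L + 2) → ∀ u, ext g u < L + 3 := by
      intro g hg u
      simp only [ext]
      split_ifs with hu
      · have := hg ⟨u, hu⟩; omega
      · omega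
    have := hmin (ext t') (ext f') ((ofInput_cert_iff hE).2 (by rwa [hext, hext]))
      (hlt t' fun v => (ht' v).trans (by omega)) (hlt f' hf')
    rw [hcard, hcard] at this
    refine this.trans (le_of_eq (congrArg _ ?_))
    ext v
    simp [ext, h0]

/-- The set of all vertices is a solution. -/
theorem exists_ofInput_cert {G : SimpleGraph (Fin n)} (hE : IsEdgeList G E) :
    ∃ t f, (ofInput L K E V' B par ord idx).Cert t f ∧ (∀ u, t u < L + 3) ∧
      ∀ u, f u < L + 3 := by
  refine ⟨fun _ => 0, fun _ => 1, (ofInput_cert_iff hE).2 ⟨fun _ => by simp, ?_, ?_, ?_⟩, ?_, ?_⟩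
  · intro u w w' _ _ h; simp at h
  · intro u; exact Or.inl rfl
  · intro u _; simp
  · intro u; simp
  · intro u; simp

end ofInput

end Inst

namespace RAM

/-! ### The whole program -/

theorem Agree.seq {p q : Prog} {σ σ' σ'' : State} (h : Agree p σ σ') (h' : Agree q σ' σ'') :
    Agree (p ;; q) σ σ'' :=
  (h.mono (by simp +contextual [Prog.wr]) (by simp +contextual [Prog.wa])).trans
    (h'.mono (by simp +contextual [Prog.wr]) (by simp +contextual [Prog.wa]))

/-- In a postcondition, the frame of the program may be assumed. -/
theorem Runs.frame {p : Prog} {σ : State} {T : ℕ} {Q : State → Prop}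
    (h : Runs p σ T fun σ' => Agree p σ σ' → Q σ') : Runs p σ T Q :=
  h.mono le_rfl fun _ hA hQ => hQ hA

/-- Computes the tables that describe the graph and the bags. -/
def layoutP : Prog :=
  widthP ;; paramP ;; mulP 8 (.reg 2 + .reg 0) (.reg 0) ;; adjP ;; posP

/-- An upper bound for the running time of `layoutP`. -/
def layoutTime (n N m K : ℕ) : ℕ :=
  (N + 1) * (widthBody.size + 12) + (paramP.size +
    ((N + n + 1) * ((mulBody 8 (.reg 0)).size + 14) + ((m + 1) * (adjBody.size + 12) +
      (N + 1) * ((K + 1) * (posBody.size + ((bagLo 10).cost + (bagHi 10).cost + 10)) + 12))))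

theorem layoutP_runs {σ : State} {n N m ℓ K : ℕ} (h0 : σ.reg 0 = n) (h1 : σ.reg 1 = m)
    (h2 : σ.reg 2 = N) (h4 : σ.reg 4 = ℓ) (h5 : σ.reg 5 = 0) (h8 : σ.arr 8 = fun _ => 0)
    (h9 : σ.arr 9 = fun _ => 0) (h10 : σ.arr 10 = fun _ => 0)
    (hE : ∀ e < m, σ.arr 0 e < n ∧ σ.arr 1 e < n)
    (hoff : ∀ j < N, σ.arr 5 j ≤ σ.arr 5 (j + 1))
    (hK : ((Finset.range N).sup fun j => σ.arr 5 (j + 1) - σ.arr 5 j) = K)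
    (hbag : ∀ j < N, ∀ x ∈ Finset.Ico (σ.arr 5 j) (σ.arr 5 (j + 1)), σ.arr 6 x < n) :
    Runs layoutP σ (layoutTime n N m K) (fun σ' =>
      σ'.reg 4 = (if K < 2 then 1 else ℓ) ∧ σ'.reg 5 = K ∧
      σ'.reg 6 = (if K < 2 then 1 else ℓ) + 3 ∧ σ'.reg 8 = 2 * K ∧ σ'.reg 9 = 3 * K ∧
      (∀ j ≤ N + 1, σ'.arr 5 j = σ.arr 5 (min j N)) ∧
      (∀ j ≤ N + n, σ'.arr 8 j = j * n) ∧
      (∀ u < n, ∀ w < n, σ'.arr 9 (u * n + w) = ∑ e ∈ Finset.range m,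
        ((if σ.arr 0 e = u ∧ σ.arr 1 e = w then 1 else 0) +
          if σ.arr 1 e = u ∧ σ.arr 0 e = w then 1 else 0)) ∧
      ∀ j ≤ N, ∀ u < n, σ'.arr 10 (j * n + u) =
        ∑ x ∈ Finset.Ico (σ.arr 5 (min j N)) (σ.arr 5 (min (j + 1) N)),
          if σ.arr 6 x = u then x + 1 - σ.arr 5 (min j N) else 0) := by
  obtain ⟨L, hL⟩ : ∃ L, L = if K < 2 then 1 else ℓ := ⟨_, rfl⟩
  rw [← hL]
  have hsup : ∀ j < N, σ.arr 5 (j + 1) ≤ σ.arr 5 j + K := by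
    intro j hj
    have := Finset.le_sup (f := fun j => σ.arr 5 (j + 1) - σ.arr 5 j) (Finset.mem_range.2 hj)
    simp only [hK] at this
    omega
  have hpair : ∀ {a b u w : ℕ}, b < n → w < n → (a * n + b = u * n + w ↔ a = u ∧ b = w) :=
    fun hb hw => ⟨addr_inj hb hw, fun h => by rw [h.1, h.2]⟩
  refine ((widthP_runs h5).mono (by rw [h2]) fun _ _ h => h).seq ?_
  intro σ₁ hA₁ e5
  rw [h2, hK] at e5
  have e2 : σ₁.reg 2 = N := (hA₁.reg 2 (by rfl)).trans h2
  have e4 : σ₁.reg 4 = ℓ := (hA₁.reg 4 (by rfl)).trans h4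
  have a5 : σ₁.arr 5 = σ.arr 5 := hA₁.arr 5 (by rfl)
  refine Runs.frame ((Runs.flat (Q := fun σ' => σ'.reg 4 = L ∧ σ'.reg 5 = K ∧ σ'.reg 6 = L + 3 ∧
    σ'.reg 8 = 2 * K ∧ σ'.reg 9 = 3 * K ∧
    σ'.arr 5 = Function.update (σ.arr 5) (N + 1) (σ.arr 5 N)) (by rfl) le_rfl ?_).seq ?_)
  · by_cases hK2 : K < 2
    · simp [paramP, Prog.den, e2, e5, a5, hK2, hL, two_mul, Nat.succ_mul]
    · simp [paramP, Prog.den, e2, e4, e5, a5, hK2, hL, two_mul, Nat.succ_mul]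
  rintro σ₂ hA₂ ⟨f4, f5, f6, f8, f9, b5⟩
  have hP₂ := hA₁.seq hA₂
  have f0 : σ₂.reg 0 = n := (hP₂.reg 0 (by rfl)).trans h0
  have f2 : σ₂.reg 2 = N := (hP₂.reg 2 (by rfl)).trans h2
  have hb : ∀ j ≤ N, σ₂.arr 5 j = σ.arr 5 j := fun j hj => by
    rw [b5, Function.update_of_ne (by omega)]
  refine Runs.frame (((mulP_runs (σ := σ₂) (a := 8) (m := N + n) (v := n) (b := .reg 2 + .reg 0)
    (e := .reg 0) ((hP₂.arr 8 (by rfl)).trans h8) ?_ ?_).mono le_rfl fun _ _ h => h).seq ?_)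
  · intro σ' hA
    simp [(hA.reg 2 (by rfl)).trans f2, (hA.reg 0 (by rfl)).trans f0]
  · intro σ' hA
    exact (hA.reg 0 (by rfl)).trans f0
  intro σ₃ hA₃ g8
  have hP₃ := hP₂.seq hA₃
  have i0 : σ₃.arr 0 = σ.arr 0 := hP₃.arr 0 (by rfl)
  have i1 : σ₃.arr 1 = σ.arr 1 := hP₃.arr 1 (by rfl)
  have g1 : σ₃.reg 1 = m := (hP₃.reg 1 (by rfl)).trans h1
  refine Runs.frame (((adjP_runs ((hP₃.arr 9 (by rfl)).trans h9)).mono (by rw [g1])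
    fun _ _ h => h).seq ?_)
  intro σ₄ hA₄ k9
  rw [g1, i0, i1] at k9
  have hP₄ := hP₃.seq hA₄
  have k2 : σ₄.reg 2 = N := (hP₄.reg 2 (by rfl)).trans h2
  have k5 : ∀ j ≤ N, σ₄.arr 5 j = σ.arr 5 j := fun j hj => by
    rw [hA₄.arr 5 (by rfl), hA₃.arr 5 (by rfl), hb j hj]
  have k6 : σ₄.arr 6 = σ.arr 6 := hP₄.arr 6 (by rfl)
  have k8 : ∀ j ≤ N + n, σ₄.arr 8 j = j * n := fun j hj => by
    rw [hA₄.arr 8 (by rfl), g8 j hj]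
  refine Runs.frame ((posP_runs (K := K) ((hP₄.arr 10 (by rfl)).trans h10) ?_ ?_).mono
    (by rw [k2]) ?_)
  · intro j hj
    rw [k2] at hj
    rw [k5 j hj.le, k5 (j + 1) hj]
    exact hoff j hj
  · intro j hj
    rw [k2] at hj
    rw [k5 j hj.le, k5 (j + 1) hj]
    exact hsup j hj
  intro σ₅ _ l10 hB₄ hB₃ hB₂ hB₁
  refine ⟨(hB₂.reg 4 (by rfl)).trans f4, (hB₂.reg 5 (by rfl)).trans f5,
    (hB₂.reg 6 (by rfl)).trans f6, (hB₂.reg 8 (by rfl)).trans f8, (hB₂.reg 9 (by rfl)).trans f9,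
    fun j hj => ?_, fun j hj => ?_, fun u hu w hw => ?_, fun j hj u hu => ?_⟩
  · rw [hB₂.arr 5 (by rfl)]
    rcases hj.lt_or_eq with hlt | rfl
    · rw [hb j (by omega), min_eq_left (by omega)]
    · rw [b5, Function.update_self, min_eq_right (by omega)]
  · rw [hB₃.arr 8 (by rfl), g8 j hj]
  · rw [hB₄.arr 9 (by rfl), k9]
    refine Finset.sum_congr rfl fun e he => ?_
    obtain ⟨he0, he1⟩ := hE e (Finset.mem_range.1 he)
    rw [g8 _ (by omega), g8 _ (by omega), if_congr (hpair he1 hw) rfl rfl,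
      if_congr (hpair he0 hw) rfl rfl]
  · rw [l10, k2]
    beta_reduce
    -- only the bag of `j` itself contributes
    have hterm : ∀ j' < N, ∀ x ∈ Finset.Ico (σ₄.arr 5 j') (σ₄.arr 5 (j' + 1)),
        (if σ₄.arr 8 j' + σ₄.arr 6 x = j * n + u then x + 1 - σ₄.arr 5 j' else 0) =
          if j' = j ∧ σ.arr 6 x = u then x + 1 - σ.arr 5 j' else 0 := by
      intro j' hj' x hx
      rw [k5 j' hj'.le, k5 (j' + 1) hj'] at hx
      rw [k5 j' hj'.le, k8 j' (by omega), k6]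
      exact if_congr (hpair (hbag j' hj' x hx) hu) rfl rfl
    rw [Finset.sum_congr rfl fun j' hj' => Finset.sum_congr rfl (hterm j' (Finset.mem_range.1 hj'))]
    rcases hj.lt_or_eq with hlt | rfl
    · rw [Finset.sum_eq_single_of_mem j (Finset.mem_range.2 hlt) fun j' _ hne =>
        Finset.sum_eq_zero fun x _ => if_neg fun h => hne h.1]
      rw [k5 j hj, k5 (j + 1) hlt, min_eq_left hj, min_eq_left (show j + 1 ≤ N from hlt)]
      simp
    · rw [min_self, min_eq_right (by omega), Finset.Ico_self, Finset.sum_empty]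
      exact Finset.sum_eq_zero fun j' hj' => Finset.sum_eq_zero fun x _ =>
        if_neg fun h => (Finset.mem_range.1 hj').ne h.1

/-- Computes the tables that describe the states, and the initial tables. -/
def codeP : Prog :=
  powP ;; mulP 11 (.reg 2 + .reg 2 + .reg 9 + .reg 5 + .lit 1) (.reg 7) ;; divP ;; digitP ;; initP

/-- An upper bound for the running time of `codeP`. -/
def codeTime (N K B M : ℕ) : ℕ :=
  (3 + ((4 * K + 2) * ((2 + ((B + 1) * (powInner.size + 12) + powTail.size)) + 16) + 14)) +
    ((2 * N + (4 * K + 1) + 1) * ((mulBody 11 (.reg 7)).size + 20) +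
      ((M + 1) * (divBody.size + 12) +
        ((M + 1) * ((2 + (4 * K + 2) * (digitBody.size + 16)) + 12) +
          (N + 2) * ((M + 1) * (initBody.size + 12) + 14))))

theorem codeP_runs {σ : State} {n N K B M : ℕ} (hB : 0 < B) (hM : B ^ (4 * K + 1) = M)
    (h0 : σ.reg 0 = n) (h2 : σ.reg 2 = N) (h5 : σ.reg 5 = K) (h6 : σ.reg 6 = B)
    (h8 : σ.reg 8 = 2 * K) (h9 : σ.reg 9 = 3 * K) (h11 : σ.arr 11 = fun _ => 0)
    (h15 : σ.arr 15 = fun _ => 0) (h21 : σ.arr 21 = fun _ => 0) (h22 : σ.arr 22 = fun _ => 0) :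
    Runs codeP σ (codeTime N K B M) (fun σ' => σ'.reg 7 = M ∧
      (∀ j ≤ 2 * N + (4 * K + 1), σ'.arr 11 j = j * M) ∧
      (∀ z < 4 * K + 1, ∀ s < M, σ'.arr 12 (z * M + s) = s / B ^ z % B) ∧
      ∀ q ≤ N, ∀ s < M, σ'.arr 15 (q * M + s) = if s < B ^ (2 * K + 1) then n + 1 else 0) := by
  refine (powP_runs h5 h6 h8 h9).seq ?_
  rintro σ₁ hA₁ ⟨e7, e29⟩
  rw [hM] at e7
  have e2 : σ₁.reg 2 = N := (hA₁.reg 2 (by rfl)).trans h2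
  have e5 : σ₁.reg 5 = K := (hA₁.reg 5 (by rfl)).trans h5
  have e9 : σ₁.reg 9 = 3 * K := (hA₁.reg 9 (by rfl)).trans h9
  refine Runs.frame (((mulP_runs (σ := σ₁) (a := 11) (m := 2 * N + (4 * K + 1)) (v := M)
    (b := .reg 2 + .reg 2 + .reg 9 + .reg 5 + .lit 1) (e := .reg 7)
    ((hA₁.arr 11 (by rfl)).trans h11) ?_ ?_).mono le_rfl fun _ _ h => h).seq ?_)
  · intro σ' hA
    simp only [Expr.eval_add, Expr.eval_reg, Expr.eval_lit, (hA.reg 2 (by rfl)).trans e2,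
      (hA.reg 5 (by rfl)).trans e5, (hA.reg 9 (by rfl)).trans e9]
    omega
  · intro σ' hA
    exact (hA.reg 7 (by rfl)).trans e7
  intro σ₂ hA₂ f11
  have hP₂ := hA₁.seq hA₂
  have f7 : σ₂.reg 7 = M := (hA₂.reg 7 (by rfl)).trans e7
  refine Runs.frame (((divP_runs hB ((hP₂.reg 6 (by rfl)).trans h6)
    ((hP₂.arr 21 (by rfl)).trans h21) ((hP₂.arr 22 (by rfl)).trans h22)).mono (by rw [f7])
    fun _ _ h => h).seq ?_)
  intro σ₃ hA₃ g
  rw [f7] at g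
  have hP₃ := hP₂.seq hA₃
  refine Runs.frame (((digitP_runs (K := K) (B := B) (M := M) ((hP₃.reg 5 (by rfl)).trans h5)
    ((hP₃.reg 9 (by rfl)).trans h9) ((hA₃.reg 7 (by rfl)).trans f7) (fun z hz => ?_) g).mono
    le_rfl fun _ _ h => h).seq ?_)
  · rw [hA₃.arr 11 (by rfl), f11 z (by omega)]
  intro σ₄ hA₄ k12
  have hP₄ := hP₃.seq hA₄
  refine Runs.frame ((initP_runs (N := N) (M := M) (Q := B ^ (2 * K + 1)) (n := n)
    ((hP₄.reg 0 (by rfl)).trans h0) ((hP₄.reg 2 (by rfl)).trans h2) ?_ ?_ (fun j hj => ?_)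
    ((hP₄.arr 15 (by rfl)).trans h15)).mono le_rfl ?_)
  · rw [hA₄.reg 29 (by rfl), hA₃.reg 29 (by rfl), hA₂.reg 29 (by rfl), e29]
  · rw [← hM]; exact Nat.pow_le_pow_right hB (by omega)
  · rw [hA₄.arr 11 (by rfl), hA₃.arr 11 (by rfl), f11 j (by omega)]
  intro σ₅ _ l15 hB₄ hB₃ hB₂ hB₁
  exact ⟨(hB₁.reg 7 (by rfl)).trans e7, fun j hj => by rw [hB₂.arr 11 (by rfl), f11 j hj],
    fun z hz s hs => by rw [hB₄.arr 12 (by rfl), k12 z hz s hs], l15⟩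

/-- The algorithm. -/
def mainP : Prog := layoutP ;; codeP ;; treeP ;; dpP ;; traceP ;; outP

/-- An upper bound for the running time of `treeP`. -/
def treeTime (N F : ℕ) : ℕ :=
  (F + 1) * (linkBody.size + 12) + 12 +
    (2 + (N + 1) * (leafBody.size + 12) + (N + 1) * (cutBody.size + 12))

/-- An upper bound for the running time of the algorithm. -/
def mainTime (n N m F K B M : ℕ) : ℕ :=
  layoutTime n N m K + (codeTime N K B M + (treeTime N F + (dpTime N K M +
    ((N + 1) * (traceBody.size + 12) + (N + 1) * ((K + 1) *
        (outBody.size + ((bagLo 11).cost + (bagHi 11).cost + 10)) + 12)))))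

/-- The algorithm computes an optimal solution for `L` rounds, where `L` is the number of rounds
after its replacement by one if no bag has two elements. -/
theorem mainP_runs {n N ℓ : ℕ} {G : SimpleGraph (Fin n)} {V' : Finset (Fin n)}
    {D : TreeDecomposition G (Fin N)} {E : List (Fin n × Fin n)} {F : List (Fin N × Fin N)}
    {B : Fin N → List (Fin n)} (hE : IsEdgeList G E) (hF : IsEdgeList D.tree F)
    (hB : IsBagList D B) {L K : ℕ} (hK : (Finset.univ.sup fun i => (D.bag i).card) = K)
    (hL : L = if K < 2 then 1 else ℓ) (hℓ : 1 ≤ ℓ) :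
    Runs mainP (inputState E V' ℓ F B)
      (mainTime n N E.length F.length K (L + 3) ((L + 3) ^ (4 * K + 1)))
      (fun σ' => ∃ S : Finset (Fin n), IsOutput σ' S ∧ IsMinPowerDom G V' L S) := by
  obtain ⟨par, dep, hr⟩ := D.isTree.exists_rooting
  obtain ⟨r⟩ := D.isTree.connected.nonempty
  have hN : 0 < N := r.pos
  obtain ⟨σ, hσ⟩ : ∃ σ, σ = inputState E V' ℓ F B := ⟨_, rfl⟩
  rw [← hσ]
  have r0 : σ.reg 0 = n := by rw [hσ]; rfl
  have r1 : σ.reg 1 = E.length := by rw [hσ]; rfl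
  have r2 : σ.reg 2 = N := by rw [hσ]; rfl
  have r3 : σ.reg 3 = F.length := by rw [hσ]; rfl
  have r4 : σ.reg 4 = ℓ := by rw [hσ]; rfl
  have r5 : σ.reg 5 = 0 := by rw [hσ]; rfl
  have a0 : σ.arr 0 = fun i => (E.map fun p => p.1.val).getD i 0 := by rw [hσ]; rfl
  have a1 : σ.arr 1 = fun i => (E.map fun p => p.2.val).getD i 0 := by rw [hσ]; rfl
  have a2 : σ.arr 2 = fun i => (List.ofFn fun v => if v ∈ V' then 1 else 0).getD i 0 := by
    rw [hσ]; rfl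
  have a3 : σ.arr 3 = fun i => (F.map fun p => p.1.val).getD i 0 := by rw [hσ]; rfl
  have a4 : σ.arr 4 = fun i => (F.map fun p => p.2.val).getD i 0 := by rw [hσ]; rfl
  have a5 : ∀ j ≤ N, σ.arr 5 j = bagStart B j := by
    intro j hj
    rw [hσ]
    show ((List.range (N + 1)).map (bagStart B)).getD j 0 = _
    rw [List.getD_eq_getElem?_getD, List.getElem?_map, List.getElem?_range (by omega)]
    rfl
  have a6 : σ.arr 6 = bagEntry B := by rw [hσ]; rfl
  have az : ∀ a, 7 ≤ a → σ.arr a = fun _ => 0 := by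
    intro a ha
    obtain ⟨b, rfl⟩ := Nat.exists_eq_add_of_le' ha
    rw [hσ]; rfl
  have hlen : ∀ q : Fin N, (B q).length = (D.bag q).card := by
    intro q
    rw [← List.toFinset_card_of_nodup (hB q).1]
    congr 1
    ext v
    rw [List.mem_toFinset, (hB q).2]
  have hdiff : ∀ q : Fin N, σ.arr 5 (q + 1) = σ.arr 5 q + (B q).length := by
    intro q
    rw [a5 _ q.isLt, a5 _ q.isLt.le, bagStart_succ]
  refine Runs.seq (layoutP_runs (n := n) (N := N) (m := E.length) (ℓ := ℓ) (K := K) r0 r1 r2 r4 r5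
    (az 8 (by omega)) (az 9 (by omega)) (az 10 (by omega)) ?_ ?_ ?_ ?_) ?_
  · intro e he
    rw [a0, a1]
    simp [List.getD_eq_getElem?_getD, he]
  · intro j hj
    rw [hdiff ⟨j, hj⟩]
    exact Nat.le_add_right _ _
  · rw [← hK]
    refine le_antisymm (Finset.sup_le fun j hj => ?_) (Finset.sup_le fun q _ => ?_)
    · have hj := Finset.mem_range.1 hj
      rw [hdiff ⟨j, hj⟩, Nat.add_sub_cancel_left, hlen]
      exact Finset.le_sup (f := fun i => (D.bag i).card) (Finset.mem_univ _)
    · have := Finset.le_sup (f := fun j => σ.arr 5 (j + 1) - σ.arr 5 j)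
        (Finset.mem_range.2 q.isLt)
      rwa [hdiff, Nat.add_sub_cancel_left, hlen] at this
  · intro j hj x hx
    rw [a5 j hj.le, a5 (j + 1) hj] at hx
    obtain ⟨i, hi, -, he⟩ := mem_Ico_bag B (q := ⟨j, hj⟩) hx
    rw [a6, he]
    exact Fin.isLt _
  rw [← hL]
  rintro σ₁ hA₁ ⟨e4, e5, e6, e8, e9, b5, b8, b9, b10⟩
  refine Runs.seq (codeP_runs (n := n) (N := N) (K := K) (B := L + 3) (by omega) rfl
    ((hA₁.reg 0 (by rfl)).trans r0) ((hA₁.reg 2 (by rfl)).trans r2) e5 e6 e8 e9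
    ((hA₁.arr 11 (by rfl)).trans (az 11 (by omega)))
    ((hA₁.arr 15 (by rfl)).trans (az 15 (by omega)))
    ((hA₁.arr 21 (by rfl)).trans (az 21 (by omega)))
    ((hA₁.arr 22 (by rfl)).trans (az 22 (by omega)))) ?_
  rintro σ₂ hA₂ ⟨f7, c11, c12, c15⟩
  have hP₂ := hA₁.seq hA₂
  refine Runs.seq (treeP_runs hr hF hN ((hP₂.reg 2 (by rfl)).trans r2)
    ((hP₂.reg 3 (by rfl)).trans r3) ((hP₂.arr 3 (by rfl)).trans a3)
    ((hP₂.arr 4 (by rfl)).trans a4) ((hP₂.arr 13 (by rfl)).trans (az 13 (by omega)))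
    ((hP₂.arr 20 (by rfl)).trans (az 20 (by omega)))) ?_
  rintro σ₃ hA₃ ⟨hord, g13⟩
  have hP₃ := hP₂.seq hA₃
  obtain ⟨idx, i1, i2, i3, i4, i5⟩ := hord.exists_idx fun q hq => hr.par_le hq
  obtain ⟨I, hI⟩ : ∃ I, I = Inst.ofInput L K E V' B par (σ₃.arr 14) idx := ⟨_, rfl⟩
  have hgood : I.Good := hI ▸ Inst.ofInput_good hE hB
    (fun q => by
      rw [hlen, ← hK]
      exact Finset.le_sup (f := fun i => (D.bag i).card) (Finset.mem_univ q))
    hr hord.lt i1 i2 i3 i4 i5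
  have hready : Ready I σ₃ := by
    have hA := hA₂.seq hA₃
    rw [hI]
    constructor
    · exact (hP₃.reg 0 (by rfl)).trans r0
    · exact (hP₃.reg 2 (by rfl)).trans r2
    · exact (hA.reg 4 (by rfl)).trans e4
    · exact (hA.reg 5 (by rfl)).trans e5
    · exact (hA₃.reg 7 (by rfl)).trans f7
    · exact (hA.reg 8 (by rfl)).trans e8
    · exact (hA.reg 9 (by rfl)).trans e9
    · intro u _
      rw [hP₃.arr 2 (by rfl), a2]
      rfl
    · intro j hj
      rw [hA.arr 5 (by rfl), b5 j hj, a5 _ (min_le_right _ _)]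
      rfl
    · exact (hP₃.arr 6 (by rfl)).trans a6
    · intro j hj
      rw [hA.arr 8 (by rfl), b8 j hj]
      rfl
    · intro u hu w hw
      rw [hA.arr 9 (by rfl)]
      refine (b9 u hu w hw).trans ?_
      rw [a0, a1]
      rfl
    · intro j hj u hu
      rw [hA.arr 10 (by rfl)]
      refine (b10 j hj u hu).trans ?_
      rw [a5 _ (min_le_right _ _), a5 _ (min_le_right _ _), a6]
      rfl
    · intro j hj
      rw [hA₃.arr 11 (by rfl)]
      exact c11 j hj
    · intro z hz s hs
      rw [hA₃.arr 12 (by rfl)]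
      exact c12 z hz s hs
    · exact g13
    · exact fun i _ => rfl
  have hIn : I.n = n := by rw [hI]; rfl
  have hIN : I.N = N := by rw [hI]; rfl
  have hIK : I.K = K := by rw [hI]; rfl
  have hIB : I.B = L + 3 := by rw [hI]; rfl
  have hIM : I.M = (L + 3) ^ (4 * K + 1) := by rw [Inst.M, hIB, hIK]
  have hL1 : 1 ≤ L := by rw [hL]; split_ifs <;> omega
  refine Runs.seq ((dpP_runs hgood hready fun q hq s hs => ?_).mono (by rw [hIN, hIK, hIM])
    fun _ _ h => h) ?_
  · rw [hA₃.arr 15 (by rfl), hIM]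
    rw [hIM] at hs
    rw [c15 q (hIN ▸ hq) s hs, Inst.tab, hIB, hIK, hIn]
  intro σ₄ hA₄ hptr
  have hready₄ := hready.agree hA₄ (by rfl)
  have hP₄ := hP₃.seq hA₄
  obtain ⟨t, f, hc, hM, hlab, hmin⟩ := hptr.optimal hgood (by
    rw [hIB, hI]; exact Inst.exists_ofInput_cert hE)
  refine Runs.seq ((traceP_runs hgood hready₄ ((hP₄.arr 19 (by rfl)).trans
    (az 19 (by omega)))).mono (by rw [hIN]) fun _ _ h => h) ?_
  intro σ₅ hA₅ k19
  have hready₅ := hready₄.agree hA₅ (by rfl)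
  refine (outP_runs hgood hready₅ (t := t) (fun q hq => ?_) fun q hq u hu => ?_).mono
    (by rw [hIN, hIK]) ?_
  · rw [k19]; exact hM q hq.le
  · rw [k19]; exact hlab q hq u hu
  rintro σ₆ - h7
  refine ⟨Finset.univ.filter fun v : Fin n => t v = 0, fun v => ?_, ?_⟩
  · obtain ⟨q, hq⟩ := D.exists_mem_bag v
    rw [h7 q (by rw [hIN]; exact q.isLt) v
      (by rw [hI]; exact (Inst.mem_ofInput_X hB).2 ⟨v, hq, rfl⟩)]
    simp
  · rw [hIB, hIn] at hmin
    rw [hI] at hc hmin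
    exact Inst.isMinPowerDom_of_cert hE hL1 hc hmin

end RAM

namespace RAM

/-! ### The running time -/

/-- The quantities on which the running time depends, with the inequalities that are needed to
express it by the size of the input and the number of states. -/
structure Sizes where
  n : ℕ
  N : ℕ
  m : ℕ
  F : ℕ
  K : ℕ
  B : ℕ
  M : ℕ
  K_le : K + 1 ≤ M
  B_le : B ≤ M

/-- The size of the input, up to the bag lists. -/
def Sizes.Z (s : Sizes) : ℕ := s.n + s.N + s.m + s.F + 1

/-- `f` is bounded by a constant multiple of `Z ^ i * M ^ j`. -/
def Dom (i j : ℕ) (f : Sizes → ℕ) : Prop := ∃ C, ∀ s, f s ≤ C * (s.Z ^ i * s.M ^ j)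

namespace Dom
variable {i j i' j' : ℕ} {f g : Sizes → ℕ}

theorem mono (h : Dom i j f) (hi : i ≤ i') (hj : j ≤ j') : Dom i' j' f := by
  obtain ⟨C, h⟩ := h
  refine ⟨C, fun s => (h s).trans ?_⟩
  have hM : 0 < s.M := by have := s.K_le; omega
  have hZ : 0 < s.Z := by simp [Sizes.Z]
  exact Nat.mul_le_mul_left _ (Nat.mul_le_mul (Nat.pow_le_pow_right hZ hi)
    (Nat.pow_le_pow_right hM hj))

theorem const (c : ℕ) : Dom 0 0 fun _ => c := ⟨c, fun s => by simp⟩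

theorem add (h : Dom i j f) (h' : Dom i' j' g) :
    Dom (max i i') (max j j') fun s => f s + g s := by
  obtain ⟨C, h⟩ := h.mono (le_max_left i i') (le_max_left j j')
  obtain ⟨C', h'⟩ := h'.mono (le_max_right i i') (le_max_right j j')
  exact ⟨C + C', fun s => by rw [Nat.add_mul]; exact Nat.add_le_add (h s) (h' s)⟩

theorem mul (h : Dom i j f) (h' : Dom i' j' g) : Dom (i + i') (j + j') fun s => f s * g s := by
  obtain ⟨C, h⟩ := h
  obtain ⟨C', h'⟩ := h'
  refine ⟨C * C', fun s => (Nat.mul_le_mul (h s) (h' s)).trans (le_of_eq ?_)⟩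
  ring

theorem n : Dom 1 0 Sizes.n := ⟨1, fun s => by simp only [Sizes.Z, pow_one, pow_zero]; omega⟩
theorem N : Dom 1 0 Sizes.N := ⟨1, fun s => by simp only [Sizes.Z, pow_one, pow_zero]; omega⟩
theorem m : Dom 1 0 Sizes.m := ⟨1, fun s => by simp only [Sizes.Z, pow_one, pow_zero]; omega⟩
theorem F : Dom 1 0 Sizes.F := ⟨1, fun s => by simp only [Sizes.Z, pow_one, pow_zero]; omega⟩
theorem K : Dom 0 1 Sizes.K := ⟨1, fun s => by have := s.K_le; simp only [pow_one, pow_zero]; omega⟩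
theorem B : Dom 0 1 Sizes.B := ⟨1, fun s => by have := s.B_le; simp only [pow_one, pow_zero]; omega⟩
theorem M : Dom 0 1 Sizes.M := ⟨1, fun s => by simp⟩

/- In the proofs below, the bounds are decomposed into sums and products of the quantities. They
contain the sizes of fixed pieces of the program, which must be recognized as constants without
being unfolded; this is why definitions are not unfolded in the search. -/
theorem layoutTime : Dom 1 1 fun s => RAM.layoutTime s.n s.N s.m s.K := by
  unfold RAM.layoutTime
  apply mono
  · repeat' with_reducible first
      | exact const _ | exact n | exact N | exact m | exact K | apply add | apply mul
  · decide
  · decide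

theorem codeTime : Dom 1 2 fun s => RAM.codeTime s.N s.K s.B s.M := by
  unfold RAM.codeTime
  apply mono
  · repeat' with_reducible first
      | exact const _ | exact N | exact K | exact B | exact M | apply add | apply mul
  · decide
  · decide

theorem treeTime : Dom 1 0 fun s => RAM.treeTime s.N s.F := by
  unfold RAM.treeTime
  apply mono
  · repeat' with_reducible first
      | exact const _ | exact N | exact F | apply add | apply mul
  · decide
  · decide

theorem dpTime : Dom 1 5 fun s => RAM.dpTime s.N s.K s.M := by
  unfold RAM.dpTime RAM.mergeTime RAM.stateTime RAM.checkTime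
  apply mono
  · repeat' with_reducible first
      | exact const _ | exact N | exact K | exact M | apply add | apply mul
  · decide
  · decide

theorem mainTime : Dom 1 5 fun s => RAM.mainTime s.n s.N s.m s.F s.K s.B s.M := by
  unfold RAM.mainTime
  apply mono
  · repeat' with_reducible first
      | exact layoutTime | exact codeTime | exact treeTime | exact dpTime | exact const _
      | exact N | exact K | apply add | apply mul
  · decide
  · decide

end Dom

end RAM

/-! ### Counting edges and states -/

section counts
variable {n N : ℕ} {G : SimpleGraph (Fin n)} {D : TreeDecomposition G (Fin N)}

theorem length_edgeList_tree {F : List (Fin N × Fin N)} (hF : IsEdgeList D.tree F) :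
    F.length ≤ N := by
  classical
  have h := D.isTree.card_edgeFinset
  have he : (F.map fun p => s(p.1, p.2)).toFinset = D.tree.edgeFinset := by
    ext e
    rw [List.mem_toFinset, ← hF.2, SimpleGraph.mem_edgeFinset]
  rw [← he, List.toFinset_card_of_nodup hF.1, List.length_map, Fintype.card_fin] at h
  omega

/-- Every edge lies in a bag. -/
theorem length_edgeList_le {E : List (Fin n × Fin n)} (hE : IsEdgeList G E) {K : ℕ}
    (hK : (Finset.univ.sup fun i => (D.bag i).card) = K) : E.length ≤ N * (K * K) := by
  classical
  have hsub : (E.map fun p => s(p.1, p.2)).toFinset ⊆ Finset.univ.biUnion fun i : Fin N =>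
      (D.bag i ×ˢ D.bag i).image fun p => s(p.1, p.2) := by
    intro e he
    rw [List.mem_toFinset, ← hE.2] at he
    induction e with
    | _ u v =>
      obtain ⟨i, hu, hv⟩ := D.exists_adj_bag u v he
      exact Finset.mem_biUnion.2 ⟨i, Finset.mem_univ _, Finset.mem_image.2
        ⟨(u, v), Finset.mem_product.2 ⟨hu, hv⟩, rfl⟩⟩
  have hcard := Finset.card_le_card hsub
  rw [List.toFinset_card_of_nodup hE.1, List.length_map] at hcard
  refine hcard.trans ((Finset.card_biUnion_le_card_mul _ _ (K * K) fun i _ => ?_).trans (by simp))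
  refine Finset.card_image_le.trans ?_
  rw [Finset.card_product]
  have : (D.bag i).card ≤ K := hK ▸ Finset.le_sup (f := fun i => (D.bag i).card) (Finset.mem_univ i)
  exact Nat.mul_le_mul this this

theorem powerDom_eq_of_bags_lt_two (h : (Finset.univ.sup fun i => (D.bag i).card) < 2)
    (S : Set (Fin n)) {r : ℕ} (hr : 1 ≤ r) : powerDom G S r = powerDom G S 1 := by
  refine powerDom_eq_of_no_edges (fun u v huv => ?_) S hr
  obtain ⟨i, hu, hv⟩ := D.exists_adj_bag u v huv
  have := Finset.le_sup (f := fun i => (D.bag i).card) (Finset.mem_univ i)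
  exact huv.ne (Finset.card_le_one.1 (by omega) u hu v hv)

end counts

/-- The number of states is single exponential in `k * log (ℓ + 1)`, where `k = K - 1`. Seven powers
of it are needed: five for the dynamic program and two for the number of edges in a bag. For `K < 2`
there are at most `4 ^ 5` states. For larger `K`, the number is at most
`(ℓ + 1) ^ (2 * (4 * K + 1))`, where `2 * (4 * K + 1) ≤ 18 * (K - 1)`, and `126 = 7 * 18`. -/
theorem states_le {K ℓ L : ℕ} (hℓ : 1 ≤ ℓ) (hL : L = if K < 2 then 1 else ℓ) :
    (((L + 3) ^ (4 * K + 1) : ℕ) : ℝ) ^ 7 ≤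
      4 ^ 35 * Real.exp 126 ^ (((K - 1 : ℕ) : ℝ) * Real.log ((ℓ : ℝ) + 1)) := by
  have hlog : 0 ≤ Real.log ((ℓ : ℝ) + 1) := Real.log_nonneg (by simp)
  have hc : (1 : ℝ) ≤ Real.exp 126 := Real.one_le_exp (by norm_num)
  have h1 : 1 ≤ Real.exp 126 ^ (((K - 1 : ℕ) : ℝ) * Real.log ((ℓ : ℝ) + 1)) :=
    Real.one_le_rpow hc (by positivity)
  by_cases hK : K < 2
  · rw [if_pos hK] at hL
    subst hL
    have h2 : ((1 + 3) ^ (4 * K + 1) : ℕ) ≤ 4 ^ 5 := Nat.pow_le_pow_right (by norm_num) (by omega)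
    have h3 : (((1 + 3) ^ (4 * K + 1) : ℕ) : ℝ) ≤ 4 ^ 5 := by exact_mod_cast h2
    calc (((1 + 3) ^ (4 * K + 1) : ℕ) : ℝ) ^ 7 ≤ (4 ^ 5) ^ 7 := by gcongr
      _ = 4 ^ 35 * 1 := by norm_num
      _ ≤ _ := by gcongr
  · rw [if_neg hK] at hL
    subst hL
    obtain ⟨k, rfl⟩ : ∃ k, K = k + 2 := ⟨K - 2, by omega⟩
    have h2 : (L + 3) ^ (4 * (k + 2) + 1) ≤ (L + 1) ^ (18 * (k + 1)) := by
      calc (L + 3) ^ (4 * (k + 2) + 1) ≤ ((L + 1) ^ 2) ^ (4 * (k + 2) + 1) :=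
            Nat.pow_le_pow_left (by nlinarith) _
        _ = (L + 1) ^ (2 * (4 * (k + 2) + 1)) := by rw [← pow_mul]
        _ ≤ _ := Nat.pow_le_pow_right (by omega) (by omega)
    have h3 : (((L + 3) ^ (4 * (k + 2) + 1) : ℕ) : ℝ) ≤ ((L : ℝ) + 1) ^ (18 * (k + 1)) := by
      exact_mod_cast h2
    have h4 : Real.exp 126 ^ (((k + 2 - 1 : ℕ) : ℝ) * Real.log ((L : ℝ) + 1)) =
        (((L : ℝ) + 1) ^ (18 * (k + 1))) ^ 7 := by
      rw [← Real.exp_mul, ← pow_mul, ← Real.exp_log (show (0 : ℝ) < (L : ℝ) + 1 by positivity),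
        ← Real.exp_nat_mul, Real.log_exp]
      congr 1
      rw [show k + 2 - 1 = k + 1 by omega]
      push_cast
      ring
    rw [h4]
    calc (((L + 3) ^ (4 * (k + 2) + 1) : ℕ) : ℝ) ^ 7 ≤ (((L : ℝ) + 1) ^ (18 * (k + 1))) ^ 7 := by
          gcongr
      _ ≤ 4 ^ 35 * (((L : ℝ) + 1) ^ (18 * (k + 1))) ^ 7 :=
          le_mul_of_one_le_left (by positivity) (by norm_num)

theorem mainTheorem3 :
    ∃ (P : RAM.Prog) (c : ℝ), 1 < c ∧ ∀ a : ℕ, ∃ C : ℝ,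
      ∀ (n N ℓ : ℕ) (G : SimpleGraph (Fin n)) (V' : Finset (Fin n))
        (D : TreeDecomposition G (Fin N))
        (E : List (Fin n × Fin n)) (F : List (Fin N × Fin N)) (B : Fin N → List (Fin n)),
        1 ≤ n → 1 ≤ ℓ → N ≤ a * n →
        IsEdgeList G E → IsEdgeList D.tree F → IsBagList D B →
        ∃ (t : ℕ) (σ : RAM.State) (S : Finset (Fin n)),
          RAM.Exec P (inputState E V' ℓ F B) t σ ∧ IsOutput σ S ∧ IsMinPowerDom G V' ℓ S ∧
            (t : ℝ) ≤
              C * c ^ ((D.maxBagEdges : ℝ) + (D.width : ℝ) * Real.log ((ℓ : ℝ) + 1)) * (n : ℝ) := by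
  obtain ⟨C, hC⟩ := RAM.Dom.mainTime
  refine ⟨RAM.mainP, Real.exp 126, Real.one_lt_exp_iff.2 (by norm_num), fun a =>
    ⟨C * (3 * a + 2) * 4 ^ 35, ?_⟩⟩
  intro n N ℓ G V' D E F B hn hℓ hN hE hF hB
  obtain ⟨K, hK⟩ : ∃ K, (Finset.univ.sup fun i => (D.bag i).card) = K := ⟨_, rfl⟩
  obtain ⟨L, hL⟩ : ∃ L, L = if K < 2 then 1 else ℓ := ⟨_, rfl⟩
  obtain ⟨t, σ, hex, ht, S, hout, hS⟩ := RAM.mainP_runs (V' := V') hE hF hB hK hL hℓ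
  refine ⟨t, σ, S, hex, hout, ?_, ?_⟩
  · by_cases hK2 : K < 2
    -- without edges, the solutions for one round are the solutions for `ℓ` rounds
    · rw [if_pos hK2] at hL
      subst hL
      have h := fun S : Set (Fin n) => powerDom_eq_of_bags_lt_two (D := D) (hK ▸ hK2) S hℓ
      exact ⟨by rw [h]; exact hS.1, fun S' hS' => hS.2 S' (by rw [← h]; exact hS')⟩
    · rw [if_neg hK2] at hL
      exact hL ▸ hS
  · obtain ⟨M, hM⟩ : ∃ M, M = (L + 3) ^ (4 * K + 1) := ⟨_, rfl⟩
    have hBM : L + 3 ≤ M := hM ▸ Nat.le_self_pow (by omega) _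
    have hKM : K + 1 ≤ M := by
      have : 4 * K + 1 < (L + 3) ^ (4 * K + 1) := Nat.lt_pow_self (by omega)
      omega
    rw [← hM] at ht
    have hZ : n + N + E.length + F.length + 1 ≤ (3 * a + 2) * n * M ^ 2 := by
      have h1 := length_edgeList_tree hF
      have h2 : E.length ≤ a * n * M ^ 2 := (length_edgeList_le hE hK).trans
        (Nat.mul_le_mul hN (by rw [sq]; exact Nat.mul_le_mul (by omega) (by omega)))
      have h3 : 1 ≤ M ^ 2 := Nat.one_le_pow _ _ (by omega)
      have h4 : n + a * n + a * n + 1 ≤ (2 * a + 2) * n := by nlinarith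
      have h5 : (2 * a + 2) * n ≤ (2 * a + 2) * n * M ^ 2 := Nat.le_mul_of_pos_right _ h3
      calc n + N + E.length + F.length + 1 ≤ (2 * a + 2) * n * M ^ 2 + a * n * M ^ 2 := by omega
        _ = _ := by ring
    have htM : t ≤ C * (3 * a + 2) * n * M ^ 7 := by
      refine ht.trans ((hC ⟨n, N, E.length, F.length, K, L + 3, M, hKM, hBM⟩).trans ?_)
      simp only [RAM.Sizes.Z, pow_one]
      calc C * ((n + N + E.length + F.length + 1) * M ^ 5)
          ≤ C * ((3 * a + 2) * n * M ^ 2 * M ^ 5) := by gcongr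
        _ = _ := by ring
    have hstates := states_le (K := K) hℓ hL
    rw [← hM] at hstates
    have hw : D.width = K - 1 := by rw [TreeDecomposition.width, hK]
    have hexp : Real.exp 126 ^ (((K - 1 : ℕ) : ℝ) * Real.log ((ℓ : ℝ) + 1)) ≤
        Real.exp 126 ^ ((D.maxBagEdges : ℝ) + (D.width : ℝ) * Real.log ((ℓ : ℝ) + 1)) := by
      rw [hw]
      exact Real.rpow_le_rpow_of_exponent_le (Real.one_le_exp (by norm_num)) (by simp)
    calc (t : ℝ) ≤ ((C * (3 * a + 2) * n * M ^ 7 : ℕ) : ℝ) := by exact_mod_cast htM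
      _ = C * (3 * a + 2) * (M : ℝ) ^ 7 * n := by push_cast; ring
      _ ≤ C * (3 * a + 2) * (4 ^ 35 * Real.exp 126 ^ ((D.maxBagEdges : ℝ) +
          (D.width : ℝ) * Real.log ((ℓ : ℝ) + 1))) * n := by
        gcongr
        exact hstates.trans (by gcongr)
      _ = _ := by ring
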